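/- Let $\ell\ge 3$ be an integer, $\ell'=\ell/\gcd(\ell,2)$, and for $x\in\mathbb{C}$ put $\xi^x=e^{2\pi i x/\ell}$, $\xi=\xi^1$. Let $\mathcal{U}^K$ be the $\mathbb{C}$-algebra with generators $E$, $F$, $K^\alpha$ ($\alpha\in\mathbb{C}$) and relations $$K^\alpha K^\beta=K^{\alpha+\beta},\quad K^0=1,\quad K^\alpha EK^{-\alpha}=\xi^{2\alpha}E,\quad K^\alpha FK^{-\alpha}=\xi^{-2\alpha}F,\quad [E,F]=\frac{K-K^{-1}}{\xi-\xi^{-1}},\quad E^{\ell'}=F^{\ell'}=0 .$$ Let $G=\mathbb{C}/2\mathbb{Z}$ and $\mathbf{U}_a=\mathcal{U}^K/(K^{\ell/2}-\xi^{\ell a/2})$ for $a\in G$. The family $\mathbf{U}=\{\mathbf{U}_a\}_{a\in G}$ is a Hopf $G$-coalgebra, with algebra maps $\Delta_{a,b}:\mathbf{U}_{a+b}\to\mathbf{U}_a\otimes\mathbf{U}_b$, $\varepsilon:\mathbf{U}_0\to\mathbb{C}$ and bijective antipodes (anti-homomorphisms) $S_a:\mathbf{U}_a\to\mathbf{U}_{-a}$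 given by $$\Delta(E)=1\otimes E+E\otimes K,\quad \Delta(F)=K^{-1}\otimes F+F\otimes 1,\quad \Delta(K^\alpha)=K^\alpha\otimes K^\alpha,$$ $$\varepsilon(E)=\varepsilon(F)=0,\quad \varepsilon(K^\alpha)=1,\quad S(E)=-EK^{-1},\quad S(F)=-KF,\quad S(K^\alpha)=K^{-\alpha},$$ and it is pivotal with pivot $g_a=K^{1-\ell'}\in\mathbf{U}_a$. Let $\eta\in\mathbb{C}\setminus\{0\}$. (1) There is exactly one family of linear forms $\mu_a:\mathbf{U}_a\to\mathbb{C}$ ($a\in G$) such that $\mu_a(E^iF^jK^\alpha)=0$ if $i\ne\ell'-1$ or $j\neq\ell'-1$ or $\alpha\notin\frac{\ell}{2}\mathbb{Z}$, and $\mu_a(E^{\ell'-1}F^{\ell'-1}K^{n\ell/2})=\xi^{n\ell a/2}\,\eta$ for all $n\in\mathbb{Z}$. It is a symmetrized integral of $(\mathbf{U},g)$: for all $a,b\in G$, $$(\mu_a\otimes g_b)\Delta_{a,b}(x)=\mu_{a+b}(x)1_b\ \ (x\in \mathbf{U}_{a+b}),\qquad \mu_a(xy)=\mu_a(yx),\qquad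 \mu_{-a}(S_a(x))=\mu_a(x)\ \ (x,y\in \mathbf{U}_a).$$ (2) Let $G'=G\setminus\{\bar 0,\bar 1\}$ if $\ell$ is even and $G'=G\setminus\{\bar 0,\overline{1/2},\bar 1,\overline{3/2}\}$ if $\ell$ is odd. Let $\widetilde{\mathbf{U}}_a$ be the subalgebra of $\mathbf{U}_a$ generated by $E$, $F$ and $K$. For each $a\in G'$ there is a unique element $z_a$ of the center of $\widetilde{\mathbf{U}}_a$ such that $\mu_a(x)=\operatorname{tr}_{\widetilde{\mathbf{U}}_a}(L_{z_ax})$ for all $x\in\widetilde{\mathbf{U}}_a$, where $L_y$ is left multiplication by $y$. With these $z_a$, the maps $\mu'_a=\mu_a\circ L_{z_a}$, restricted to the center $C(\mathbf{U}_a)$ of $\mathbf{U}_a$, form a modified symmetrized integral on $G'$: for all $a,b\in G'$ one has $$\mu_aL_{g_a^{-1}}\otimes\mu'_b=\mu'_a\otimes\mu_bL_{g_b}$$ on the algebra $C(\mathbf{U}_a\otimes\mathbf{U}_b)$ of the elements of $\mathbf{U}_a\otimes\mathbf{U}_b$ that commute with $\Delta_{a,b}(\mathbf{U}_{a+b})$.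 (On this algebra the maps $\mu_aL_{g_a^{-1}}\otimes\mathrm{Id}$ and $\mathrm{Id}\otimes\mu_bL_{g_b}$ take values in $C(\mathbf{U}_b)$ and $C(\mathbf{U}_a)$, so both sides make sense.) -/

import Mathlib

open scoped TensorProduct

/-! ### Hopf `G`-coalgebras over an abelian group, in additive notation

To avoid transporting elements along equalities of degrees, the structure maps are indexed by
a degree together with a proof that it is the required sum or opposite: for `h : a + b = c` the
map `comul h` is `Δ_{a,b} : H_{a+b} → H_a ⊗ H_b`, and for `h : a + b = 0` the map `antipode h`
is `S_a : H_a → H_{-a}`. -/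

/-- A Hopf `G`-coalgebra with bijective antipode. -/
structure HopfGCoalgebra (k : Type*) {G : Type*} [CommRing k] [AddCommGroup G]
    (H : G → Type*) [∀ a, Ring (H a)] [∀ a, Algebra k (H a)] where
  comul : ∀ {a b c : G}, a + b = c → (H c →ₐ[k] H a ⊗[k] H b)
  counit : H 0 →ₐ[k] k
  antipode : ∀ {a b : G}, a + b = 0 → (H a →ₗ[k] H b)
  coassoc : ∀ {a b c ab bc abc : G} (h₁ : a + b = ab) (h₂ : ab + c = abc)
    (h₃ : b + c = bc) (h₄ : a + bc = abc) (x : H abc),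
    TensorProduct.assoc k (H a) (H b) (H c)
        ((comul h₁).toLinearMap.rTensor (H c) (comul h₂ x)) =
      (comul h₃).toLinearMap.lTensor (H a) (comul h₄ x)
  counit_right : ∀ (a : G) (x : H a),
    TensorProduct.rid k (H a) (counit.toLinearMap.lTensor (H a) (comul (add_zero a) x)) = x
  counit_left : ∀ (a : G) (x : H a),
    TensorProduct.lid k (H a) (counit.toLinearMap.rTensor (H a) (comul (zero_add a) x)) = x
  antipode_left : ∀ {a b : G} (h : a + b = 0) (x : H 0),
    LinearMap.mul' k (H b) ((antipode h).rTensor (H b) (comul h x)) =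
      algebraMap k (H b) (counit x)
  antipode_right : ∀ {a b : G} (h : a + b = 0) (h' : b + a = 0) (x : H 0),
    LinearMap.mul' k (H a) ((antipode h').lTensor (H a) (comul h x)) =
      algebraMap k (H a) (counit x)
  antipode_bijective : ∀ {a b : G} (h : a + b = 0), Function.Bijective (antipode h)

/-- A Hopf `G`-coalgebra together with a pivot: a `G`-grouplike family `g_a` such that
`S_{-a} S_a (x) = g_a x g_a⁻¹`. -/
structure PivotalHopfGCoalgebra (k : Type*) {G : Type*} [CommRing k] [AddCommGroup G]
    (H : G → Type*) [∀ a, Ring (H a)] [∀ a, Algebra k (H a)] extends HopfGCoalgebra k H where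
  pivot : ∀ a, (H a)ˣ
  comul_pivot : ∀ {a b c : G} (h : a + b = c),
    comul h (pivot c : H c) = (pivot a : H a) ⊗ₜ[k] (pivot b : H b)
  counit_pivot : counit (pivot 0 : H 0) = 1
  antipode_antipode : ∀ {a b : G} (h : a + b = 0) (h' : b + a = 0) (x : H a),
    antipode h' (antipode h x) = (pivot a : H a) * x * ((pivot a)⁻¹ : (H a)ˣ)

namespace PivotalHopfGCoalgebra

variable {k : Type*} {G : Type*} [CommRing k] [AddCommGroup G]
  {H : G → Type*} [∀ a, Ring (H a)] [∀ a, Algebra k (H a)]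

/-- For a linear form `f` on `A`, the map `f ⊗ Id : A ⊗ B → k ⊗ B = B`. -/
noncomputable def contractLeft {A B : Type*} [Ring A] [Algebra k A] [Ring B] [Algebra k B]
    (f : A →ₗ[k] k) : A ⊗[k] B →ₗ[k] B :=
  (TensorProduct.lid k B).toLinearMap ∘ₗ f.rTensor B

/-- For a linear form `f` on `B`, the map `Id ⊗ f : A ⊗ B → A ⊗ k = A`. -/
noncomputable def contractRight {A B : Type*} [Ring A] [Algebra k A] [Ring B] [Algebra k B]
    (f : B →ₗ[k] k) : A ⊗[k] B →ₗ[k] A :=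
  (TensorProduct.rid k A).toLinearMap ∘ₗ f.lTensor A

/-- Symmetrized integrals of a pivotal Hopf `G`-coalgebra: the first condition reads
`(μ_a ⊗ g_b) Δ_{a,b}(x) = μ_{a+b}(x) 1_b`. -/
structure IsSymmetrizedIntegral (P : PivotalHopfGCoalgebra k H)
    (μ : ∀ a, H a →ₗ[k] k) : Prop where
  integral : ∀ {a b c : G} (h : a + b = c) (x : H c),
    (P.pivot b : H b) * contractLeft (μ a) (P.comul h x) = μ c x • (1 : H b)
  cyclic : ∀ (a : G) (x y : H a), μ a (x * y) = μ a (y * x)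
  antipode : ∀ {a b : G} (h : a + b = 0) (x : H a), μ b (P.antipode h x) = μ a x

/-- `C(H_a ⊗ H_b)`: the elements commuting with the image of `Δ_{a,b}`. -/
noncomputable def commutant (P : PivotalHopfGCoalgebra k H) (a b : G) :
    Subalgebra k (H a ⊗[k] H b) :=
  Subalgebra.centralizer k (Set.range (P.comul (rfl : a + b = a + b)))

/-- Modified symmetrized integrals on `G'` (relative to `μ`): families `μ'_a : C(H_a) → k` with
`μ_a L_{g_a⁻¹} ⊗ μ'_b = μ'_a ⊗ μ_b L_{g_b}` on `C(H_a ⊗ H_b)`. Here `C(H_a)` is the center of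
`H_a`, and it is part of the condition that the two partial contractions do land in the centers
`C(H_b)` and `C(H_a)`, on which `μ'_b` and `μ'_a` are defined. -/
def IsModifiedSymmetrizedIntegral (P : PivotalHopfGCoalgebra k H)
    (μ : ∀ a, H a →ₗ[k] k) (G' : Set G)
    (μ' : ∀ a : G', Subalgebra.center k (H a) →ₗ[k] k) : Prop :=
  ∀ (a b : G'), ∀ x ∈ P.commutant (a : G) (b : G),
    ∃ (hl : contractLeft (μ a ∘ₗ LinearMap.mulLeft k (((P.pivot a)⁻¹ : (H a)ˣ) : H a)) x ∈
        Subalgebra.center k (H (b : G)))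
      (hr : contractRight (μ b ∘ₗ LinearMap.mulLeft k (P.pivot b : H b)) x ∈
        Subalgebra.center k (H (a : G))),
      μ' b ⟨_, hl⟩ = μ' a ⟨_, hr⟩

end PivotalHopfGCoalgebra

/-! ### The algebras -/

namespace QuantumSL2

/-- `ξ^x = exp(2 π i x / ℓ)`. -/
noncomputable def xi (ℓ : ℕ) (x : ℂ) : ℂ := Complex.exp (2 * Real.pi * Complex.I * x / ℓ)

/-- `ℓ' = ℓ / gcd(ℓ, 2)`. -/
def ell' (ℓ : ℕ) : ℕ := ℓ / Nat.gcd ℓ 2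

/-- The grading group `ℂ / 2ℤ`. -/
abbrev Deg : Type := ℂ ⧸ AddSubgroup.zmultiples (2 : ℂ)

/-- The generators `E`, `F`, `K^α` (`α ∈ ℂ`). -/
inductive Gen : Type
  | E : Gen
  | F : Gen
  | K : ℂ → Gen

open FreeAlgebra in
/-- The defining relations of the algebra `𝒰^K`. -/
inductive UKRel (ℓ : ℕ) : FreeAlgebra ℂ Gen → FreeAlgebra ℂ Gen → Prop
  | K_mul_K (α β : ℂ) :
      UKRel ℓ (ι ℂ (Gen.K α) * ι ℂ (Gen.K β)) (ι ℂ (Gen.K (α + β)))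
  | K_zero : UKRel ℓ (ι ℂ (Gen.K 0)) 1
  | K_E (α : ℂ) :
      UKRel ℓ (ι ℂ (Gen.K α) * ι ℂ Gen.E * ι ℂ (Gen.K (-α))) (xi ℓ (2 * α) • ι ℂ Gen.E)
  | K_F (α : ℂ) :
      UKRel ℓ (ι ℂ (Gen.K α) * ι ℂ Gen.F * ι ℂ (Gen.K (-α))) (xi ℓ (-2 * α) • ι ℂ Gen.F)
  | E_F : UKRel ℓ (ι ℂ Gen.E * ι ℂ Gen.F - ι ℂ Gen.F * ι ℂ Gen.E)
      ((xi ℓ 1 - xi ℓ (-1))⁻¹ • (ι ℂ (Gen.K 1) - ι ℂ (Gen.K (-1))))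
  | E_pow : UKRel ℓ (ι ℂ Gen.E ^ ell' ℓ) 0
  | F_pow : UKRel ℓ (ι ℂ Gen.F ^ ell' ℓ) 0

/-- The algebra `𝒰^K`. -/
def UK (ℓ : ℕ) : Type := RingQuot (UKRel ℓ)

noncomputable instance (ℓ : ℕ) : Ring (UK ℓ) := inferInstanceAs (Ring (RingQuot (UKRel ℓ)))
noncomputable instance (ℓ : ℕ) : Algebra ℂ (UK ℓ) :=
  inferInstanceAs (Algebra ℂ (RingQuot (UKRel ℓ)))

/-- The class of a generator in `𝒰^K`. -/
noncomputable def UK.gen (ℓ : ℕ) (s : Gen) : UK ℓ :=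
  RingQuot.mkAlgHom ℂ (UKRel ℓ) (FreeAlgebra.ι ℂ s)

/-- The relation `K^{ℓ/2} = ξ^{ℓ a / 2}`, where `a ∈ ℂ/2ℤ` is the class of `t ∈ ℂ`. -/
inductive DegRel (ℓ : ℕ) (a : Deg) : UK ℓ → UK ℓ → Prop
  | mk (t : ℂ) (ht : (t : Deg) = a) :
      DegRel ℓ a (UK.gen ℓ (Gen.K ((ℓ : ℂ) / 2))) (algebraMap ℂ (UK ℓ) (xi ℓ (ℓ * t / 2)))

/-- The algebra `U_a = 𝒰^K / (K^{ℓ/2} - ξ^{ℓ a / 2})`. -/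
def U (ℓ : ℕ) (a : Deg) : Type := RingQuot (DegRel ℓ a)

noncomputable instance (ℓ : ℕ) (a : Deg) : Ring (U ℓ a) :=
  inferInstanceAs (Ring (RingQuot (DegRel ℓ a)))
noncomputable instance (ℓ : ℕ) (a : Deg) : Algebra ℂ (U ℓ a) :=
  inferInstanceAs (Algebra ℂ (RingQuot (DegRel ℓ a)))

/-- The projection `𝒰^K → U_a`. -/
noncomputable def toU (ℓ : ℕ) (a : Deg) : UK ℓ →ₐ[ℂ] U ℓ a := RingQuot.mkAlgHom ℂ (DegRel ℓ a)

variable (ℓ : ℕ) (a b c : Deg)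

/-- `E ∈ U_a`. -/
noncomputable def E : U ℓ a := toU ℓ a (UK.gen ℓ Gen.E)
/-- `F ∈ U_a`. -/
noncomputable def F : U ℓ a := toU ℓ a (UK.gen ℓ Gen.F)
/-- `K^α ∈ U_a`. -/
noncomputable def K (α : ℂ) : U ℓ a := toU ℓ a (UK.gen ℓ (Gen.K α))

/-! #### Relations and the universal property -/

theorem xi_add (x y : ℂ) : xi ℓ (x + y) = xi ℓ x * xi ℓ y := by
  simp only [xi, ← Complex.exp_add]; congr 1; ring

theorem xi_zero : xi ℓ 0 = 1 := by simp [xi]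

theorem xi_neg_mul (x : ℂ) : xi ℓ (-x) * xi ℓ x = 1 := by
  rw [← xi_add, neg_add_cancel, xi_zero]

theorem xi_nat_mul (n : ℕ) (x : ℂ) : xi ℓ (n * x) = xi ℓ x ^ n := by
  simp only [xi, ← Complex.exp_nat_mul]; congr 1; ring


/-- The composite projection from the free algebra onto `U_a`. -/
noncomputable def proj : FreeAlgebra ℂ Gen →ₐ[ℂ] U ℓ a :=
  (toU ℓ a).comp (show FreeAlgebra ℂ Gen →ₐ[ℂ] UK ℓ from RingQuot.mkAlgHom ℂ (UKRel ℓ))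

theorem proj_rel {x y : FreeAlgebra ℂ Gen} (h : UKRel ℓ x y) : proj ℓ a x = proj ℓ a y :=
  congrArg (toU ℓ a) (RingQuot.mkAlgHom_rel ℂ h)

theorem proj_E : proj ℓ a (FreeAlgebra.ι ℂ Gen.E) = E ℓ a := rfl
theorem proj_F : proj ℓ a (FreeAlgebra.ι ℂ Gen.F) = F ℓ a := rfl
theorem proj_K (α : ℂ) : proj ℓ a (FreeAlgebra.ι ℂ (Gen.K α)) = K ℓ a α := rfl

theorem proj_surjective : Function.Surjective (proj ℓ a) := by
  have h1 : Function.Surjective (toU ℓ a) := RingQuot.mkAlgHom_surjective ℂ _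
  have h2 : Function.Surjective
      (show FreeAlgebra ℂ Gen →ₐ[ℂ] UK ℓ from RingQuot.mkAlgHom ℂ (UKRel ℓ)) :=
    RingQuot.mkAlgHom_surjective ℂ _
  exact h1.comp h2

theorem K_mul_K (α β : ℂ) : K ℓ a α * K ℓ a β = K ℓ a (α + β) := by
  simpa only [map_mul, proj_K] using proj_rel ℓ a (UKRel.K_mul_K α β)

theorem K_zero : K ℓ a 0 = 1 := by
  simpa only [map_one, proj_K] using proj_rel ℓ a UKRel.K_zero

theorem K_mul_K_neg (α : ℂ) : K ℓ a α * K ℓ a (-α) = 1 := by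
  rw [K_mul_K, add_neg_cancel, K_zero]

theorem K_neg_mul_K (α : ℂ) : K ℓ a (-α) * K ℓ a α = 1 := by
  rw [K_mul_K, neg_add_cancel, K_zero]

theorem K_mul_E (α : ℂ) : K ℓ a α * E ℓ a = xi ℓ (2 * α) • (E ℓ a * K ℓ a α) := by
  have h := proj_rel ℓ a (UKRel.K_E α)
  simp only [map_mul, map_smul, proj_K, proj_E] at h
  rw [← smul_mul_assoc, ← h, mul_assoc _ (K ℓ a (-α)), K_neg_mul_K, mul_one]

theorem K_mul_F (α : ℂ) : K ℓ a α * F ℓ a = xi ℓ (-2 * α) • (F ℓ a * K ℓ a α) := by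
  have h := proj_rel ℓ a (UKRel.K_F α)
  simp only [map_mul, map_smul, proj_K, proj_F] at h
  rw [← smul_mul_assoc, ← h, mul_assoc _ (K ℓ a (-α)), K_neg_mul_K, mul_one]

theorem E_mul_F : E ℓ a * F ℓ a =
    F ℓ a * E ℓ a + (xi ℓ 1 - xi ℓ (-1))⁻¹ • (K ℓ a 1 - K ℓ a (-1)) := by
  have h := proj_rel ℓ a UKRel.E_F
  simp only [map_mul, map_smul, map_sub, proj_K, proj_F, proj_E] at h
  rw [← h]; abel

theorem E_pow : E ℓ a ^ ell' ℓ = 0 := by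
  simpa only [map_pow, map_zero, proj_E] using proj_rel ℓ a UKRel.E_pow

theorem F_pow : F ℓ a ^ ell' ℓ = 0 := by
  simpa only [map_pow, map_zero, proj_F] using proj_rel ℓ a UKRel.F_pow

theorem K_half (t : ℂ) (ht : (t : Deg) = a) :
    K ℓ a ((ℓ : ℂ) / 2) = algebraMap ℂ (U ℓ a) (xi ℓ (ℓ * t / 2)) :=
  (RingQuot.mkAlgHom_rel ℂ (DegRel.mk t ht)).trans ((toU ℓ a).commutes _)

/-- A choice of elements of an algebra satisfying the defining relations of `U_a`. -/
structure Rels {A : Type*} [Ring A] [Algebra ℂ A] (e f : A) (κ : ℂ → A) : Prop where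
  mul_K : ∀ α β, κ α * κ β = κ (α + β)
  K_zero : κ 0 = 1
  K_E : ∀ α, κ α * e = xi ℓ (2 * α) • (e * κ α)
  K_F : ∀ α, κ α * f = xi ℓ (-2 * α) • (f * κ α)
  E_F : e * f = f * e + (xi ℓ 1 - xi ℓ (-1))⁻¹ • (κ 1 - κ (-1))
  E_pow : e ^ ell' ℓ = 0
  F_pow : f ^ ell' ℓ = 0
  K_half : ∀ t : ℂ, (t : Deg) = a → κ ((ℓ : ℂ) / 2) = algebraMap ℂ A (xi ℓ (ℓ * t / 2))

section lift

variable {ℓ a} {A : Type*} [Ring A] [Algebra ℂ A] {e f : A} {κ : ℂ → A}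

/-- The map from the free algebra sending the generators to `e`, `f`, `κ α`. -/
noncomputable def preLift (e f : A) (κ : ℂ → A) : FreeAlgebra ℂ Gen →ₐ[ℂ] A :=
  FreeAlgebra.lift ℂ fun s => match s with
    | Gen.E => e
    | Gen.F => f
    | Gen.K α => κ α

theorem Rels.preLift_rel (h : Rels ℓ a e f κ) ⦃x y : FreeAlgebra ℂ Gen⦄ (hxy : UKRel ℓ x y) :
    preLift e f κ x = preLift e f κ y := by
  cases hxy with
  | K_mul_K α β => simpa [preLift] using h.mul_K α β
  | K_zero => simpa [preLift] using h.K_zero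
  | K_E α =>
    simp only [preLift, map_mul, map_smul, FreeAlgebra.lift_ι_apply]
    rw [h.K_E, smul_mul_assoc, mul_assoc, h.mul_K, add_neg_cancel, h.K_zero, mul_one]
  | K_F α =>
    simp only [preLift, map_mul, map_smul, FreeAlgebra.lift_ι_apply]
    rw [h.K_F, smul_mul_assoc, mul_assoc, h.mul_K, add_neg_cancel, h.K_zero, mul_one]
  | E_F =>
    simp only [preLift, map_mul, map_smul, map_sub, FreeAlgebra.lift_ι_apply]
    rw [h.E_F]; abel
  | E_pow => simpa [preLift] using h.E_pow
  | F_pow => simpa [preLift] using h.F_pow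

/-- The map out of `𝒰^K` given by elements satisfying the relations. -/
noncomputable def Rels.liftUK (h : Rels ℓ a e f κ) : UK ℓ →ₐ[ℂ] A :=
  RingQuot.liftAlgHom ℂ ⟨preLift e f κ, h.preLift_rel⟩

theorem Rels.liftUK_gen (h : Rels ℓ a e f κ) (s : Gen) :
    h.liftUK (UK.gen ℓ s) = preLift e f κ (FreeAlgebra.ι ℂ s) :=
  RingQuot.liftAlgHom_mkAlgHom_apply ℂ _ h.preLift_rel _

theorem Rels.liftUK_rel (h : Rels ℓ a e f κ) ⦃x y : UK ℓ⦄ (hxy : DegRel ℓ a x y) :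
    h.liftUK x = h.liftUK y := by
  cases hxy with
  | mk t ht =>
    rw [h.liftUK_gen, AlgHom.commutes]
    simpa [preLift] using h.K_half t ht

/-- The universal property of `U_a`. -/
noncomputable def Rels.lift (h : Rels ℓ a e f κ) : U ℓ a →ₐ[ℂ] A :=
  RingQuot.liftAlgHom ℂ ⟨h.liftUK, h.liftUK_rel⟩

theorem Rels.lift_toU (h : Rels ℓ a e f κ) (x : UK ℓ) : h.lift (toU ℓ a x) = h.liftUK x :=
  RingQuot.liftAlgHom_mkAlgHom_apply ℂ _ h.liftUK_rel _

theorem Rels.lift_E (h : Rels ℓ a e f κ) : h.lift (E ℓ a) = e := by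
  simp [E, h.lift_toU, h.liftUK_gen, preLift]

theorem Rels.lift_F (h : Rels ℓ a e f κ) : h.lift (F ℓ a) = f := by
  simp [F, h.lift_toU, h.liftUK_gen, preLift]

theorem Rels.lift_K (h : Rels ℓ a e f κ) (α : ℂ) : h.lift (K ℓ a α) = κ α := by
  simp [K, h.lift_toU, h.liftUK_gen, preLift]

end lift

variable {a} in
theorem U.hom_ext {A : Type*} [Ring A] [Algebra ℂ A] {f g : U ℓ a →ₐ[ℂ] A}
    (hE : f (E ℓ a) = g (E ℓ a)) (hF : f (F ℓ a) = g (F ℓ a))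
    (hK : ∀ α, f (K ℓ a α) = g (K ℓ a α)) : f = g := by
  have : f.comp (proj ℓ a) = g.comp (proj ℓ a) := by
    apply FreeAlgebra.hom_ext
    funext s
    cases s with
    | E => exact hE
    | F => exact hF
    | K α => exact hK α
  ext x
  obtain ⟨y, rfl⟩ := proj_surjective ℓ a x
  exact DFunLike.congr_fun this y

variable {a} in
theorem U.induction {p : U ℓ a → Prop} (hc : ∀ r : ℂ, p (algebraMap ℂ _ r))
    (hE : p (E ℓ a)) (hF : p (F ℓ a)) (hK : ∀ α, p (K ℓ a α))
    (hmul : ∀ x y, p x → p y → p (x * y)) (hadd : ∀ x y, p x → p y → p (x + y))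
    (x : U ℓ a) : p x := by
  obtain ⟨y, rfl⟩ := proj_surjective ℓ a x
  induction y using FreeAlgebra.induction with
  | grade0 r => rw [AlgHom.commutes]; exact hc r
  | grade1 s =>
    cases s with
    | E => exact hE
    | F => exact hF
    | K α => exact hK α
  | mul x y hx hy => rw [map_mul]; exact hmul _ _ hx hy
  | add x y hx hy => rw [map_add]; exact hadd _ _ hx hy

/-! #### Powers of sums of `q`-commuting elements -/

/-- Gaussian binomial coefficients. -/
noncomputable def gauss (q : ℂ) : ℕ → ℕ → ℂ
  | _, 0 => 1
  | 0, _ + 1 => 0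
  | n + 1, k + 1 => gauss q n k + q ^ (k + 1) * gauss q n (k + 1)

theorem gauss_zero_right (q : ℂ) (n : ℕ) : gauss q n 0 = 1 := by cases n <;> rfl

theorem gauss_of_lt (q : ℂ) : ∀ n k : ℕ, n < k → gauss q n k = 0
  | _, 0, h => absurd h (Nat.not_lt_zero _)
  | 0, _ + 1, _ => rfl
  | n + 1, k + 1, h => by
    rw [gauss, gauss_of_lt q n k (by omega), gauss_of_lt q n (k + 1) (by omega)]; ring

theorem gauss_self (q : ℂ) : ∀ n : ℕ, gauss q n n = 1
  | 0 => rfl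
  | n + 1 => by rw [gauss, gauss_self q n, gauss_of_lt q n (n + 1) (by omega)]; ring

theorem gauss_aux (q : ℂ) : ∀ n k : ℕ,
    (q ^ k - q ^ n) * gauss q n k = q ^ k * (1 - q ^ (k + 1)) * gauss q n (k + 1)
  | 0, 0 => by simp [gauss]
  | 0, k + 1 => by simp [gauss]
  | n + 1, 0 => by
    have h := gauss_aux q n 0
    simp only [gauss, gauss_zero_right] at h ⊢
    linear_combination q * h
  | n + 1, k + 1 => by
    have h1 := gauss_aux q n k
    have h2 := gauss_aux q n (k + 1)
    rw [gauss, gauss]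
    linear_combination q * h1 + q ^ (k + 2) * h2

theorem gauss_eq_zero {q : ℂ} {n : ℕ} (hq : IsPrimitiveRoot q n) {k : ℕ} (h0 : 0 < k)
    (hk : k < n) : gauss q n k = 0 := by
  obtain ⟨k, rfl⟩ : ∃ j, k = j + 1 := ⟨k - 1, by omega⟩
  obtain ⟨m, rfl⟩ : ∃ m, n = m + 1 := ⟨n - 1, by omega⟩
  have h := gauss_aux q m k
  have h1 : (1 - q ^ (k + 1)) * gauss q (m + 1) (k + 1) = (1 - q ^ (m + 1)) * gauss q m k := by
    rw [gauss]
    linear_combination (-q) * h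
  rw [hq.pow_eq_one, sub_self, zero_mul] at h1
  refine (mul_eq_zero.1 h1).resolve_left fun h2 => ?_
  exact hq.pow_ne_one_of_pos_of_lt (by omega) hk (sub_eq_zero.1 h2).symm

theorem q_binomial {A : Type*} [Ring A] [Algebra ℂ A] {q : ℂ} {x y : A}
    (h : y * x = q • (x * y)) (n : ℕ) :
    (x + y) ^ n = ∑ k ∈ Finset.range (n + 1), gauss q n k • (x ^ k * y ^ (n - k)) := by
  have hy : ∀ k : ℕ, y * x ^ k = q ^ k • (x ^ k * y) := by
    intro k
    induction k with
    | zero => simp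
    | succ k ih =>
      rw [pow_succ x, ← mul_assoc, ih, smul_mul_assoc, mul_assoc, h, mul_smul_comm, smul_smul,
        ← pow_succ, mul_assoc]
  induction n with
  | zero => simp [gauss]
  | succ n ih =>
    rw [pow_succ', ih, add_mul, Finset.mul_sum, Finset.mul_sum]
    rw [Finset.sum_range_succ' _ (n + 1)]
    have e1 : ∀ k ∈ Finset.range (n + 1), gauss q (n + 1) (k + 1) •
        (x ^ (k + 1) * y ^ (n + 1 - (k + 1))) = x * gauss q n k • (x ^ k * y ^ (n - k)) +
          (q ^ (k + 1) * gauss q n (k + 1)) • (x ^ (k + 1) * y ^ (n - k)) := by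
      intro k _
      rw [gauss, add_smul, mul_smul_comm, ← mul_assoc x, ← pow_succ' x, Nat.add_sub_add_right]
    rw [Finset.sum_congr rfl e1, Finset.sum_add_distrib, add_assoc]
    congr 1
    rw [Finset.sum_range_succ' _ n, Finset.sum_range_succ _ n, gauss_of_lt q n (n + 1) (by omega)]
    simp only [mul_zero, zero_smul, add_zero]
    congr 1
    · refine Finset.sum_congr rfl fun k hk => ?_
      rw [Finset.mem_range] at hk
      rw [mul_smul_comm, ← mul_assoc, hy, smul_mul_assoc, smul_smul, mul_assoc, ← pow_succ',
        mul_comm (q ^ (k + 1))]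
      congr 4
      omega
    · simp [gauss_zero_right, pow_succ']

theorem add_pow_eq_zero {A : Type*} [Ring A] [Algebra ℂ A] {q : ℂ} {x y : A} {n : ℕ}
    (hq : IsPrimitiveRoot q n) (h : y * x = q • (x * y)) (hx : x ^ n = 0) (hy : y ^ n = 0) :
    (x + y) ^ n = 0 := by
  rw [q_binomial h]
  refine Finset.sum_eq_zero fun k hk => ?_
  rw [Finset.mem_range] at hk
  rcases Nat.eq_zero_or_pos k with rfl | h0
  · simp [hy]
  rcases (show k = n ∨ k < n by omega) with rfl | hn
  · simp [hx]
  · rw [gauss_eq_zero hq h0 hn, zero_smul]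

theorem smul_mul_pow {A : Type*} [Ring A] [Algebra ℂ A] {q : ℂ} {x y : A}
    (h : y * x = q • (x * y)) (n : ℕ) : ∃ r : ℂ, (x * y) ^ n = r • (x ^ n * y ^ n) := by
  have hy : ∀ k : ℕ, y ^ k * x = q ^ k • (x * y ^ k) := by
    intro k
    induction k with
    | zero => simp
    | succ k ih =>
      rw [pow_succ', mul_assoc, ih, mul_smul_comm, ← mul_assoc, h, smul_mul_assoc, smul_smul,
        ← pow_succ, mul_assoc]
  induction n with
  | zero => exact ⟨1, by simp⟩
  | succ n ih =>
    obtain ⟨r, hr⟩ := ih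
    refine ⟨r * q ^ n, ?_⟩
    rw [pow_succ, hr, smul_mul_assoc, mul_assoc, ← mul_assoc (y ^ n), hy, smul_mul_assoc,
      mul_smul_comm, smul_smul, ← mul_assoc, ← mul_assoc, ← pow_succ, mul_assoc, ← pow_succ]

theorem xi_two_primitive {ℓ : ℕ} (hℓ : ℓ ≠ 0) : IsPrimitiveRoot (xi ℓ 2) (ell' ℓ) := by
  have h : IsPrimitiveRoot (xi ℓ 1) ℓ := by
    have := Complex.isPrimitiveRoot_exp ℓ hℓ
    simpa [xi] using this
  have h2 : xi ℓ 2 = xi ℓ 1 ^ 2 := by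
    rw [← xi_nat_mul]; norm_num
  have h3 : orderOf (xi ℓ 2) = ell' ℓ := by
    rw [h2, orderOf_pow' _ two_ne_zero, ← h.eq_orderOf, ell']
  rw [← h3]
  exact IsPrimitiveRoot.orderOf _

/-! #### The pivotal Hopf coalgebra structure -/

variable {ℓ a b c}

theorem comul_rels (hℓ : 3 ≤ ℓ) (h : a + b = c) : Rels ℓ c (A := U ℓ a ⊗[ℂ] U ℓ b)
    (1 ⊗ₜ E ℓ b + E ℓ a ⊗ₜ K ℓ b 1) (K ℓ a (-1) ⊗ₜ F ℓ b + F ℓ a ⊗ₜ 1)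
    (fun α => K ℓ a α ⊗ₜ K ℓ b α) where
  mul_K α β := by
    rw [Algebra.TensorProduct.tmul_mul_tmul, K_mul_K, K_mul_K]
  K_zero := by rw [K_zero, K_zero]; rfl
  K_E α := by
    simp only [mul_add, add_mul, Algebra.TensorProduct.tmul_mul_tmul, K_mul_E, K_mul_K, one_mul,
      mul_one, smul_add, TensorProduct.tmul_smul, TensorProduct.smul_tmul', add_comm]
  K_F α := by
    simp only [mul_add, add_mul, Algebra.TensorProduct.tmul_mul_tmul, K_mul_F, K_mul_K, one_mul,
      mul_one, smul_add, TensorProduct.tmul_smul, TensorProduct.smul_tmul', add_comm]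
  E_F := by
    simp only [mul_add, add_mul, Algebra.TensorProduct.tmul_mul_tmul, one_mul, mul_one,
      K_mul_E, K_mul_F]
    rw [E_mul_F, E_mul_F]
    simp only [TensorProduct.tmul_smul, TensorProduct.smul_tmul', TensorProduct.tmul_add,
      TensorProduct.add_tmul, TensorProduct.tmul_sub, TensorProduct.sub_tmul, smul_sub, mul_neg,
      mul_one]
    abel
  E_pow := by
    refine add_pow_eq_zero (xi_two_primitive (by omega : ℓ ≠ 0)) ?_ ?_ ?_
    · simp only [Algebra.TensorProduct.tmul_mul_tmul, one_mul, mul_one, K_mul_E,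
        TensorProduct.tmul_smul]
    · rw [Algebra.TensorProduct.tmul_pow, E_pow, TensorProduct.tmul_zero]
    · rw [Algebra.TensorProduct.tmul_pow, E_pow, TensorProduct.zero_tmul]
  F_pow := by
    rw [add_comm]
    refine add_pow_eq_zero (xi_two_primitive (by omega : ℓ ≠ 0)) ?_ ?_ ?_
    · simp only [Algebra.TensorProduct.tmul_mul_tmul, one_mul, mul_one, K_mul_F,
        TensorProduct.smul_tmul', mul_neg, neg_neg]
    · rw [Algebra.TensorProduct.tmul_pow, F_pow, TensorProduct.zero_tmul]
    · rw [Algebra.TensorProduct.tmul_pow, F_pow, TensorProduct.tmul_zero]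
  K_half t ht := by
    obtain ⟨s, rfl⟩ := QuotientAddGroup.mk_surjective a
    have hb : ((t - s : ℂ) : Deg) = b := by
      rw [QuotientAddGroup.mk_sub, ht, ← h]; abel
    rw [K_half ℓ _ s rfl, K_half ℓ b (t - s) hb]
    simp only [Algebra.algebraMap_eq_smul_one, ← TensorProduct.smul_tmul',
      TensorProduct.tmul_smul, smul_smul, ← xi_add]
    rw [Algebra.TensorProduct.one_def]
    congr 2
    ring

/-- The coproduct `Δ_{a,b} : U_{a+b} → U_a ⊗ U_b`. -/
noncomputable def comul (hℓ : 3 ≤ ℓ) (h : a + b = c) : U ℓ c →ₐ[ℂ] U ℓ a ⊗[ℂ] U ℓ b :=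
  (comul_rels hℓ h).lift

theorem ell'_ne_zero (hℓ : 3 ≤ ℓ) : ell' ℓ ≠ 0 := by
  have : Nat.gcd ℓ 2 ≤ 2 := Nat.gcd_le_right ℓ (by norm_num)
  exact (Nat.div_pos (by omega) (Nat.gcd_pos_of_pos_right ℓ (by norm_num))).ne'

theorem xi_ell {ℓ : ℕ} (hℓ : ℓ ≠ 0) : xi ℓ ℓ = 1 := by
  have : (ℓ : ℂ) ≠ 0 := by exact_mod_cast hℓ
  rw [xi, mul_div_cancel_right₀ _ this, Complex.exp_two_pi_mul_I]

theorem counit_rels (hℓ : 3 ≤ ℓ) : Rels ℓ (0 : Deg) (A := ℂ) 0 0 (fun _ => 1) where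
  mul_K _ _ := mul_one 1
  K_zero := rfl
  K_E _ := by simp
  K_F _ := by simp
  E_F := by simp
  E_pow := zero_pow (ell'_ne_zero hℓ)
  F_pow := zero_pow (ell'_ne_zero hℓ)
  K_half t ht := by
    obtain ⟨n, rfl⟩ := AddSubgroup.mem_zmultiples_iff.1 ((QuotientAddGroup.eq_zero_iff t).1 ht)
    have h0 : (ℓ : ℂ) ≠ 0 := by exact_mod_cast (by omega : ℓ ≠ 0)
    rw [Algebra.algebraMap_self_apply, xi, eq_comm, Complex.exp_eq_one_iff]
    refine ⟨n, ?_⟩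
    rw [zsmul_eq_mul]
    field_simp

/-- The counit `ε : U_0 → ℂ`. -/
noncomputable def counit (hℓ : 3 ≤ ℓ) : U ℓ 0 →ₐ[ℂ] ℂ := (counit_rels hℓ).lift

open MulOpposite in
theorem antipode_rels (h : a + b = 0) : Rels ℓ a (A := (U ℓ b)ᵐᵒᵖ)
    (op (-(E ℓ b * K ℓ b (-1)))) (op (-(K ℓ b 1 * F ℓ b))) (fun α => op (K ℓ b (-α))) where
  mul_K α β := by
    rw [← op_mul, K_mul_K]; congr 2; ring
  K_zero := by rw [neg_zero, K_zero, op_one]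
  K_E α := by
    rw [← op_mul, ← op_mul, ← op_smul]
    congr 1
    rw [mul_neg, ← mul_assoc, K_mul_E, neg_mul, mul_assoc, K_mul_K, smul_mul_assoc, mul_assoc,
      K_mul_K, smul_neg, smul_smul, ← xi_add, add_comm (-1) (-α)]
    ring_nf
    rw [xi_zero, one_smul]
  K_F α := by
    rw [← op_mul, ← op_mul, ← op_smul]
    congr 1
    rw [mul_neg, ← mul_assoc, K_mul_K, neg_mul, K_mul_F, K_mul_F, smul_mul_assoc, mul_assoc,
      K_mul_K, smul_neg, smul_smul, ← xi_add, add_comm (-α) 1]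
    ring_nf
  E_F := by
    have h1 : K ℓ b 1 * F ℓ b * (E ℓ b * K ℓ b (-1)) = F ℓ b * E ℓ b := by
      rw [K_mul_F, smul_mul_assoc, mul_assoc, ← mul_assoc (K ℓ b 1), K_mul_E, smul_mul_assoc,
        mul_smul_comm, smul_smul, ← xi_add, mul_assoc, K_mul_K_neg, mul_one]
      norm_num [xi_zero]
    have h2 : E ℓ b * K ℓ b (-1) * (K ℓ b 1 * F ℓ b) = E ℓ b * F ℓ b := by
      rw [mul_assoc, ← mul_assoc (K ℓ b (-1)), K_neg_mul_K, one_mul]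
    rw [← op_mul, ← op_mul, ← op_sub, ← op_smul, ← op_add, neg_mul_neg, neg_mul_neg, h1, h2,
      E_mul_F, neg_neg, add_assoc, ← smul_add, sub_add_sub_cancel, sub_self, smul_zero, add_zero]
  E_pow := by
    rw [← op_pow, neg_pow]
    obtain ⟨r, hr⟩ := smul_mul_pow (K_mul_E ℓ b (-1)) (ell' ℓ)
    rw [hr, E_pow, zero_mul, smul_zero, mul_zero, op_zero]
  F_pow := by
    have h1 : F ℓ b * K ℓ b 1 = xi ℓ 2 • (K ℓ b 1 * F ℓ b) := by
      rw [K_mul_F, smul_smul, ← xi_add]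
      norm_num [xi_zero]
    rw [← op_pow, neg_pow]
    obtain ⟨r, hr⟩ := smul_mul_pow h1 (ell' ℓ)
    rw [hr, F_pow, mul_zero, smul_zero, mul_zero, op_zero]
  K_half t ht := by
    have hb : ((-t : ℂ) : Deg) = b := by
      rw [QuotientAddGroup.mk_neg, ht]; exact neg_eq_of_add_eq_zero_right h
    have h1 := K_half ℓ b (-t) hb
    have h2 : K ℓ b (-((ℓ : ℂ) / 2)) = algebraMap ℂ (U ℓ b) (xi ℓ (ℓ * t / 2)) := by
      have h3 : algebraMap ℂ (U ℓ b) (xi ℓ (ℓ * -t / 2)) *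
          algebraMap ℂ (U ℓ b) (xi ℓ (ℓ * t / 2)) = 1 := by
        rw [← map_mul, ← xi_add, ← map_one (algebraMap ℂ (U ℓ b)), ← xi_zero ℓ]
        congr 2; ring
      rw [← mul_one (K ℓ b _), ← h3, ← h1, ← mul_assoc, K_neg_mul_K, one_mul]
    rw [h2]; rfl

/-- The antipode `S_a : U_a → U_{-a}`, as an algebra map to the opposite algebra. -/
noncomputable def antipodeOp (h : a + b = 0) : U ℓ a →ₐ[ℂ] (U ℓ b)ᵐᵒᵖ := (antipode_rels h).lift

/-- The antipode `S_a : U_a → U_{-a}`. -/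
noncomputable def antipode (h : a + b = 0) : U ℓ a →ₗ[ℂ] U ℓ b :=
  (MulOpposite.opLinearEquiv ℂ).symm.toLinearMap ∘ₗ (antipodeOp h).toLinearMap

section values

theorem comul_E (hℓ : 3 ≤ ℓ) (h : a + b = c) :
    comul hℓ h (E ℓ c) = 1 ⊗ₜ E ℓ b + E ℓ a ⊗ₜ K ℓ b 1 := Rels.lift_E _

theorem comul_F (hℓ : 3 ≤ ℓ) (h : a + b = c) :
    comul hℓ h (F ℓ c) = K ℓ a (-1) ⊗ₜ F ℓ b + F ℓ a ⊗ₜ 1 := Rels.lift_F _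

theorem comul_K (hℓ : 3 ≤ ℓ) (h : a + b = c) (α : ℂ) :
    comul hℓ h (K ℓ c α) = K ℓ a α ⊗ₜ K ℓ b α := Rels.lift_K _ α

theorem counit_E (hℓ : 3 ≤ ℓ) : counit hℓ (E ℓ 0) = 0 := Rels.lift_E _

theorem counit_F (hℓ : 3 ≤ ℓ) : counit hℓ (F ℓ 0) = 0 := Rels.lift_F _

theorem counit_K (hℓ : 3 ≤ ℓ) (α : ℂ) : counit hℓ (K ℓ 0 α) = 1 := Rels.lift_K _ α

theorem antipode_E (h : a + b = 0) : antipode h (E ℓ a) = -(E ℓ b * K ℓ b (-1)) :=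
  congrArg MulOpposite.unop (Rels.lift_E (antipode_rels h))

theorem antipode_F (h : a + b = 0) : antipode h (F ℓ a) = -(K ℓ b 1 * F ℓ b) :=
  congrArg MulOpposite.unop (Rels.lift_F (antipode_rels h))

theorem antipode_K (h : a + b = 0) (α : ℂ) : antipode h (K ℓ a α) = K ℓ b (-α) :=
  congrArg MulOpposite.unop (Rels.lift_K (antipode_rels h) α)

theorem antipode_mul (h : a + b = 0) (x y : U ℓ a) :
    antipode h (x * y) = antipode h y * antipode h x :=
  congrArg MulOpposite.unop (map_mul (antipodeOp h) x y)

theorem antipode_algebraMap (h : a + b = 0) (r : ℂ) :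
    antipode h (algebraMap ℂ (U ℓ a) r) = algebraMap ℂ (U ℓ b) r :=
  congrArg MulOpposite.unop ((antipodeOp h).commutes r)

end values

theorem coassoc (hℓ : 3 ≤ ℓ) {a b c ab bc abc : Deg} (h₁ : a + b = ab) (h₂ : ab + c = abc)
    (h₃ : b + c = bc) (h₄ : a + bc = abc) (x : U ℓ abc) :
    TensorProduct.assoc ℂ (U ℓ a) (U ℓ b) (U ℓ c)
        ((comul hℓ h₁).toLinearMap.rTensor (U ℓ c) (comul hℓ h₂ x)) =
      (comul hℓ h₃).toLinearMap.lTensor (U ℓ a) (comul hℓ h₄ x) := by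
  have key : ((Algebra.TensorProduct.assoc ℂ ℂ ℂ (U ℓ a) (U ℓ b) (U ℓ c)).toAlgHom.comp
      (Algebra.TensorProduct.map (comul hℓ h₁) (AlgHom.id ℂ (U ℓ c)))).comp (comul hℓ h₂) =
      (Algebra.TensorProduct.map (AlgHom.id ℂ (U ℓ a)) (comul hℓ h₃)).comp (comul hℓ h₄) := by
    apply U.hom_ext
    · simp [comul_E, comul_K, TensorProduct.add_tmul, TensorProduct.tmul_add, add_assoc,
        Algebra.TensorProduct.one_def]
    · simp [comul_F, comul_K, TensorProduct.add_tmul, TensorProduct.tmul_add, add_assoc,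
        Algebra.TensorProduct.one_def]
    · simp [comul_K]
  exact DFunLike.congr_fun key x

theorem counit_right (hℓ : 3 ≤ ℓ) (a : Deg) (x : U ℓ a) :
    TensorProduct.rid ℂ (U ℓ a)
      ((counit hℓ).toLinearMap.lTensor (U ℓ a) (comul hℓ (add_zero a) x)) = x := by
  have key : ((Algebra.TensorProduct.rid ℂ ℂ (U ℓ a)).toAlgHom.comp
      (Algebra.TensorProduct.map (AlgHom.id ℂ (U ℓ a)) (counit hℓ))).comp
        (comul hℓ (add_zero a)) = AlgHom.id ℂ (U ℓ a) := by
    apply U.hom_ext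
    · simp [comul_E, counit_E, counit_K]
    · simp [comul_F, counit_F]
    · simp [comul_K, counit_K]
  exact DFunLike.congr_fun key x

theorem counit_left (hℓ : 3 ≤ ℓ) (a : Deg) (x : U ℓ a) :
    TensorProduct.lid ℂ (U ℓ a)
      ((counit hℓ).toLinearMap.rTensor (U ℓ a) (comul hℓ (zero_add a) x)) = x := by
  have key : ((Algebra.TensorProduct.lid ℂ (U ℓ a)).toAlgHom.comp
      (Algebra.TensorProduct.map (counit hℓ) (AlgHom.id ℂ (U ℓ a)))).comp
        (comul hℓ (zero_add a)) = AlgHom.id ℂ (U ℓ a) := by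
    apply U.hom_ext
    · simp [comul_E, counit_E]
    · simp [comul_F, counit_F, counit_K]
    · simp [comul_K, counit_K]
  exact DFunLike.congr_fun key x

theorem antipode_left (hℓ : 3 ≤ ℓ) (h : a + b = 0) (x : U ℓ 0) :
    LinearMap.mul' ℂ (U ℓ b) ((antipode h).rTensor (U ℓ b) (comul hℓ h x)) =
      algebraMap ℂ (U ℓ b) (counit hℓ x) := by
  set Φ : U ℓ a ⊗[ℂ] U ℓ b →ₗ[ℂ] U ℓ b :=
    LinearMap.mul' ℂ (U ℓ b) ∘ₗ (antipode h).rTensor (U ℓ b) with hΦ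
  have h1 : ∀ x y, Φ (x ⊗ₜ y) = antipode h x * y := fun _ _ => rfl
  change Φ (comul hℓ h x) = _
  induction x using U.induction with
  | hc r =>
    rw [AlgHom.commutes, AlgHom.commutes, Algebra.TensorProduct.algebraMap_apply, h1,
      antipode_algebraMap, mul_one]; rfl
  | hE =>
    rw [comul_E, counit_E, map_add, h1, h1, ← map_one (algebraMap ℂ (U ℓ a)),
      antipode_algebraMap, antipode_E, neg_mul, mul_assoc, K_neg_mul_K]
    simp
  | hF =>
    rw [comul_F, counit_F, map_add, h1, h1, antipode_F, antipode_K]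
    simp
  | hK α => rw [comul_K, counit_K, h1, antipode_K, K_neg_mul_K, map_one]
  | hmul x y hx hy =>
    have h2 : ∀ s t : U ℓ a ⊗[ℂ] U ℓ b, ∀ r : ℂ, Φ s = algebraMap ℂ (U ℓ b) r →
        Φ (s * t) = r • Φ t := by
      intro s t r hs
      induction t with
      | zero => simp
      | add t t' ht ht' => rw [mul_add, map_add, ht, ht', map_add, smul_add]
      | tmul u v =>
        have h3 : Φ (s * u ⊗ₜ v) = antipode h u * Φ s * v := by
          clear hs
          induction s with
          | zero => simp
          | add s s' hs hs' => rw [add_mul, map_add, hs, hs', map_add, mul_add, add_mul]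
          | tmul p q =>
            rw [Algebra.TensorProduct.tmul_mul_tmul, h1, h1, antipode_mul]
            simp only [mul_assoc]
        rw [h3, hs, h1, ← Algebra.commutes, mul_assoc, Algebra.smul_def]
    rw [map_mul, h2 _ _ _ hx, hy, map_mul, map_mul, Algebra.smul_def]
  | hadd x y hx hy => rw [map_add, map_add, hx, hy, map_add, map_add]

theorem antipode_right (hℓ : 3 ≤ ℓ) (h : a + b = 0) (h' : b + a = 0) (x : U ℓ 0) :
    LinearMap.mul' ℂ (U ℓ a) ((antipode h').lTensor (U ℓ a) (comul hℓ h x)) =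
      algebraMap ℂ (U ℓ a) (counit hℓ x) := by
  set Φ : U ℓ a ⊗[ℂ] U ℓ b →ₗ[ℂ] U ℓ a :=
    LinearMap.mul' ℂ (U ℓ a) ∘ₗ (antipode h').lTensor (U ℓ a) with hΦ
  have h1 : ∀ x y, Φ (x ⊗ₜ y) = x * antipode h' y := fun _ _ => rfl
  change Φ (comul hℓ h x) = _
  induction x using U.induction with
  | hc r =>
    rw [AlgHom.commutes, AlgHom.commutes, Algebra.TensorProduct.algebraMap_apply, h1,
      ← map_one (algebraMap ℂ (U ℓ b)), antipode_algebraMap, map_one, mul_one]; rfl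
  | hE =>
    rw [comul_E, counit_E, map_add, h1, h1, antipode_K, antipode_E]
    simp
  | hF =>
    rw [comul_F, counit_F, map_add, h1, h1, ← map_one (algebraMap ℂ (U ℓ b)),
      antipode_algebraMap, antipode_F, mul_neg, ← mul_assoc, K_neg_mul_K]
    simp
  | hK α => rw [comul_K, counit_K, h1, antipode_K, K_mul_K_neg, map_one]
  | hmul x y hx hy =>
    have h2 : ∀ s t : U ℓ a ⊗[ℂ] U ℓ b, ∀ r : ℂ, Φ t = algebraMap ℂ (U ℓ a) r →
        Φ (s * t) = r • Φ s := by
      intro s t r ht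
      induction s with
      | zero => simp
      | add s s' hs hs' => rw [add_mul, map_add, hs, hs', map_add, smul_add]
      | tmul u v =>
        have h3 : Φ (u ⊗ₜ v * t) = u * Φ t * antipode h' v := by
          clear ht
          induction t with
          | zero => simp
          | add s s' hs hs' => rw [mul_add, map_add, hs, hs', map_add, mul_add, add_mul]
          | tmul p q =>
            rw [Algebra.TensorProduct.tmul_mul_tmul, h1, h1, antipode_mul]
            simp only [mul_assoc]
        rw [h3, ht, h1, ← Algebra.commutes, mul_assoc, Algebra.smul_def]
    rw [map_mul, h2 _ _ _ hy, hx, map_mul, mul_comm, map_mul, Algebra.smul_def]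
  | hadd x y hx hy => rw [map_add, map_add, hx, hy, map_add, map_add]

/-- The pivot `g_a = K^{1-ℓ'}`. -/
noncomputable def pivot (ℓ : ℕ) (a : Deg) : (U ℓ a)ˣ where
  val := K ℓ a (1 - ell' ℓ)
  inv := K ℓ a (-(1 - ell' ℓ))
  val_inv := K_mul_K_neg ℓ a _
  inv_val := K_neg_mul_K ℓ a _

theorem antipode_antipode (hℓ : 3 ≤ ℓ) (h : a + b = 0) (h' : b + a = 0) (x : U ℓ a) :
    antipode h' (antipode h x) = (pivot ℓ a : U ℓ a) * x * ((pivot ℓ a)⁻¹ : (U ℓ a)ˣ) := by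
  have hx : xi ℓ (-2 * ell' ℓ) = 1 := by
    have h1 := (xi_two_primitive (by omega : ℓ ≠ 0)).pow_eq_one
    rw [← xi_nat_mul] at h1
    have h2 := xi_neg_mul ℓ (ell' ℓ * 2)
    rw [h1, mul_one] at h2
    rw [← h2]; congr 1; ring
  have hx' : xi ℓ (2 * ell' ℓ) = 1 := by
    have h2 := xi_neg_mul ℓ (2 * ell' ℓ)
    rwa [← neg_mul, hx, one_mul] at h2
  change _ = K ℓ a (1 - ell' ℓ) * x * K ℓ a (-(1 - ell' ℓ))
  induction x using U.induction with
  | hc r =>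
    rw [antipode_algebraMap, antipode_algebraMap, ← Algebra.commutes, mul_assoc, K_mul_K_neg,
      mul_one]
  | hE =>
    rw [antipode_E, map_neg, antipode_mul, antipode_K, antipode_E, K_mul_E, smul_mul_assoc,
      mul_assoc, K_mul_K_neg, neg_neg, mul_neg, neg_neg, ← mul_assoc, K_mul_E, smul_mul_assoc,
      mul_assoc, K_mul_K_neg, mul_one]
    congr 1
    rw [show (2 : ℂ) * (1 - ell' ℓ) = 2 + -2 * ell' ℓ by ring, xi_add, hx, mul_one]
  | hF =>
    rw [antipode_F, map_neg, antipode_mul, antipode_K, antipode_F, K_mul_F, K_mul_F,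
      smul_mul_assoc,
      mul_assoc, K_mul_K_neg, neg_mul, neg_neg, smul_mul_assoc, mul_assoc, K_mul_K_neg, mul_one]
    congr 1
    rw [show (-2 : ℂ) * (1 - ell' ℓ) = -2 + 2 * ell' ℓ by ring, xi_add, hx', mul_one]
  | hK α =>
    rw [antipode_K, antipode_K, K_mul_K, K_mul_K]; congr 1; ring
  | hmul x y hx hy =>
    rw [antipode_mul, antipode_mul, hx, hy]
    simp only [mul_assoc]
    rw [← mul_assoc (K ℓ a (-(1 - ell' ℓ))) (K ℓ a (1 - ell' ℓ)), K_neg_mul_K, one_mul]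
  | hadd x y hx hy => rw [map_add, map_add, hx, hy, mul_add, add_mul]

theorem antipode_comp_bijective (hℓ : 3 ≤ ℓ) (h : a + b = 0) (h' : b + a = 0) :
    Function.Bijective (antipode (ℓ := ℓ) h' ∘ antipode (ℓ := ℓ) h) := by
  refine ⟨fun x y hxy => ?_, fun y => ⟨((pivot ℓ a)⁻¹ : (U ℓ a)ˣ) * y * pivot ℓ a, ?_⟩⟩
  · simp only [Function.comp_apply, antipode_antipode hℓ] at hxy
    exact (pivot ℓ a).mul_right_inj.1 ((pivot ℓ a)⁻¹.mul_left_inj.1 hxy)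
  · simp only [Function.comp_apply, antipode_antipode hℓ]
    simp [mul_assoc]

/-- The pivotal Hopf `ℂ/2ℤ`-coalgebra `(U, g)` with `g = K^{1-ℓ'}`. -/
noncomputable def pivotalU (ℓ : ℕ) (hℓ : 3 ≤ ℓ) : PivotalHopfGCoalgebra ℂ (U ℓ) where
  comul := comul hℓ
  counit := counit hℓ
  antipode := antipode
  coassoc := coassoc hℓ
  counit_right := counit_right hℓ
  counit_left := counit_left hℓ
  antipode_left := antipode_left hℓ
  antipode_right := antipode_right hℓ
  antipode_bijective {a b} h := by
    have h' : b + a = 0 := by rw [add_comm, h]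
    exact ⟨(antipode_comp_bijective hℓ h h').1.of_comp, (antipode_comp_bijective hℓ h' h).2.of_comp⟩
  pivot := pivot ℓ
  comul_pivot h := comul_K hℓ h _
  counit_pivot := counit_K hℓ _
  antipode_antipode := antipode_antipode hℓ

/-! ### The subalgebras generated by `E`, `F`, `K` and the integral -/

/-- The subalgebra `Ũ_a` of `U_a` generated by `E`, `F` and `K`. -/
noncomputable def smallU (ℓ : ℕ) (a : Deg) : Subalgebra ℂ (U ℓ a) :=
  Algebra.adjoin ℂ {E ℓ a, F ℓ a, K ℓ a 1}

/-- The family of linear forms `μ` is given on the monomials `E^i F^j K^α` (which span `U_a`) by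
`E^{ℓ'-1} F^{ℓ'-1} K^{nℓ/2} ↦ ξ^{nℓa/2} η` for `n ∈ ℤ`, all other ones being sent to `0`. -/
structure IsPBWForm (ℓ : ℕ) (η : ℂ) (μ : ∀ a : Deg, U ℓ a →ₗ[ℂ] ℂ) : Prop where
  eq_zero : ∀ (a : Deg) (i j : ℕ) (α : ℂ),
    (i ≠ ell' ℓ - 1 ∨ j ≠ ell' ℓ - 1 ∨ ∀ n : ℤ, α ≠ n * (ℓ / 2)) →
      μ a (E ℓ a ^ i * F ℓ a ^ j * K ℓ a α) = 0
  eq_top : ∀ (t : ℂ) (n : ℤ),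
    μ (t : Deg) (E ℓ t ^ (ell' ℓ - 1) * F ℓ t ^ (ell' ℓ - 1) * K ℓ t (n * (ℓ / 2))) =
      xi ℓ (n * (ℓ / 2) * t) * η

/-- The set `G'` of degrees: `ℂ/2ℤ` without the classes of `0` and `1` and, for odd `ℓ`, also
without the classes of `1/2` and `3/2`. -/
def genericDeg (ℓ : ℕ) : Set Deg :=
  {a | a ≠ 0 ∧ a ≠ ((1 : ℂ) : Deg) ∧
    (Odd ℓ → a ≠ ((1 / 2 : ℂ) : Deg) ∧ a ≠ ((3 / 2 : ℂ) : Deg))}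

/-- `z ∈ C(Ũ_a)` represents the restriction of `μ_a` to `Ũ_a` through the trace of the left regular
representation of `Ũ_a`: `μ_a(x) = tr_{Ũ_a}(L_{z x})` for all `x ∈ Ũ_a`. -/
def Represents (ℓ : ℕ) (a : Deg) (μ : U ℓ a →ₗ[ℂ] ℂ)
    (z : Subalgebra.center ℂ (smallU ℓ a)) : Prop :=
  ∀ x : smallU ℓ a,
    μ x = LinearMap.trace ℂ (smallU ℓ a) (LinearMap.mulLeft ℂ ((z : smallU ℓ a) * x))

/-- The linear form `μ_a ∘ L_z` on the center of `U_a`. -/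
noncomputable def modifiedForm (ℓ : ℕ) (a : Deg) (μ : U ℓ a →ₗ[ℂ] ℂ) (z : U ℓ a) :
    Subalgebra.center ℂ (U ℓ a) →ₗ[ℂ] ℂ :=
  μ ∘ₗ LinearMap.mulLeft ℂ z ∘ₗ (Subalgebra.center ℂ (U ℓ a)).val.toLinearMap

end QuantumSL2

/-! Commuting generators past each other shows that the monomials E^i F^j K^α with i, j < ℓ' span
U_a, so linear forms are determined by their values there. Their linear independence is never proved
as such, and the existence of μ therefore needs a construction. Apply Δ, then a matrix coefficient
of a highest weight module on the first factor and one of a lowest weight module of weight w on the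
second. The resulting form sends E^i F^j K^α to ξ^{αw} if i = j = ℓ'-1 and to 0 otherwise
(`topForm_monomial`). Composing with the projection onto Ũ_a and averaging over the lifts w = t + 2r
of the degree leaves only α ∈ (ℓ/2)ℤ, which gives μ_a (`exists_isPBWForm`). The properties of a
symmetrized integral are checked on monomials: the corrections from [E,F] have too low a degree for
μ to see, only one term of the coproduct survives a contraction, and K^{nℓ/2} is a scalar.

For generic a, the vectors v_r = E^{ℓ'-1} F^{ℓ'-1} e_r, with e_r the weight projectors, are highest
weight vectors for left multiplication and satisfy v_r F = 0. The rescaled products F^i v_r E^j are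
matrix units (`matrixUnit_mul`). They form ℓ' blocks of size ℓ' × ℓ', which exhausts the bound ℓ'^3
on dim Ũ_a. So Ũ_a is a product of matrix algebras, its trace form is nondegenerate, and the cyclic
form μ_a is represented by a unique central z_a.

The modified identity compares two computations of one trace. Through Δ, the space Ũ_a ⊗ Ũ_b has
coordinates over Ũ_{a+b} with respect to the elements 1 ⊗ v_j, and also with respect to the elements
w_i ⊗ 1, for bases v_j of Ũ_b and w_i of Ũ_a. If X commutes with Δ(Ũ_{a+b}), its trace composed with
the cyclic form μ_{a+b} is the same in both systems (`sum_trace_eq_sum_trace`). The integral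
property evaluates the two sides and gives tr(g_b (μ_a ⊗ Id)(X)) = tr(g_a⁻¹ (Id ⊗ μ_b)(X))
(`IsPBWForm.regularTrace_contract`). Taking X = (z_a ⊗ z_b) x turns both traces into values of μ,
and this is the claim. The contractions are central because K^{ℓ'} is a scalar, so that conjugation
by the pivot is conjugation by K. -/

namespace QuantumSL2

variable {ℓ : ℕ} {a b c : Deg}

/-! ### Commutation rules and spanning monomials -/

theorem xi_ne_zero (x : ℂ) : xi ℓ x ≠ 0 := Complex.exp_ne_zero _

theorem xi_eq_one_iff (hℓ : 3 ≤ ℓ) (x : ℂ) : xi ℓ x = 1 ↔ ∃ n : ℤ, x = n * ℓ := by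
  have h0 : (ℓ : ℂ) ≠ 0 := by exact_mod_cast (by omega : ℓ ≠ 0)
  have hpi := Complex.two_pi_I_ne_zero
  rw [xi, Complex.exp_eq_one_iff]
  refine exists_congr fun n => ?_
  rw [div_eq_iff h0]
  constructor
  · intro h
    apply mul_left_cancel₀ hpi
    linear_combination h
  · rintro rfl; ring

theorem xi_two_mul_ell' (hℓ : 3 ≤ ℓ) : xi ℓ (2 * ell' ℓ) = 1 := by
  have h1 := (xi_two_primitive (by omega : ℓ ≠ 0)).pow_eq_one
  rwa [← xi_nat_mul, mul_comm] at h1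

theorem ell'_pos (hℓ : 3 ≤ ℓ) : 0 < ell' ℓ := Nat.pos_of_ne_zero (ell'_ne_zero hℓ)

theorem ell'_cases (ℓ : ℕ) : (Even ℓ ∧ ℓ = 2 * ell' ℓ) ∨ (Odd ℓ ∧ ℓ = ell' ℓ) := by
  rcases Nat.even_or_odd ℓ with h | h
  · left
    refine ⟨h, ?_⟩
    have h2 : 2 ∣ ℓ := h.two_dvd
    rw [ell', Nat.gcd_eq_right h2]
    omega
  · right
    refine ⟨h, ?_⟩
    have : Nat.gcd ℓ 2 = 1 := (Nat.coprime_two_right).2 h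
    rw [ell', this, Nat.div_one]

theorem K_mul_E_pow (α : ℂ) (i : ℕ) :
    K ℓ a α * E ℓ a ^ i = xi ℓ (2 * α * i) • (E ℓ a ^ i * K ℓ a α) := by
  induction i with
  | zero => simp [xi_zero]
  | succ i ih =>
    rw [pow_succ, ← mul_assoc, ih, smul_mul_assoc, mul_assoc (E ℓ a ^ i), K_mul_E, mul_smul_comm,
      smul_smul, ← xi_add, ← mul_assoc (E ℓ a ^ i)]
    congr 2
    push_cast; ring

theorem K_mul_F_pow (α : ℂ) (i : ℕ) :
    K ℓ a α * F ℓ a ^ i = xi ℓ (-2 * α * i) • (F ℓ a ^ i * K ℓ a α) := by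
  induction i with
  | zero => simp [xi_zero]
  | succ i ih =>
    rw [pow_succ, ← mul_assoc, ih, smul_mul_assoc, mul_assoc (F ℓ a ^ i), K_mul_F, mul_smul_comm,
      smul_smul, ← xi_add, ← mul_assoc (F ℓ a ^ i)]
    congr 2
    push_cast; ring

theorem K_pow (α : ℂ) (n : ℕ) : K ℓ a α ^ n = K ℓ a (n * α) := by
  induction n with
  | zero => simp [K_zero]
  | succ n ih =>
    rw [pow_succ, ih, K_mul_K]; congr 1; push_cast; ring

theorem K_mul_monomial (i j : ℕ) (α β : ℂ) :
    K ℓ a β * (E ℓ a ^ i * F ℓ a ^ j * K ℓ a α) =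
      xi ℓ (2 * β * (i - j)) • (E ℓ a ^ i * F ℓ a ^ j * K ℓ a (α + β)) := by
  rw [← mul_assoc, ← mul_assoc, K_mul_E_pow, smul_mul_assoc, mul_assoc (E ℓ a ^ i), K_mul_F_pow,
    mul_smul_comm, smul_smul, ← xi_add, smul_mul_assoc, ← mul_assoc (E ℓ a ^ i),
    mul_assoc _ (K ℓ a β), K_mul_K, add_comm β α]
  congr 2
  ring

/-- Only the shape of the correction matters below: it has one power of E less and involves only K
and K⁻¹. The values of `u` and `v` are never used. -/
theorem exists_F_mul_E_pow (i : ℕ) : ∃ u v : ℂ, F ℓ a * E ℓ a ^ (i + 1) =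
    E ℓ a ^ (i + 1) * F ℓ a + E ℓ a ^ i * (u • K ℓ a 1 + v • K ℓ a (-1)) := by
  have h0 : F ℓ a * E ℓ a =
      E ℓ a * F ℓ a - (xi ℓ 1 - xi ℓ (-1))⁻¹ • (K ℓ a 1 - K ℓ a (-1)) := by
    rw [E_mul_F]; abel
  set s := (xi ℓ 1 - xi ℓ (-1))⁻¹
  induction i with
  | zero => exact ⟨-s, s, by rw [zero_add, pow_one, pow_zero, one_mul, h0, smul_sub, neg_smul]; abel⟩
  | succ i ih =>
    obtain ⟨u, v, h⟩ := ih
    refine ⟨u * xi ℓ (2 * 1) - s, v * xi ℓ (2 * -1) + s, ?_⟩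
    rw [pow_succ (E ℓ a) (i + 1), ← mul_assoc, h, add_mul, mul_assoc _ (F ℓ a), h0,
      mul_assoc _ _ (E ℓ a), add_mul, smul_mul_assoc, smul_mul_assoc, K_mul_E, K_mul_E,
      pow_succ (E ℓ a) i]
    simp only [mul_add, mul_sub, smul_sub, mul_smul_comm, smul_smul, sub_smul, add_smul, mul_assoc]
    abel

theorem exists_F_pow_mul_E (j : ℕ) : ∃ u v : ℂ, F ℓ a ^ (j + 1) * E ℓ a =
    E ℓ a * F ℓ a ^ (j + 1) + F ℓ a ^ j * (u • K ℓ a 1 + v • K ℓ a (-1)) := by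
  have h0 : F ℓ a * E ℓ a =
      E ℓ a * F ℓ a - (xi ℓ 1 - xi ℓ (-1))⁻¹ • (K ℓ a 1 - K ℓ a (-1)) := by
    rw [E_mul_F]; abel
  set s := (xi ℓ 1 - xi ℓ (-1))⁻¹
  induction j with
  | zero => exact ⟨-s, s, by rw [zero_add, pow_one, pow_zero, one_mul, h0, smul_sub, neg_smul]; abel⟩
  | succ j ih =>
    obtain ⟨u, v, h⟩ := ih
    refine ⟨u - s * xi ℓ (-2 * 1 * ↑(j + 1)), v + s * xi ℓ (-2 * -1 * ↑(j + 1)), ?_⟩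
    rw [pow_succ' (F ℓ a) (j + 1), mul_assoc, h, mul_add, ← mul_assoc, h0, sub_mul,
      smul_mul_assoc, sub_mul, K_mul_F_pow, K_mul_F_pow, ← mul_assoc (F ℓ a) (F ℓ a ^ j),
      ← pow_succ']
    simp only [mul_add, mul_sub, smul_sub, mul_smul_comm, smul_smul, sub_smul, add_smul, mul_assoc]
    abel

/-- The span of the monomials `E^i F^j K^α` with `i, j < ℓ'` and `α ∈ L`. -/
noncomputable def monomialSpan (ℓ : ℕ) (a : Deg) (L : AddSubgroup ℂ) : Submodule ℂ (U ℓ a) :=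
  Submodule.span ℂ {x | ∃ i < ell' ℓ, ∃ j < ell' ℓ, ∃ α ∈ L,
    E ℓ a ^ i * F ℓ a ^ j * K ℓ a α = x}

theorem E_pow_eq_zero {i : ℕ} (h : ell' ℓ ≤ i) : E ℓ a ^ i = 0 :=
  pow_eq_zero_of_le h (E_pow ℓ a)

theorem F_pow_eq_zero {i : ℕ} (h : ell' ℓ ≤ i) : F ℓ a ^ i = 0 :=
  pow_eq_zero_of_le h (F_pow ℓ a)

theorem monomial_mem_monomialSpan {L : AddSubgroup ℂ} (i j : ℕ) {α : ℂ} (hα : α ∈ L) :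
    E ℓ a ^ i * F ℓ a ^ j * K ℓ a α ∈ monomialSpan ℓ a L := by
  by_cases hi : i < ell' ℓ
  · by_cases hj : j < ell' ℓ
    · exact Submodule.subset_span ⟨i, hi, j, hj, α, hα, rfl⟩
    · rw [F_pow_eq_zero (not_lt.1 hj)]; simp
  · rw [E_pow_eq_zero (not_lt.1 hi)]; simp

/-- Moving F past E^i creates factors K and K⁻¹, which is why L has to contain 1. -/
theorem F_mul_monomial_mem {L : AddSubgroup ℂ} (h1 : (1 : ℂ) ∈ L) (i j : ℕ) {α : ℂ}
    (hα : α ∈ L) : F ℓ a * (E ℓ a ^ i * F ℓ a ^ j * K ℓ a α) ∈ monomialSpan ℓ a L := by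
  cases i with
  | zero =>
    rw [pow_zero, one_mul, ← mul_assoc, ← pow_succ']
    simpa using monomial_mem_monomialSpan (ℓ := ℓ) (a := a) 0 (j + 1) hα
  | succ i =>
    obtain ⟨u, v, h⟩ := exists_F_mul_E_pow (ℓ := ℓ) (a := a) i
    rw [← mul_assoc, ← mul_assoc, h, add_mul, add_mul, mul_assoc (E ℓ a ^ (i + 1)), ← pow_succ',
      mul_assoc (E ℓ a ^ i), add_mul, smul_mul_assoc, smul_mul_assoc, K_mul_F_pow, K_mul_F_pow]
    simp only [mul_add, add_mul, mul_smul_comm, smul_mul_assoc, ← mul_assoc (E ℓ a ^ i)]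
    simp only [mul_assoc _ (K ℓ a _) (K ℓ a _), K_mul_K]
    refine add_mem (monomial_mem_monomialSpan _ _ hα) (add_mem ?_ ?_) <;>
      refine Submodule.smul_mem _ _ (Submodule.smul_mem _ _ (monomial_mem_monomialSpan _ _ ?_))
    · exact add_mem h1 hα
    · exact add_mem (neg_mem h1) hα

/-- The span contains 1 and is stable under left multiplication by the generators. Keeping the
exponent group L general covers all of U_a (L = ℂ) and Ũ_a (L = ℤ) at once. -/
theorem mem_monomialSpan_of_mem_adjoin {L : AddSubgroup ℂ} (h1 : (1 : ℂ) ∈ L) {s : Set (U ℓ a)}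
    (hs : ∀ x ∈ s, x = E ℓ a ∨ x = F ℓ a ∨ ∃ α ∈ L, x = K ℓ a α) {x : U ℓ a}
    (hx : x ∈ Algebra.adjoin ℂ s) : x ∈ monomialSpan ℓ a L := by
  have key : ∀ y ∈ monomialSpan ℓ a L, x * y ∈ monomialSpan ℓ a L := by
    induction hx using Algebra.adjoin_induction with
    | mem x hx =>
      intro y hy
      induction hy using Submodule.span_induction with
      | mem y hy =>
        obtain ⟨i, -, j, -, α, hα, rfl⟩ := hy
        rcases hs x hx with rfl | rfl | ⟨β, hβ, rfl⟩
        · rw [← mul_assoc, ← mul_assoc, ← pow_succ']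
          exact monomial_mem_monomialSpan _ _ hα
        · exact F_mul_monomial_mem h1 i j hα
        · rw [K_mul_monomial]
          exact Submodule.smul_mem _ _ (monomial_mem_monomialSpan _ _ (add_mem hα hβ))
      | zero => rw [mul_zero]; exact zero_mem _
      | add y z _ _ hy hz => rw [mul_add]; exact add_mem hy hz
      | smul r y _ hy => rw [mul_smul_comm]; exact Submodule.smul_mem _ _ hy
    | algebraMap r =>
      intro y hy
      rw [← Algebra.smul_def]; exact Submodule.smul_mem _ _ hy
    | add x y _ _ hx hy =>
      intro z hz
      rw [add_mul]; exact add_mem (hx z hz) (hy z hz)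
    | mul x y _ _ hx hy =>
      intro z hz
      rw [mul_assoc]; exact hx _ (hy z hz)
  have h2 := key 1 (by
    simpa [K_zero] using monomial_mem_monomialSpan (ℓ := ℓ) (a := a) 0 0 (zero_mem L))
  rwa [mul_one] at h2

theorem mem_monomialSpan_top (x : U ℓ a) : x ∈ monomialSpan ℓ a ⊤ := by
  apply mem_monomialSpan_of_mem_adjoin (s := {E ℓ a, F ℓ a} ∪ Set.range (K ℓ a)) (AddSubgroup.mem_top _)
  · rintro x ((rfl | rfl) | ⟨α, rfl⟩)
    · exact Or.inl rfl
    · exact Or.inr (Or.inl rfl)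
    · exact Or.inr (Or.inr ⟨α, trivial, rfl⟩)
  · induction x using U.induction with
    | hc r => exact Subalgebra.algebraMap_mem _ r
    | hE => exact Algebra.subset_adjoin (by simp)
    | hF => exact Algebra.subset_adjoin (by simp)
    | hK α => exact Algebra.subset_adjoin (by simp)
    | hmul x y hx hy => exact mul_mem hx hy
    | hadd x y hx hy => exact add_mem hx hy

/-- Induction over the spanning monomials of `U_a`. -/
theorem monomial_induction {p : U ℓ a → Prop}
    (hmon : ∀ i < ell' ℓ, ∀ j < ell' ℓ, ∀ α, p (E ℓ a ^ i * F ℓ a ^ j * K ℓ a α))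
    (hadd : ∀ x y, p x → p y → p (x + y)) (hsmul : ∀ (r : ℂ) x, p x → p (r • x)) (h0 : p 0)
    (x : U ℓ a) : p x := by
  have hx := mem_monomialSpan_top x
  rw [monomialSpan] at hx
  induction hx using Submodule.span_induction with
  | mem x hx =>
    obtain ⟨i, hi, j, hj, α, -, rfl⟩ := hx
    exact hmon i hi j hj α
  | zero => exact h0
  | add x y _ _ hx hy => exact hadd x y hx hy
  | smul r x _ hx => exact hsmul r x hx

theorem linearMap_ext_monomial {M : Type*} [AddCommMonoid M] [Module ℂ M] {f g : U ℓ a →ₗ[ℂ] M}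
    (h : ∀ i < ell' ℓ, ∀ j < ell' ℓ, ∀ α, f (E ℓ a ^ i * F ℓ a ^ j * K ℓ a α) =
      g (E ℓ a ^ i * F ℓ a ^ j * K ℓ a α)) : f = g := by
  ext x
  induction x using monomial_induction with
  | hmon i hi j hj α => exact h i hi j hj α
  | hadd x y hx hy => rw [map_add, map_add, hx, hy]
  | hsmul r x hx => rw [map_smul, map_smul, hx]
  | h0 => rw [map_zero, map_zero]

end QuantumSL2

namespace QuantumSL2

variable {ℓ : ℕ} {a b c : Deg}

/-! ### The projection of `U_a` onto `Ũ_a` -/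

/-- The subgroup `ℤ + (ℓ/2)ℤ` of `ℂ`. -/
def smallExponents (ℓ : ℕ) : AddSubgroup ℂ := AddSubgroup.closure {1, (ℓ : ℂ) / 2}

theorem mem_smallExponents {α : ℂ} :
    α ∈ smallExponents ℓ ↔ ∃ k n : ℤ, k + n * ((ℓ : ℂ) / 2) = α := by
  simp [smallExponents, AddSubgroup.mem_closure_pair]

theorem one_mem_smallExponents : (1 : ℂ) ∈ smallExponents ℓ :=
  AddSubgroup.subset_closure (by simp)

theorem half_mem_smallExponents : (ℓ : ℂ) / 2 ∈ smallExponents ℓ :=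
  AddSubgroup.subset_closure (by simp)

/-- The defining relations are homogeneous when E and F have degree 0 and K^α has degree α, provided
that 1 and ℓ/2 have degree 0. The first is forced by [E,F], the second by the scalar value of
K^{ℓ/2}. -/
theorem gradingRels (ℓ : ℕ) (a : Deg) :
    Rels ℓ a (A := AddMonoidAlgebra (U ℓ a) (ℂ ⧸ smallExponents ℓ))
      (AddMonoidAlgebra.single 0 (E ℓ a)) (AddMonoidAlgebra.single 0 (F ℓ a))
      (fun α => AddMonoidAlgebra.single (α : ℂ ⧸ smallExponents ℓ) (K ℓ a α)) where
  mul_K α β := by rw [AddMonoidAlgebra.single_mul_single, K_mul_K]; rfl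
  K_zero := by rw [K_zero]; rfl
  K_E α := by
    rw [AddMonoidAlgebra.single_mul_single, AddMonoidAlgebra.single_mul_single, K_mul_E,
      AddMonoidAlgebra.smul_single, add_comm]
  K_F α := by
    rw [AddMonoidAlgebra.single_mul_single, AddMonoidAlgebra.single_mul_single, K_mul_F,
      AddMonoidAlgebra.smul_single, add_comm]
  E_F := by
    have h1 : ((1 : ℂ) : ℂ ⧸ smallExponents ℓ) = 0 :=
      (QuotientAddGroup.eq_zero_iff _).2 one_mem_smallExponents
    have h2 : ((-1 : ℂ) : ℂ ⧸ smallExponents ℓ) = 0 :=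
      (QuotientAddGroup.eq_zero_iff _).2 (neg_mem one_mem_smallExponents)
    rw [AddMonoidAlgebra.single_mul_single, AddMonoidAlgebra.single_mul_single, E_mul_F, h1, h2,
      ← AddMonoidAlgebra.single_sub, AddMonoidAlgebra.smul_single, AddMonoidAlgebra.single_add,
      add_zero]
  E_pow := by rw [AddMonoidAlgebra.single_pow, E_pow, AddMonoidAlgebra.single_zero]
  F_pow := by rw [AddMonoidAlgebra.single_pow, F_pow, AddMonoidAlgebra.single_zero]
  K_half t ht := by
    have h1 : (((ℓ : ℂ) / 2 : ℂ) : ℂ ⧸ smallExponents ℓ) = 0 :=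
      (QuotientAddGroup.eq_zero_iff _).2 half_mem_smallExponents
    rw [h1, K_half ℓ a t ht]; rfl

/-- The grading of `U_a` by the exponents of `K` modulo `ℤ + (ℓ/2)ℤ`, as a coaction. -/
noncomputable def grading (ℓ : ℕ) (a : Deg) :
    U ℓ a →ₐ[ℂ] AddMonoidAlgebra (U ℓ a) (ℂ ⧸ smallExponents ℓ) := (gradingRels ℓ a).lift

/-- The projection of `U_a` onto its part of degree zero, which is `Ũ_a`. -/
noncomputable def smallProj (ℓ : ℕ) (a : Deg) : U ℓ a →ₗ[ℂ] U ℓ a :=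
  Finsupp.lapply 0 ∘ₗ (AddMonoidAlgebra.coeffLinearEquiv ℂ).toLinearMap ∘ₗ
    (grading ℓ a).toLinearMap

theorem smallProj_apply (x : U ℓ a) : smallProj ℓ a x = (grading ℓ a x).coeff 0 := rfl

theorem grading_of_mem {x : U ℓ a} (hx : x ∈ smallU ℓ a) :
    grading ℓ a x = AddMonoidAlgebra.single 0 x := by
  rw [smallU] at hx
  induction hx using Algebra.adjoin_induction with
  | mem x hx =>
    rcases hx with rfl | rfl | rfl
    · exact (gradingRels ℓ a).lift_E
    · exact (gradingRels ℓ a).lift_F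
    · refine ((gradingRels ℓ a).lift_K 1).trans ?_
      rw [(QuotientAddGroup.eq_zero_iff _).2 one_mem_smallExponents]
  | algebraMap r => rw [AlgHom.commutes]; rfl
  | add x y _ _ hx hy => rw [map_add, hx, hy, AddMonoidAlgebra.single_add]
  | mul x y _ _ hx hy => rw [map_mul, hx, hy, AddMonoidAlgebra.single_mul_single, add_zero]

theorem smallProj_of_mem {x : U ℓ a} (hx : x ∈ smallU ℓ a) : smallProj ℓ a x = x := by
  rw [smallProj_apply, grading_of_mem hx]; simp

/-- Multiplication by elements of degree 0 preserves the grading. The projection is thus a map of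
Ũ_a-bimodules, and computations in the infinite-dimensional U_a can be moved to Ũ_a. -/
theorem smallProj_mul_left {u : U ℓ a} (hu : u ∈ smallU ℓ a) (x : U ℓ a) :
    smallProj ℓ a (u * x) = u * smallProj ℓ a x := by
  rw [smallProj_apply, map_mul, grading_of_mem hu, AddMonoidAlgebra.coeff_single_zero_mul]; rfl

theorem smallProj_mul_right {u : U ℓ a} (hu : u ∈ smallU ℓ a) (x : U ℓ a) :
    smallProj ℓ a (x * u) = smallProj ℓ a x * u := by
  rw [smallProj_apply, map_mul, grading_of_mem hu, AddMonoidAlgebra.coeff_mul_single_zero]; rfl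

theorem E_mem_smallU : E ℓ a ∈ smallU ℓ a := Algebra.subset_adjoin (by simp)
theorem F_mem_smallU : F ℓ a ∈ smallU ℓ a := Algebra.subset_adjoin (by simp)
theorem K_one_mem_smallU : K ℓ a 1 ∈ smallU ℓ a := Algebra.subset_adjoin (by simp)

theorem smallProj_K_of_notMem {α : ℂ} (hα : α ∉ smallExponents ℓ) :
    smallProj ℓ a (K ℓ a α) = 0 := by
  have h := (gradingRels ℓ a).lift_K α
  rw [smallProj_apply, grading, h, AddMonoidAlgebra.coeff_single,
    Finsupp.single_eq_of_ne (fun h => hα ((QuotientAddGroup.eq_zero_iff _).1 h.symm))]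

theorem K_int_mul_half (t : ℂ) (n : ℤ) :
    K ℓ t (n * ((ℓ : ℂ) / 2)) = algebraMap ℂ _ (xi ℓ (n * (ℓ / 2) * t)) := by
  have h1 := K_half ℓ t t rfl
  have h2 : K ℓ (t : Deg) (-((ℓ : ℂ) / 2)) = algebraMap ℂ (U ℓ t) (xi ℓ (-(ℓ * t / 2))) := by
    rw [← one_mul (K ℓ _ _), ← map_one (algebraMap ℂ (U ℓ t)), ← xi_neg_mul ℓ (ℓ * t / 2),
      map_mul, ← h1, mul_assoc, K_mul_K_neg, mul_one]
  obtain ⟨k, rfl | rfl⟩ := n.eq_nat_or_neg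
  · rw [Int.cast_natCast, ← K_pow, h1, ← map_pow, ← xi_nat_mul]
    congr 2; ring
  · rw [Int.cast_neg, Int.cast_natCast, neg_mul, ← mul_neg, ← K_pow, h2, ← map_pow, ← xi_nat_mul]
    congr 2; ring

/-- The integer ℓ' is ℓ/2 for even ℓ and 2·(ℓ/2) for odd ℓ, so K^{ℓ'} is a scalar in both cases. -/
theorem K_ell' (t : ℂ) : K ℓ t (ell' ℓ) = algebraMap ℂ _ (xi ℓ (ell' ℓ * t)) := by
  rcases ell'_cases ℓ with ⟨-, h⟩ | ⟨-, h⟩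
  · have h2 : ((1 : ℤ) : ℂ) * ((ℓ : ℂ) / 2) = ell' ℓ := by
      rw [show (ℓ : ℂ) = 2 * ell' ℓ by exact_mod_cast h]; push_cast; ring
    rw [← h2, K_int_mul_half]
  · have h2 : ((2 : ℤ) : ℂ) * ((ℓ : ℂ) / 2) = ell' ℓ := by
      rw [show (ell' ℓ : ℂ) = ℓ by exact_mod_cast h.symm]; push_cast; ring
    rw [← h2, K_int_mul_half]

/-- `K^k` for `k ∈ ℤ` is a scalar multiple of `K^r` with `0 ≤ r < ℓ'`. -/
theorem exists_K_int_eq (hℓ : 3 ≤ ℓ) (a : Deg) (k : ℤ) :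
    ∃ r < ell' ℓ, ∃ s : ℂ, K ℓ a k = s • K ℓ a 1 ^ r := by
  obtain ⟨t, rfl⟩ := QuotientAddGroup.mk_surjective a
  have hpos : (0 : ℤ) < ell' ℓ := by exact_mod_cast ell'_pos hℓ
  have hr := Int.emod_lt_of_pos k hpos
  have hr0 := Int.emod_nonneg k hpos.ne'
  obtain ⟨r, hr'⟩ := Int.eq_ofNat_of_zero_le hr0
  have hK : ∀ q : ℤ, ∃ s : ℂ, K ℓ t (q * ell' ℓ) = s • 1 := by
    intro q
    have h2 : K ℓ (t : Deg) (-ell' ℓ) = (xi ℓ (ell' ℓ * t))⁻¹ • 1 := by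
      have h3 := K_mul_K_neg ℓ (t : Deg) (ell' ℓ)
      rw [K_ell', ← Algebra.smul_def] at h3
      rw [← h3, smul_smul, inv_mul_cancel₀ (xi_ne_zero _), one_smul]
    obtain ⟨n, rfl | rfl⟩ := q.eq_nat_or_neg
    · refine ⟨xi ℓ (ell' ℓ * t) ^ n, ?_⟩
      rw [Int.cast_natCast, ← K_pow, K_ell', ← map_pow, Algebra.algebraMap_eq_smul_one]
    · refine ⟨(xi ℓ (ell' ℓ * t))⁻¹ ^ n, ?_⟩
      rw [Int.cast_neg, Int.cast_natCast, neg_mul, ← mul_neg, ← K_pow, h2, smul_pow, one_pow]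
  obtain ⟨s, hs⟩ := hK (k / ell' ℓ)
  refine ⟨r, by omega, s, ?_⟩
  have hk : (k : ℂ) = (k / ell' ℓ : ℤ) * ell' ℓ + r * 1 := by
    have := Int.mul_ediv_add_emod k (ell' ℓ)
    rw [hr'] at this
    conv_lhs => rw [← this]
    push_cast; ring
  rw [hk, ← K_mul_K, hs, smul_one_mul, K_pow]

theorem K_mem_smallU (hℓ : 3 ≤ ℓ) {α : ℂ} (hα : α ∈ smallExponents ℓ) : K ℓ a α ∈ smallU ℓ a := by
  obtain ⟨k, n, rfl⟩ := mem_smallExponents.1 hα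
  rw [← K_mul_K]
  obtain ⟨r, -, s, hs⟩ := exists_K_int_eq hℓ a k
  refine mul_mem ?_ ?_
  · rw [hs]
    exact Subalgebra.smul_mem _ (pow_mem K_one_mem_smallU r) s
  · obtain ⟨t, rfl⟩ := QuotientAddGroup.mk_surjective a
    exact (K_int_mul_half t n).symm ▸ Subalgebra.algebraMap_mem _ _

theorem monomial_mem_smallU (hℓ : 3 ≤ ℓ) (i j : ℕ) {α : ℂ} (hα : α ∈ smallExponents ℓ) :
    E ℓ a ^ i * F ℓ a ^ j * K ℓ a α ∈ smallU ℓ a :=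
  mul_mem (mul_mem (pow_mem E_mem_smallU i) (pow_mem F_mem_smallU j)) (K_mem_smallU hℓ hα)

theorem EF_mem_smallU (i j : ℕ) : E ℓ a ^ i * F ℓ a ^ j ∈ smallU ℓ a :=
  mul_mem (pow_mem E_mem_smallU i) (pow_mem F_mem_smallU j)

theorem smallProj_monomial_of_notMem (i j : ℕ) {α : ℂ} (hα : α ∉ smallExponents ℓ) :
    smallProj ℓ a (E ℓ a ^ i * F ℓ a ^ j * K ℓ a α) = 0 := by
  rw [smallProj_mul_left (EF_mem_smallU i j), smallProj_K_of_notMem hα, mul_zero]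

theorem smallProj_mem (hℓ : 3 ≤ ℓ) (x : U ℓ a) : smallProj ℓ a x ∈ smallU ℓ a := by
  induction x using monomial_induction with
  | hmon i hi j hj α =>
    by_cases hα : α ∈ smallExponents ℓ
    · have h := monomial_mem_smallU hℓ (a := a) i j hα
      rwa [smallProj_of_mem h]
    · rw [smallProj_monomial_of_notMem i j hα]; exact zero_mem _
  | hadd x y hx hy => rw [map_add]; exact add_mem hx hy
  | hsmul r x hx => rw [map_smul]; exact Subalgebra.smul_mem _ hx r
  | h0 => rw [map_zero]; exact zero_mem _

/-- `Ũ_a` is spanned by the monomials `E^i F^j K^k` with `0 ≤ i, j, k < ℓ'`. -/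
theorem smallU_le_span (hℓ : 3 ≤ ℓ) : Subalgebra.toSubmodule (smallU ℓ a) ≤
    Submodule.span ℂ (Set.range fun p : Fin (ell' ℓ) × Fin (ell' ℓ) × Fin (ell' ℓ) =>
      E ℓ a ^ (p.1 : ℕ) * F ℓ a ^ (p.2.1 : ℕ) * K ℓ a 1 ^ (p.2.2 : ℕ)) := by
  intro x hx
  have h1 : x ∈ monomialSpan ℓ a (AddSubgroup.zmultiples (1 : ℂ)) := by
    refine mem_monomialSpan_of_mem_adjoin (AddSubgroup.mem_zmultiples 1)
      (s := {E ℓ a, F ℓ a, K ℓ a 1}) ?_ hx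
    rintro y (rfl | rfl | rfl)
    · exact Or.inl rfl
    · exact Or.inr (Or.inl rfl)
    · exact Or.inr (Or.inr ⟨1, AddSubgroup.mem_zmultiples 1, rfl⟩)
  refine Submodule.span_le.2 ?_ h1
  rintro _ ⟨i, hi, j, hj, α, hα, rfl⟩
  obtain ⟨k, rfl⟩ := AddSubgroup.mem_zmultiples_iff.1 hα
  obtain ⟨r, hr, s, hs⟩ := exists_K_int_eq hℓ a k
  rw [zsmul_one, hs, mul_smul_comm]
  exact Submodule.smul_mem _ _ (Submodule.subset_span ⟨(⟨i, hi⟩, ⟨j, hj⟩, ⟨r, hr⟩), rfl⟩)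

end QuantumSL2

namespace QuantumSL2

variable {ℓ : ℕ} {a b c : Deg}

/-! ### Highest weight modules -/

theorem xi_sub_ne_zero (hℓ : 3 ≤ ℓ) : xi ℓ 1 - xi ℓ (-1) ≠ 0 := by
  intro h
  have h1 : xi ℓ 2 = 1 := by
    rw [show (2 : ℂ) = 1 + 1 by norm_num, xi_add]
    nth_rw 1 [sub_eq_zero.1 h]
    exact xi_neg_mul ℓ 1
  obtain ⟨n, hn⟩ := (xi_eq_one_iff hℓ 2).1 h1
  have h2 : (2 : ℤ) = n * ℓ := by exact_mod_cast hn
  have h3 : (ℓ : ℤ) ∣ 2 := ⟨n, by rw [h2, mul_comm]⟩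
  have := Int.le_of_dvd (by norm_num) h3
  omega

/-- The coefficients of the action of `E` on the highest weight module of weight `w`. -/
noncomputable def hwCoeff (ℓ : ℕ) (w x : ℂ) : ℂ :=
  (xi ℓ x - xi ℓ (-x)) * (xi ℓ (1 - x + w) - xi ℓ (-(1 - x + w))) / (xi ℓ 1 - xi ℓ (-1)) ^ 2

theorem xi_neg (x : ℂ) : xi ℓ (-x) = (xi ℓ x)⁻¹ :=
  eq_inv_of_mul_eq_one_left (xi_neg_mul ℓ x)

theorem hwCoeff_zero (w : ℂ) : hwCoeff ℓ w 0 = 0 := by simp [hwCoeff]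

/-- The quantum integer [ℓ'] vanishes because ξ^{2ℓ'} = 1. This allows the module to be cut off in
dimension ℓ'. -/
theorem hwCoeff_ell' (hℓ : 3 ≤ ℓ) (w : ℂ) : hwCoeff ℓ w (ell' ℓ) = 0 := by
  have h : xi ℓ (ell' ℓ) = xi ℓ (-ell' ℓ) := by
    rw [xi_neg]
    refine eq_inv_of_mul_eq_one_left ?_
    rw [← xi_add, ← two_mul, xi_two_mul_ell' hℓ]
  rw [hwCoeff, h, sub_self, zero_mul, zero_div]

/-- In quantum integers this reads [x+1][w-x] = [x][w+1-x] + [w-2x], which is the relation for [E,F]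
on the vector of weight w - 2x. -/
theorem hwCoeff_succ (hℓ : 3 ≤ ℓ) (w x : ℂ) : hwCoeff ℓ w (x + 1) = hwCoeff ℓ w x +
    (xi ℓ 1 - xi ℓ (-1))⁻¹ * (xi ℓ (w - 2 * x) - xi ℓ (-(w - 2 * x))) := by
  have h0 := xi_sub_ne_zero hℓ
  rw [hwCoeff, hwCoeff]
  rw [show 1 - (x + 1) + w = w + -x by ring, show 1 - x + w = 1 + (w + -x) by ring,
    show w - 2 * x = w + (-x + -x) by ring]
  simp only [xi_neg, xi_add] at h0 ⊢
  have h1 := xi_ne_zero (ℓ := ℓ) 1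
  have h2 := xi_ne_zero (ℓ := ℓ) x
  have h3 := xi_ne_zero (ℓ := ℓ) w
  generalize xi ℓ 1 = q at *
  generalize xi ℓ x = X at *
  generalize xi ℓ w = W at *
  have h4 : q ^ 2 - 1 ≠ 0 := by
    intro h; apply h0; field_simp; linear_combination h
  field_simp
  ring

/-- Extension by zero of a finite sequence. -/
def extZero {n : ℕ} (v : Fin n → ℂ) (j : ℕ) : ℂ := if h : j < n then v ⟨j, h⟩ else 0

theorem extZero_of_lt {n : ℕ} (v : Fin n → ℂ) {j : ℕ} (h : j < n) : extZero v j = v ⟨j, h⟩ :=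
  dif_pos h

theorem extZero_of_le {n : ℕ} (v : Fin n → ℂ) {j : ℕ} (h : n ≤ j) : extZero v j = 0 :=
  dif_neg (not_lt.2 h)

theorem extZero_val {n : ℕ} (v : Fin n → ℂ) (j : Fin n) : extZero v j = v j :=
  dif_pos j.2

theorem extZero_add {n : ℕ} (v w : Fin n → ℂ) (j : ℕ) :
    extZero (v + w) j = extZero v j + extZero w j := by
  unfold extZero; split <;> simp

theorem extZero_smul {n : ℕ} (r : ℂ) (v : Fin n → ℂ) (j : ℕ) :
    extZero (r • v) j = r * extZero v j := by
  unfold extZero; split <;> simp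

/-- The action of `E` on the highest weight module. -/
noncomputable def hwE (ℓ : ℕ) (w : ℂ) (n : ℕ) : Module.End ℂ (Fin n → ℂ) where
  toFun v j := hwCoeff ℓ w (j + 1) * extZero v (j + 1)
  map_add' v w := by ext j; simp only [extZero_add, Pi.add_apply]; ring
  map_smul' r v := by ext j; simp only [extZero_smul, Pi.smul_apply, smul_eq_mul, RingHom.id_apply]; ring

/-- The action of `F` on the highest weight module. -/
def hwF (n : ℕ) : Module.End ℂ (Fin n → ℂ) where
  toFun v j := if (j : ℕ) = 0 then 0 else extZero v (j - 1)
  map_add' v w := by ext j; simp only [extZero_add, Pi.add_apply]; split <;> simp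
  map_smul' r v := by
    ext j; simp only [extZero_smul, Pi.smul_apply, smul_eq_mul, RingHom.id_apply]; split <;> simp

/-- The action of `K^α` on the highest weight module. -/
noncomputable def hwK (ℓ : ℕ) (w : ℂ) (n : ℕ) (α : ℂ) : Module.End ℂ (Fin n → ℂ) where
  toFun v j := xi ℓ (α * (w - 2 * j)) * v j
  map_add' v w := by ext j; simp only [Pi.add_apply]; ring
  map_smul' r v := by ext j; simp only [Pi.smul_apply, smul_eq_mul, RingHom.id_apply]; ring

theorem hwF_pow_apply {n : ℕ} (k : ℕ) (v : Fin n → ℂ) (j : Fin n) :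
    (hwF n ^ k) v j = if (j : ℕ) < k then 0 else extZero v (j - k) := by
  induction k generalizing j with
  | zero => simp [extZero_val]
  | succ k ih =>
    rw [pow_succ', Module.End.mul_apply]
    change (if (j : ℕ) = 0 then 0 else extZero ((hwF n ^ k) v) (j - 1)) = _
    by_cases h0 : (j : ℕ) = 0
    · simp [h0]
    · rw [if_neg h0, extZero_of_lt _ (by omega : (j : ℕ) - 1 < n), ih]
      simp only
      by_cases h1 : (j : ℕ) < k + 1
      · rw [if_pos h1, if_pos (by omega)]
      · rw [if_neg h1, if_neg (by omega)]; congr 1; omega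

theorem hwE_pow_apply {n : ℕ} {w : ℂ} (k : ℕ) (v : Fin n → ℂ) (j : Fin n) (h : n ≤ j + k) :
    (hwE ℓ w n ^ k) v j = 0 := by
  induction k generalizing j with
  | zero => omega
  | succ k ih =>
    rw [pow_succ', Module.End.mul_apply]
    change hwCoeff ℓ w (j + 1) * extZero ((hwE ℓ w n ^ k) v) (j + 1) = 0
    by_cases h1 : (j : ℕ) + 1 < n
    · rw [extZero_of_lt _ h1, ih ⟨j + 1, h1⟩ (by simp only; omega), mul_zero]
    · rw [extZero_of_le _ (by omega), mul_zero]

theorem hwE_apply {n : ℕ} {w : ℂ} (v : Fin n → ℂ) (j : Fin n) :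
    hwE ℓ w n v j = hwCoeff ℓ w (j + 1) * extZero v (j + 1) := rfl

theorem hwF_apply {n : ℕ} (v : Fin n → ℂ) (j : Fin n) :
    hwF n v j = if (j : ℕ) = 0 then 0 else extZero v (j - 1) := rfl

theorem hwK_apply {n : ℕ} {w α : ℂ} (v : Fin n → ℂ) (j : Fin n) :
    hwK ℓ w n α v j = xi ℓ (α * (w - 2 * j)) * v j := rfl

/-- The coordinate vector of index j plays the role of F^j v, of weight w - 2j, for a highest weight
vector v. -/
theorem hwRels (hℓ : 3 ≤ ℓ) (w : ℂ) : Rels ℓ (w : Deg) (hwE ℓ w (ell' ℓ)) (hwF (ell' ℓ))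
    (hwK ℓ w (ell' ℓ)) where
  mul_K α β := by
    ext v j
    simp only [LinearMap.comp_apply, Module.End.mul_apply, hwK_apply]
    rw [← mul_assoc, ← xi_add]; congr 2; ring
  K_zero := by
    ext v j
    simp [hwK_apply, xi_zero]
  K_E α := by
    refine LinearMap.ext fun v => funext fun j => ?_
    simp only [Module.End.mul_apply, hwK_apply, hwE_apply, LinearMap.smul_apply, Pi.smul_apply,
      smul_eq_mul]
    by_cases h1 : (j : ℕ) + 1 < ell' ℓ
    · rw [extZero_of_lt _ h1, extZero_of_lt _ h1, hwK_apply,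
        show α * (w - 2 * j) = 2 * α + α * (w - 2 * ((j : ℕ) + 1 : ℕ)) by push_cast; ring, xi_add]
      ring
    · rw [extZero_of_le _ (by omega), extZero_of_le _ (by omega)]; simp
  K_F α := by
    refine LinearMap.ext fun v => funext fun j => ?_
    simp only [Module.End.mul_apply, hwK_apply, hwF_apply, LinearMap.smul_apply, Pi.smul_apply,
      smul_eq_mul]
    by_cases h0 : (j : ℕ) = 0
    · simp [h0]
    · have h1 : (j : ℕ) - 1 < ell' ℓ := by omega
      rw [if_neg h0, if_neg h0, extZero_of_lt _ h1, extZero_of_lt _ h1, hwK_apply,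
        show α * (w - 2 * j) = -2 * α + α * (w - 2 * ((j : ℕ) - 1 : ℕ)) by
          rw [Nat.cast_sub (by omega)]; push_cast; ring, xi_add]
      ring
  E_F := by
    refine LinearMap.ext fun v => funext fun j => ?_
    have e1 : hwE ℓ w (ell' ℓ) (hwF (ell' ℓ) v) j = hwCoeff ℓ w (j + 1) * v j := by
      rw [hwE_apply]
      by_cases h1 : (j : ℕ) + 1 < ell' ℓ
      · rw [extZero_of_lt _ h1, hwF_apply, if_neg (by simp)]
        simp [extZero_val]
      -- On the last basis vector F gives 0, and the formula still holds because the coefficient at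
      -- ℓ' vanishes.
      · have h2 : ((j : ℕ) : ℂ) + 1 = ell' ℓ := by exact_mod_cast (by omega : (j : ℕ) + 1 = ell' ℓ)
        rw [h2, hwCoeff_ell' hℓ, zero_mul, zero_mul]
    have e2 : hwF (ell' ℓ) (hwE ℓ w (ell' ℓ) v) j = hwCoeff ℓ w j * v j := by
      rw [hwF_apply]
      by_cases h0 : (j : ℕ) = 0
      · rw [if_pos h0, h0, Nat.cast_zero, hwCoeff_zero, zero_mul]
      · have h1 : (j : ℕ) - 1 < ell' ℓ := by omega
        rw [if_neg h0, extZero_of_lt _ h1, hwE_apply]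
        simp only
        rw [Nat.sub_add_cancel (by omega), extZero_val, Nat.cast_sub (by omega)]
        simp
    simp only [Module.End.mul_apply, LinearMap.add_apply, Pi.add_apply, LinearMap.smul_apply,
      Pi.smul_apply, LinearMap.sub_apply, Pi.sub_apply, smul_eq_mul]
    rw [e1, e2, hwCoeff_succ hℓ, hwK_apply, hwK_apply, one_mul, neg_one_mul]
    ring
  E_pow := by
    refine LinearMap.ext fun v => funext fun j => ?_
    exact hwE_pow_apply _ v j (by omega)
  F_pow := by
    refine LinearMap.ext fun v => funext fun j => ?_
    rw [hwF_pow_apply, if_pos j.2]; rfl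
  K_half t ht := by
    refine LinearMap.ext fun v => funext fun j => ?_
    rw [hwK_apply, Module.algebraMap_end_apply, Pi.smul_apply, smul_eq_mul]
    congr 1
    -- Another lift of the degree differs from w by an even integer, as do all the weights w - 2j.
    -- Multiplied by ℓ/2, an even integer becomes a multiple of ℓ, which ξ does not see.
    obtain ⟨n, hn⟩ := AddSubgroup.mem_zmultiples_iff.1 (QuotientAddGroup.eq.1 ht)
    have hw : w = t + n * 2 := by rw [zsmul_eq_mul] at hn; linear_combination -hn
    rw [hw, show (ℓ : ℂ) / 2 * (t + n * 2 - 2 * j) = ℓ * t / 2 + ((n - j : ℤ) : ℂ) * ℓ by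
      push_cast; ring, xi_add, (xi_eq_one_iff hℓ (((n - j : ℤ) : ℂ) * ℓ)).2 ⟨_, rfl⟩, mul_one]

/-- The matrix coefficient of the highest weight module of weight `w` from the highest to the lowest
weight vector. -/
noncomputable def hwForm (hℓ : 3 ≤ ℓ) (w : ℂ) : U ℓ (w : Deg) →ₗ[ℂ] ℂ :=
  LinearMap.proj (⟨ell' ℓ - 1, Nat.sub_lt (ell'_pos hℓ) one_pos⟩ : Fin (ell' ℓ)) ∘ₗ
    LinearMap.applyₗ (Pi.single ⟨0, ell'_pos hℓ⟩ 1 : Fin (ell' ℓ) → ℂ) ∘ₗ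
      (hwRels hℓ w).lift.toLinearMap

theorem hwForm_apply (hℓ : 3 ≤ ℓ) (w : ℂ) (x : U ℓ (w : Deg)) :
    hwForm hℓ w x = (hwRels hℓ w).lift x (Pi.single ⟨0, ell'_pos hℓ⟩ 1)
      ⟨ell' ℓ - 1, Nat.sub_lt (ell'_pos hℓ) one_pos⟩ := rfl

theorem hwForm_mul_E (hℓ : 3 ≤ ℓ) (w : ℂ) (x : U ℓ (w : Deg)) :
    hwForm hℓ w (x * E ℓ _) = 0 := by
  have h : hwE ℓ w (ell' ℓ) (Pi.single ⟨0, ell'_pos hℓ⟩ 1) = 0 := by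
    funext j
    rw [hwE_apply]
    unfold extZero
    split <;> simp
  rw [hwForm_apply, map_mul, Rels.lift_E, Module.End.mul_apply, h, map_zero]; rfl

theorem hwForm_mul_K (hℓ : 3 ≤ ℓ) (w α : ℂ) (x : U ℓ (w : Deg)) :
    hwForm hℓ w (x * K ℓ _ α) = xi ℓ (α * w) * hwForm hℓ w x := by
  have h : hwK ℓ w (ell' ℓ) α (Pi.single ⟨0, ell'_pos hℓ⟩ 1) =
      xi ℓ (α * w) • Pi.single ⟨0, ell'_pos hℓ⟩ 1 := by
    funext j
    rw [hwK_apply]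
    by_cases hj : j = ⟨0, ell'_pos hℓ⟩
    · subst hj; simp
    · simp [hj]
  rw [hwForm_apply, map_mul, Rels.lift_K, Module.End.mul_apply, h, map_smul, hwForm_apply]; rfl

theorem hwForm_F_pow (hℓ : 3 ≤ ℓ) (w : ℂ) (j : ℕ) :
    hwForm hℓ w (F ℓ _ ^ j) = if j = ell' ℓ - 1 then 1 else 0 := by
  have hpos := ell'_pos hℓ
  rw [hwForm_apply, map_pow, Rels.lift_F, hwF_pow_apply]
  simp only
  rcases lt_trichotomy j (ell' ℓ - 1) with h | h | h
  · rw [if_neg (by omega), if_neg (by omega), extZero_of_lt _ (by omega), Pi.single_eq_of_ne]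
    simp only [ne_eq, Fin.mk.injEq]; omega
  · rw [if_neg (by omega), if_pos h, extZero_of_lt _ (by omega)]
    simp [h]
  · rw [if_pos h, if_neg (by omega)]

/-- The involution exchanging `E` and `F`. -/
theorem cartanRels (h : a + b = 0) : Rels ℓ a (F ℓ b) (E ℓ b) (fun α => K ℓ b (-α)) where
  mul_K α β := by rw [K_mul_K]; congr 1; ring
  K_zero := by rw [neg_zero, K_zero]
  K_E α := by rw [K_mul_F]; congr 2; ring
  K_F α := by rw [K_mul_E]; congr 2; ring
  E_F := by
    rw [E_mul_F, neg_neg, add_assoc, ← smul_add, sub_add_sub_cancel, sub_self, smul_zero, add_zero]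
  E_pow := F_pow ℓ b
  F_pow := E_pow ℓ b
  K_half t ht := by
    have hb : ((-t : ℂ) : Deg) = b := by
      rw [QuotientAddGroup.mk_neg, ht]; exact neg_eq_of_add_eq_zero_right h
    subst hb
    have := K_int_mul_half (ℓ := ℓ) (-t) (-1)
    rw [show -((ℓ : ℂ) / 2) = ((-1 : ℤ) : ℂ) * (ℓ / 2) by push_cast; ring, this]
    congr 2; push_cast; ring

/-- The matrix coefficient of the lowest weight module of weight `w` from the lowest to the highest
weight vector. -/
noncomputable def lwForm (hℓ : 3 ≤ ℓ) (w : ℂ) : U ℓ (w : Deg) →ₗ[ℂ] ℂ :=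
  hwForm hℓ (-w) ∘ₗ (cartanRels (ℓ := ℓ) (a := (w : Deg)) (b := ((-w : ℂ) : Deg))
    (by rw [QuotientAddGroup.mk_neg, add_neg_cancel])).lift.toLinearMap

theorem lwForm_mul_F (hℓ : 3 ≤ ℓ) (w : ℂ) (x : U ℓ (w : Deg)) :
    lwForm hℓ w (x * F ℓ _) = 0 := by
  rw [lwForm, LinearMap.comp_apply, AlgHom.toLinearMap_apply, map_mul, Rels.lift_F, hwForm_mul_E]

theorem lwForm_mul_K (hℓ : 3 ≤ ℓ) (w α : ℂ) (x : U ℓ (w : Deg)) :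
    lwForm hℓ w (x * K ℓ _ α) = xi ℓ (α * w) * lwForm hℓ w x := by
  rw [lwForm, LinearMap.comp_apply, AlgHom.toLinearMap_apply, map_mul, Rels.lift_K, hwForm_mul_K,
    neg_mul_neg]
  rfl

theorem lwForm_E_pow (hℓ : 3 ≤ ℓ) (w : ℂ) (j : ℕ) :
    lwForm hℓ w (E ℓ _ ^ j) = if j = ell' ℓ - 1 then 1 else 0 := by
  rw [lwForm, LinearMap.comp_apply, AlgHom.toLinearMap_apply, map_pow, Rels.lift_E, hwForm_F_pow]

end QuantumSL2

namespace QuantumSL2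

variable {ℓ : ℕ} {a b c : Deg}

/-! ### Coproducts of monomials -/

theorem comul_E_pow (hℓ : 3 ≤ ℓ) (h : a + b = c) (i : ℕ) :
    comul hℓ h (E ℓ c ^ i) = ∑ k ∈ Finset.range (i + 1), gauss (xi ℓ 2) i k •
      ((E ℓ a ^ (i - k)) ⊗ₜ[ℂ] (E ℓ b ^ k * K ℓ b ((i - k : ℕ) * 1))) := by
  rw [map_pow, comul_E, q_binomial (q := xi ℓ 2)]
  · refine Finset.sum_congr rfl fun k _ => ?_
    rw [Algebra.TensorProduct.tmul_pow, Algebra.TensorProduct.tmul_pow,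
      Algebra.TensorProduct.tmul_mul_tmul, one_pow, one_mul, K_pow]
  · simp only [Algebra.TensorProduct.tmul_mul_tmul, one_mul, mul_one, K_mul_E,
      TensorProduct.tmul_smul]

theorem comul_F_pow (hℓ : 3 ≤ ℓ) (h : a + b = c) (j : ℕ) :
    comul hℓ h (F ℓ c ^ j) = ∑ k ∈ Finset.range (j + 1), gauss (xi ℓ 2) j k •
      ((F ℓ a ^ k * K ℓ a ((j - k : ℕ) * -1)) ⊗ₜ[ℂ] (F ℓ b ^ (j - k))) := by
  rw [map_pow, comul_F, add_comm, q_binomial (q := xi ℓ 2)]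
  · refine Finset.sum_congr rfl fun k _ => ?_
    rw [Algebra.TensorProduct.tmul_pow, Algebra.TensorProduct.tmul_pow,
      Algebra.TensorProduct.tmul_mul_tmul, one_pow, one_mul, K_pow]
  · simp only [Algebra.TensorProduct.tmul_mul_tmul, one_mul, mul_one, K_mul_F,
      TensorProduct.smul_tmul', mul_neg, neg_neg]

theorem comul_monomial (hℓ : 3 ≤ ℓ) (h : a + b = c) (i j : ℕ) (α : ℂ) :
    comul hℓ h (E ℓ c ^ i * F ℓ c ^ j * K ℓ c α) =
      ∑ k ∈ Finset.range (i + 1), ∑ k' ∈ Finset.range (j + 1),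
        (gauss (xi ℓ 2) i k * gauss (xi ℓ 2) j k') •
          ((E ℓ a ^ (i - k) * F ℓ a ^ k' * K ℓ a ((j - k' : ℕ) * -1 + α)) ⊗ₜ[ℂ]
            (E ℓ b ^ k * K ℓ b ((i - k : ℕ) * 1) * F ℓ b ^ (j - k') * K ℓ b α)) := by
  rw [map_mul, map_mul, comul_E_pow, comul_F_pow, comul_K, Finset.sum_mul_sum, Finset.sum_mul]
  refine Finset.sum_congr rfl fun k _ => ?_
  rw [Finset.sum_mul]
  refine Finset.sum_congr rfl fun k' _ => ?_
  rw [smul_mul_smul_comm, smul_mul_assoc, Algebra.TensorProduct.tmul_mul_tmul,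
    Algebra.TensorProduct.tmul_mul_tmul, ← K_mul_K]
  simp only [mul_assoc]

/-- In every evaluation of a form on a coproduct below, exactly one term of the double sum can be
nonzero. This isolates it once and for all. -/
theorem map_comul_monomial {M : Type*} [AddCommGroup M] [Module ℂ M] (hℓ : 3 ≤ ℓ)
    (h : a + b = c) (i j : ℕ) (α : ℂ) (Φ : U ℓ a ⊗[ℂ] U ℓ b →ₗ[ℂ] M) {k₀ k₀' : ℕ}
    (hk₀ : k₀ ≤ i) (hk₀' : k₀' ≤ j)
    (h0 : ∀ k ≤ i, ∀ k' ≤ j, k ≠ k₀ ∨ k' ≠ k₀' →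
      Φ ((E ℓ a ^ (i - k) * F ℓ a ^ k' * K ℓ a ((j - k' : ℕ) * -1 + α)) ⊗ₜ[ℂ]
        (E ℓ b ^ k * K ℓ b ((i - k : ℕ) * 1) * F ℓ b ^ (j - k') * K ℓ b α)) = 0) :
    Φ (comul hℓ h (E ℓ c ^ i * F ℓ c ^ j * K ℓ c α)) =
      (gauss (xi ℓ 2) i k₀ * gauss (xi ℓ 2) j k₀') •
        Φ ((E ℓ a ^ (i - k₀) * F ℓ a ^ k₀' * K ℓ a ((j - k₀' : ℕ) * -1 + α)) ⊗ₜ[ℂ]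
          (E ℓ b ^ k₀ * K ℓ b ((i - k₀ : ℕ) * 1) * F ℓ b ^ (j - k₀') * K ℓ b α)) := by
  rw [comul_monomial, map_sum, Finset.sum_eq_single k₀]
  · rw [map_sum, Finset.sum_eq_single k₀', map_smul]
    · intro k' hk' hne
      rw [map_smul, h0 k₀ hk₀ k' (by rw [Finset.mem_range] at hk'; omega) (Or.inr hne), smul_zero]
    · intro hn; exact absurd (Finset.mem_range.2 (by omega)) hn
  · intro k hk hne
    rw [map_sum]
    refine Finset.sum_eq_zero fun k' hk' => ?_
    rw [Finset.mem_range] at hk hk'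
    rw [map_smul, h0 k (by omega) k' (by omega) (Or.inl hne), smul_zero]
  · intro hn; exact absurd (Finset.mem_range.2 (by omega)) hn

/-! ### Existence and uniqueness of the form `μ` -/

/-- A linear form on `U_a` detecting `E^(ℓ'-1) F^(ℓ'-1) K^α`. -/
noncomputable def topForm (hℓ : 3 ≤ ℓ) (w : ℂ) (h : (w : Deg) = a) : U ℓ a →ₗ[ℂ] ℂ :=
  LinearMap.mul' ℂ ℂ ∘ₗ TensorProduct.map (hwForm hℓ 0) (lwForm hℓ w) ∘ₗ
    (comul hℓ (a := ((0 : ℂ) : Deg)) (b := (w : Deg)) (c := a)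
      (by rw [← QuotientAddGroup.mk_add, zero_add, h])).toLinearMap

/-- The lowest weight form kills right multiples of F, so all of F^j has to sit in the first factor.
It then requires ℓ'-1 powers of E in the second factor, which uses up all of E^i since i ≤ ℓ'-1. The
first factor has weight 0, so K contributes only ξ^{αw}. -/
theorem topForm_monomial (hℓ : 3 ≤ ℓ) (w : ℂ) (h : (w : Deg) = a) {i j : ℕ} (hi : i < ell' ℓ) (hj : j < ell' ℓ)
    (α : ℂ) : topForm hℓ w h (E ℓ a ^ i * F ℓ a ^ j * K ℓ a α) =
      if i = ell' ℓ - 1 ∧ j = ell' ℓ - 1 then xi ℓ (α * w) else 0 := by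
  rw [topForm, ← LinearMap.comp_assoc, LinearMap.comp_apply, AlgHom.toLinearMap_apply,
    map_comul_monomial hℓ _ i j α _ le_rfl le_rfl]
  · rw [gauss_self, gauss_self, one_mul, one_smul, LinearMap.comp_apply, TensorProduct.map_tmul,
      LinearMap.mul'_apply, lwForm_mul_K, Nat.sub_self, Nat.sub_self, pow_zero, pow_zero, one_mul,
      mul_one, Nat.cast_zero, zero_mul, zero_mul, K_zero, mul_one, lwForm_E_pow, hwForm_mul_K,
      hwForm_F_pow]
    simp only [mul_zero, xi_zero, one_mul]
    split_ifs <;> simp_all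
  · intro k hk k' hk' hne
    rw [LinearMap.comp_apply, TensorProduct.map_tmul, LinearMap.mul'_apply, lwForm_mul_K]
    by_cases h1 : k' = j
    · subst h1
      rw [Nat.sub_self, pow_zero, mul_one, lwForm_mul_K, lwForm_E_pow, if_neg (by omega)]
      simp
    · rw [show j - k' = (j - k' - 1) + 1 by omega, pow_succ, ← mul_assoc _ _ (F ℓ (w : Deg)),
        lwForm_mul_F]
      simp

theorem IsPBWForm.apply_monomial {η : ℂ} {μ : ∀ a : Deg, U ℓ a →ₗ[ℂ] ℂ} (hμ : IsPBWForm ℓ η μ)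
    (t : ℂ) (i j : ℕ) (α : ℂ) [Decidable (∃ n : ℤ, α = n * (ℓ / 2))] :
    μ t (E ℓ t ^ i * F ℓ t ^ j * K ℓ t α) =
      if i = ell' ℓ - 1 ∧ j = ell' ℓ - 1 ∧ ∃ n : ℤ, α = n * (ℓ / 2) then xi ℓ (α * t) * η
        else 0 := by
  split_ifs with h
  · obtain ⟨rfl, rfl, n, rfl⟩ := h
    exact hμ.eq_top t n
  · apply hμ.eq_zero
    by_contra h2
    push Not at h2
    exact h h2

/-- Since K^{nℓ/2} is a scalar, the top values for all n follow from the one at n = 0. Monomials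
with i or j at least ℓ' are zero already. -/
theorem isPBWForm_of_monomial {η : ℂ} {μ : ∀ a : Deg, U ℓ a →ₗ[ℂ] ℂ}
    (h0 : ∀ (a : Deg), ∀ i < ell' ℓ, ∀ j < ell' ℓ, ∀ α : ℂ,
      (i ≠ ell' ℓ - 1 ∨ j ≠ ell' ℓ - 1 ∨ ∀ n : ℤ, α ≠ n * (ℓ / 2)) →
        μ a (E ℓ a ^ i * F ℓ a ^ j * K ℓ a α) = 0)
    (h1 : ∀ t : ℂ, μ (t : Deg) (E ℓ t ^ (ell' ℓ - 1) * F ℓ t ^ (ell' ℓ - 1)) = η) :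
    IsPBWForm ℓ η μ where
  eq_zero a i j α h := by
    by_cases hi : i < ell' ℓ
    · by_cases hj : j < ell' ℓ
      · exact h0 a i hi j hj α h
      · rw [F_pow_eq_zero (not_lt.1 hj)]; simp
    · rw [E_pow_eq_zero (not_lt.1 hi)]; simp
  eq_top t n := by
    rw [K_int_mul_half, ← Algebra.commutes, ← Algebra.smul_def, map_smul, h1, smul_eq_mul]

theorem xi_pow_sum_eq_zero {x : ℂ} (h1 : xi ℓ x ≠ 1) {n : ℕ} (hn : xi ℓ (n * x) = 1) :
    ∑ r ∈ Finset.range n, xi ℓ (r * x) = 0 := by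
  simp only [xi_nat_mul] at hn ⊢
  rw [geom_sum_eq h1, hn, sub_self, zero_div]

/-- For the exponents occurring in Ũ_a, the number ξ^{2α} is an ℓ'-th root of unity. Its powers over
one period therefore sum to 0 unless it equals 1. -/
theorem two_mul_mem_smallExponents (hℓ : 3 ≤ ℓ) {α : ℂ} (hα : α ∈ smallExponents ℓ) :
    xi ℓ (ell' ℓ * (2 * α)) = 1 := by
  obtain ⟨k, n, rfl⟩ := mem_smallExponents.1 hα
  rw [show (ell' ℓ : ℂ) * (2 * (k + n * ((ℓ : ℂ) / 2))) =
    k * (2 * ell' ℓ) + ((n * ell' ℓ : ℤ) : ℂ) * ℓ by push_cast; ring, xi_add,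
    (xi_eq_one_iff hℓ (((n * ell' ℓ : ℤ) : ℂ) * ℓ)).2 ⟨_, rfl⟩, mul_one]
  obtain ⟨q, hq⟩ := (xi_eq_one_iff hℓ _).1 (xi_two_mul_ell' hℓ)
  rw [hq, xi_eq_one_iff hℓ]
  exact ⟨k * q, by push_cast; ring⟩

/-- The form `μ_a`, where `a` is the class of `t`. -/
noncomputable def pbwForm (hℓ : 3 ≤ ℓ) (η t : ℂ) (h : (t : Deg) = a) : U ℓ a →ₗ[ℂ] ℂ :=
  (η / ell' ℓ) • ∑ r ∈ Finset.range (ell' ℓ),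
    topForm hℓ (t + r * 2) (a := a) (by
      rw [← h, QuotientAddGroup.eq]
      exact AddSubgroup.mem_zmultiples_iff.2 ⟨-r, by push_cast [zsmul_eq_mul]; ring⟩) ∘ₗ
        smallProj ℓ a

/-- The averaging over the lifts t + 2r turns ξ^{αt} into ξ^{αt} times a geometric sum in ξ^{2α}. -/
theorem pbwForm_monomial (hℓ : 3 ≤ ℓ) (η t : ℂ) (h : (t : Deg) = a) {i j : ℕ} (hi : i < ell' ℓ)
    (hj : j < ell' ℓ) {α : ℂ} (hα : α ∈ smallExponents ℓ) :
    pbwForm hℓ η t h (E ℓ a ^ i * F ℓ a ^ j * K ℓ a α) =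
      if i = ell' ℓ - 1 ∧ j = ell' ℓ - 1 then
        η / ell' ℓ * (xi ℓ (α * t) * ∑ r ∈ Finset.range (ell' ℓ), xi ℓ (r * (2 * α))) else 0 := by
  simp only [pbwForm, LinearMap.smul_apply, LinearMap.sum_apply, LinearMap.comp_apply,
    smallProj_of_mem (monomial_mem_smallU hℓ i j hα), topForm_monomial hℓ _ _ hi hj, smul_eq_mul]
  split_ifs with hij
  · congr 1
    rw [Finset.mul_sum]
    refine Finset.sum_congr rfl fun r _ => ?_
    rw [← xi_add]; congr 1; ring
  · simp

theorem exists_isPBWForm (hℓ : 3 ≤ ℓ) (η : ℂ) : ∃ μ, IsPBWForm ℓ η μ := by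
  have h0 : (ell' ℓ : ℂ) ≠ 0 := by exact_mod_cast ell'_ne_zero hℓ
  choose t ht using QuotientAddGroup.mk_surjective (s := AddSubgroup.zmultiples (2 : ℂ))
  refine ⟨fun a => pbwForm hℓ η (t a) (ht a), isPBWForm_of_monomial ?_ ?_⟩
  · intro a i hi j hj α h
    by_cases hα : α ∈ smallExponents ℓ
    · rw [pbwForm_monomial hℓ η _ _ hi hj hα]
      split_ifs with hij
      -- The geometric sum vanishes unless ξ^{2α} = 1, which means α ∈ (ℓ/2)ℤ.
      · rw [xi_pow_sum_eq_zero _ (two_mul_mem_smallExponents hℓ hα), mul_zero, mul_zero]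
        intro h1
        obtain ⟨n, hn⟩ := (xi_eq_one_iff hℓ _).1 h1
        rcases h with h | h | h
        · exact h hij.1
        · exact h hij.2
        · exact h n (by linear_combination hn / 2)
      · rfl
    · rw [pbwForm]
      simp only [LinearMap.smul_apply, LinearMap.sum_apply, LinearMap.comp_apply,
        smallProj_monomial_of_notMem i j hα, map_zero, Finset.sum_const_zero, smul_zero]
  · intro s
    have hlt := Nat.sub_lt (ell'_pos hℓ) one_pos
    have h := pbwForm_monomial hℓ η _ (ht s) hlt hlt (zero_mem (smallExponents ℓ))
    rw [K_zero, mul_one] at h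
    rw [h, if_pos ⟨rfl, rfl⟩]
    simp only [zero_mul, mul_zero, xi_zero, Finset.sum_const, Finset.card_range, nsmul_eq_mul,
      mul_one, one_mul]
    field_simp

theorem IsPBWForm.unique {η : ℂ} {μ ν : ∀ a : Deg, U ℓ a →ₗ[ℂ] ℂ} (hμ : IsPBWForm ℓ η μ)
    (hν : IsPBWForm ℓ η ν) : μ = ν := by
  classical
  funext a
  obtain ⟨t, rfl⟩ := QuotientAddGroup.mk_surjective a
  refine linearMap_ext_monomial fun i _ j _ α => ?_
  exact (hμ.apply_monomial t i j α).trans (hν.apply_monomial t i j α).symm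

/-! ### The symmetrized integral -/

section integral

variable {η : ℂ} {μ : ∀ a : Deg, U ℓ a →ₗ[ℂ] ℂ}

theorem IsPBWForm.map_smallProj (hμ : IsPBWForm ℓ η μ) (hℓ : 3 ≤ ℓ) (x : U ℓ a) :
    μ a (smallProj ℓ a x) = μ a x := by
  suffices key : μ a ∘ₗ smallProj ℓ a = μ a from
    LinearMap.congr_fun key x
  refine linearMap_ext_monomial fun i _ j _ α => ?_
  rw [LinearMap.comp_apply]
  by_cases hα : α ∈ smallExponents ℓ
  · rw [smallProj_of_mem (monomial_mem_smallU hℓ i j hα)]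
  · rw [smallProj_monomial_of_notMem i j hα, map_zero, hμ.eq_zero]
    refine Or.inr (Or.inr fun n hn => hα (mem_smallExponents.2 ⟨0, n, ?_⟩))
    rw [hn]; simp

/-- Moving K^β across a monomial costs the factor ξ^{2β(i-j)}, which is 1 when i = j, and μ vanishes
when i ≠ j. -/
theorem IsPBWForm.mul_K_comm (hμ : IsPBWForm ℓ η μ) (β : ℂ) (x : U ℓ a) :
    μ a (x * K ℓ a β) = μ a (K ℓ a β * x) := by
  induction x using monomial_induction with
  | hmon i hi j hj α =>
    rw [K_mul_monomial, mul_assoc, K_mul_K, map_smul]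
    by_cases h : i = j
    · subst h; simp [xi_zero]
    · rw [hμ.eq_zero a i j (α + β) (by omega), smul_zero]
  | hadd x y hx hy => rw [add_mul, mul_add, map_add, map_add, hx, hy]
  | hsmul r x hx => rw [smul_mul_assoc, mul_smul_comm, map_smul, map_smul, hx]
  | h0 => simp

/-- Modulo terms with an E-exponent below ℓ'-1, on which μ vanishes, F commutes with powers of E.
Moving it past K^α costs ξ^{-2α}, which is 1 for the exponents in (ℓ/2)ℤ seen by μ. -/
theorem IsPBWForm.mul_F_comm (hμ : IsPBWForm ℓ η μ) (hℓ : 3 ≤ ℓ) (x : U ℓ a) :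
    μ a (x * F ℓ a) = μ a (F ℓ a * x) := by
  induction x using monomial_induction with
  | hmon i hi j hj α =>
    have h1 : μ a (E ℓ a ^ i * F ℓ a ^ j * K ℓ a α * F ℓ a) =
        μ a (E ℓ a ^ i * F ℓ a ^ (j + 1) * K ℓ a α) := by
      rw [mul_assoc, K_mul_F, mul_smul_comm, map_smul, ← mul_assoc, mul_assoc (E ℓ a ^ i),
        ← pow_succ]
      by_cases hα : ∃ n : ℤ, α = n * (ℓ / 2)
      · obtain ⟨n, rfl⟩ := hα
        rw [(xi_eq_one_iff hℓ _).2 ⟨-n, by push_cast; ring⟩, one_smul]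
      · push Not at hα
        rw [hμ.eq_zero a _ _ α (Or.inr (Or.inr hα)), smul_zero]
    rw [h1]
    cases i with
    | zero => rw [pow_zero, one_mul, one_mul, ← mul_assoc, ← pow_succ']
    | succ i =>
      obtain ⟨u, v, h⟩ := exists_F_mul_E_pow (ℓ := ℓ) (a := a) i
      rw [← mul_assoc, ← mul_assoc, h, add_mul, add_mul, map_add,
        mul_assoc (E ℓ a ^ (i + 1)) (F ℓ a), ← pow_succ', mul_assoc (E ℓ a ^ i), add_mul, smul_mul_assoc, smul_mul_assoc, K_mul_F_pow,
        K_mul_F_pow]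
      simp only [mul_add, add_mul, mul_smul_comm, smul_mul_assoc, ← mul_assoc (E ℓ a ^ i), map_add,
        map_smul]
      rw [mul_assoc _ (K ℓ a _) (K ℓ a _), K_mul_K, mul_assoc _ (K ℓ a _) (K ℓ a _), K_mul_K,
        hμ.eq_zero a i j _ (by omega), hμ.eq_zero a i j _ (by omega)]
      simp
  | hadd x y hx hy => rw [add_mul, mul_add, map_add, map_add, hx, hy]
  | hsmul r x hx => rw [smul_mul_assoc, mul_smul_comm, map_smul, map_smul, hx]
  | h0 => simp

theorem IsPBWForm.mul_E_comm (hμ : IsPBWForm ℓ η μ) (hℓ : 3 ≤ ℓ) (x : U ℓ a) :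
    μ a (x * E ℓ a) = μ a (E ℓ a * x) := by
  induction x using monomial_induction with
  | hmon i hi j hj α =>
    have h1 : μ a (E ℓ a ^ i * F ℓ a ^ j * K ℓ a α * E ℓ a) =
        xi ℓ (2 * α) • μ a (E ℓ a ^ (i + 1) * F ℓ a ^ j * K ℓ a α) := by
      rw [mul_assoc, K_mul_E, mul_smul_comm, map_smul]
      congr 1
      cases j with
      | zero =>
        rw [pow_zero, mul_one, mul_one, ← mul_assoc, pow_succ]
      | succ j =>
        obtain ⟨u, v, h⟩ := exists_F_pow_mul_E (ℓ := ℓ) (a := a) j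
        rw [← mul_assoc, mul_assoc (E ℓ a ^ i), h, mul_add, add_mul, map_add, ← mul_assoc,
          ← pow_succ, add_eq_left]
        simp only [mul_add, add_mul, mul_smul_comm, smul_mul_assoc, ← mul_assoc (E ℓ a ^ i),
          map_add, map_smul]
        rw [mul_assoc _ (K ℓ a _) (K ℓ a _), K_mul_K, mul_assoc _ (K ℓ a _) (K ℓ a _), K_mul_K,
          hμ.eq_zero a i j _ (by omega), hμ.eq_zero a i j _ (by omega)]
        simp
    rw [h1, ← mul_assoc, ← mul_assoc, ← pow_succ']
    by_cases hα : ∃ n : ℤ, α = n * (ℓ / 2)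
    · obtain ⟨n, rfl⟩ := hα
      rw [(xi_eq_one_iff hℓ _).2 ⟨n, by ring⟩, one_smul]
    · push Not at hα
      rw [hμ.eq_zero a _ _ α (Or.inr (Or.inr hα)), smul_zero]
  | hadd x y hx hy => rw [add_mul, mul_add, map_add, map_add, hx, hy]
  | hsmul r x hx => rw [smul_mul_assoc, mul_smul_comm, map_smul, map_smul, hx]
  | h0 => simp

theorem IsPBWForm.mul_comm (hμ : IsPBWForm ℓ η μ) (hℓ : 3 ≤ ℓ) (x y : U ℓ a) :
    μ a (x * y) = μ a (y * x) := by
  induction y using U.induction generalizing x with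
  | hc r => rw [Algebra.commutes]
  | hE => exact hμ.mul_E_comm hℓ x
  | hF => exact hμ.mul_F_comm hℓ x
  | hK α => exact hμ.mul_K_comm α x
  | hmul y z hy hz => rw [← mul_assoc, hz, ← mul_assoc, hy, mul_assoc]
  | hadd y z hy hz => rw [mul_add, add_mul, map_add, map_add, hy, hz]

open PivotalHopfGCoalgebra

theorem contractLeft_tmul {A B : Type*} [Ring A] [Algebra ℂ A] [Ring B] [Algebra ℂ B]
    (f : A →ₗ[ℂ] ℂ) (x : A) (y : B) : contractLeft f (x ⊗ₜ[ℂ] y) = f x • y := by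
  simp [PivotalHopfGCoalgebra.contractLeft]

theorem contractRight_tmul {A B : Type*} [Ring A] [Algebra ℂ A] [Ring B] [Algebra ℂ B]
    (f : B →ₗ[ℂ] ℂ) (x : A) (y : B) : contractRight f (x ⊗ₜ[ℂ] y) = f y • x := by
  simp [PivotalHopfGCoalgebra.contractRight]

/-- `(μ_a ⊗ Id) Δ_{a,b} = μ_{a+b} g_b⁻¹`. -/
theorem IsPBWForm.contractLeft_comul (hμ : IsPBWForm ℓ η μ) (hℓ : 3 ≤ ℓ) (h : a + b = c)
    (x : U ℓ c) :
    contractLeft (μ a) (comul hℓ h x) = μ c x • K ℓ b (-(1 - ell' ℓ)) := by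
  classical
  suffices key : contractLeft (μ a) ∘ₗ (comul hℓ h).toLinearMap =
      (μ c).smulRight (K ℓ b (-(1 - ell' ℓ))) from LinearMap.congr_fun key x
  refine linearMap_ext_monomial fun i hi j hj α => ?_
  -- The first factor keeps the full powers E^i and F^j only in the term k = 0, k' = j. Every other
  -- term has an exponent below ℓ'-1 there.
  rw [LinearMap.comp_apply, AlgHom.toLinearMap_apply, LinearMap.smulRight_apply,
    map_comul_monomial hℓ h i j α _ (Nat.zero_le i) le_rfl]
  · obtain ⟨s, rfl⟩ := QuotientAddGroup.mk_surjective a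
    obtain ⟨t, rfl⟩ := QuotientAddGroup.mk_surjective b
    subst h
    have e1 := hμ.apply_monomial s i j α
    have e2 := hμ.apply_monomial (s + t) i j α
    rw [contractLeft_tmul, gauss_zero_right, gauss_self, Nat.sub_self, Nat.sub_zero, one_mul,
      one_smul, pow_zero, pow_zero, Nat.cast_zero, zero_mul, zero_add, one_mul, mul_one]
    refine (congrArg (· • _) e1).trans (Eq.trans ?_ (congrArg (· • _) e2.symm))
    split_ifs with hc
    · obtain ⟨rfl, rfl, n, rfl⟩ := hc
      -- The second factor is K^{ℓ'-1} = g_b⁻¹ times K^{nℓ/2}. The latter is the scalar that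
      -- completes the value in degree s to the value in degree s + t.
      rw [K_int_mul_half, ← Algebra.commutes, ← Algebra.smul_def, smul_smul, mul_add, xi_add,
        Nat.cast_sub (ell'_pos hℓ)]
      congr 1
      · ring
      · congr 1; push_cast; ring
    · simp
  · intro k hk k' hk' hne
    rw [contractLeft_tmul, hμ.eq_zero _ _ _ _ (by omega), zero_smul]

/-- `(Id ⊗ μ_b) Δ_{a,b} = μ_{a+b} g_a`. -/
theorem IsPBWForm.contractRight_comul (hμ : IsPBWForm ℓ η μ) (hℓ : 3 ≤ ℓ) (h : a + b = c)
    (x : U ℓ c) :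
    contractRight (μ b) (comul hℓ h x) = μ c x • K ℓ a (1 - ell' ℓ) := by
  classical
  suffices key : contractRight (μ b) ∘ₗ (comul hℓ h).toLinearMap =
      (μ c).smulRight (K ℓ a (1 - ell' ℓ)) from LinearMap.congr_fun key x
  have hcomm : ∀ (k n : ℕ) (β α : ℂ), E ℓ b ^ k * K ℓ b β * F ℓ b ^ n * K ℓ b α =
      xi ℓ (-2 * β * n) • (E ℓ b ^ k * F ℓ b ^ n * K ℓ b (β + α)) := by
    intro k n β α
    rw [mul_assoc (E ℓ b ^ k), K_mul_F_pow, mul_smul_comm, smul_mul_assoc, ← mul_assoc,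
      mul_assoc _ (K ℓ b β), K_mul_K]
  refine linearMap_ext_monomial fun i hi j hj α => ?_
  -- Here the surviving term is k = i, k' = 0. It leaves K^{-(ℓ'-1)} = g_a in the first factor.
  rw [LinearMap.comp_apply, AlgHom.toLinearMap_apply, LinearMap.smulRight_apply,
    map_comul_monomial hℓ h i j α _ le_rfl (Nat.zero_le j)]
  · obtain ⟨s, rfl⟩ := QuotientAddGroup.mk_surjective a
    obtain ⟨t, rfl⟩ := QuotientAddGroup.mk_surjective b
    subst h
    have e1 := hμ.apply_monomial t i j α
    have e2 := hμ.apply_monomial (s + t) i j α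
    rw [contractRight_tmul, gauss_zero_right, gauss_self, Nat.sub_self, Nat.sub_zero, one_mul,
      one_smul, pow_zero, pow_zero, Nat.cast_zero, zero_mul, K_zero, one_mul, mul_one, one_mul]
    refine (congrArg (· • _) e1).trans (Eq.trans ?_ (congrArg (· • _) e2.symm))
    split_ifs with hc
    · obtain ⟨rfl, rfl, n, rfl⟩ := hc
      rw [← K_mul_K, K_int_mul_half, ← Algebra.commutes, ← Algebra.smul_def, smul_smul, mul_add,
        xi_add, Nat.cast_sub (ell'_pos hℓ)]
      congr 1
      · ring
      · congr 1; push_cast; ring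
    · simp
  · intro k hk k' hk' hne
    rw [contractRight_tmul, hcomm, map_smul, hμ.eq_zero _ _ _ _ (by omega), smul_zero, zero_smul]

theorem KF_pow (n : ℕ) : (K ℓ a 1 * F ℓ a) ^ n =
    xi ℓ (-(n * (n + 1))) • (F ℓ a ^ n * K ℓ a n) := by
  induction n with
  | zero => simp [xi_zero, K_zero]
  | succ n ih =>
    rw [pow_succ, ih, smul_mul_assoc, K_mul_F, mul_smul_comm, mul_assoc, ← mul_assoc (K ℓ a n),
      K_mul_F, smul_mul_assoc, mul_smul_comm, mul_assoc (F ℓ a), K_mul_K, ← mul_assoc, ← pow_succ,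
      smul_smul, smul_smul, ← xi_add, ← xi_add]
    push_cast
    congr 2; ring

theorem EK_pow (n : ℕ) : (E ℓ a * K ℓ a (-1)) ^ n =
    xi ℓ (-(n * (n - 1))) • (E ℓ a ^ n * K ℓ a (-n)) := by
  induction n with
  | zero => simp [xi_zero, K_zero]
  | succ n ih =>
    rw [pow_succ, ih, smul_mul_assoc, mul_assoc, ← mul_assoc (K ℓ a (-n)),
      K_mul_E, smul_mul_assoc, mul_smul_comm, mul_assoc (E ℓ a), K_mul_K, ← mul_assoc, ← pow_succ,
      smul_smul, ← xi_add]
    push_cast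
    congr 2
    · ring
    · congr 1; ring

/-- The antipode reverses the monomial to K^{-α} (-KF)^j (-EK⁻¹)^i. Cyclicity of μ brings E^i back
to the front. At i = j = ℓ'-1 the signs cancel in pairs and the remaining power of ξ has exponent in
ℓℤ. -/
theorem IsPBWForm.map_antipode (hμ : IsPBWForm ℓ η μ) (hℓ : 3 ≤ ℓ) (h : a + b = 0)
    (x : U ℓ a) : μ b (antipode h x) = μ a x := by
  classical
  suffices key : μ b ∘ₗ antipode h = μ a from LinearMap.congr_fun key x
  have hpow : ∀ (x : U ℓ a) (n : ℕ), antipode h (x ^ n) = antipode h x ^ n := by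
    intro x n
    induction n with
    | zero => simpa using antipode_algebraMap h (1 : ℂ)
    | succ n ih => rw [pow_succ, antipode_mul, ih, ← pow_succ']
  refine linearMap_ext_monomial fun i hi j hj α => ?_
  rw [LinearMap.comp_apply, antipode_mul, antipode_mul, hpow, hpow, antipode_E, antipode_F,
    antipode_K, ← neg_one_smul ℂ (K ℓ b 1 * _), ← neg_one_smul ℂ (E ℓ b * _), smul_pow, smul_pow,
    KF_pow, EK_pow]
  simp only [smul_smul, smul_mul_assoc, mul_smul_comm, map_smul]
  rw [← mul_assoc (K ℓ b (-α)), hμ.mul_comm hℓ, mul_assoc (E ℓ b ^ i), ← mul_assoc (K ℓ b (-i)), K_mul_K,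
    ← mul_assoc (K ℓ b _), K_mul_F_pow, smul_mul_assoc, mul_smul_comm, map_smul,
    mul_assoc (F ℓ b ^ j) (K ℓ b _), K_mul_K, ← mul_assoc (E ℓ b ^ i)]
  obtain ⟨t, rfl⟩ := QuotientAddGroup.mk_surjective a
  obtain rfl : b = ((-t : ℂ) : Deg) := by
    rw [QuotientAddGroup.mk_neg]; exact (neg_eq_of_add_eq_zero_right h).symm
  refine Eq.trans ?_ (hμ.apply_monomial t i j α).symm
  split_ifs with hc
  · obtain ⟨rfl, rfl, n, rfl⟩ := hc
    set m := ell' ℓ - 1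
    have e : (-(m : ℂ) + -(n * (ℓ / 2)) + m) = ((-n : ℤ) : ℂ) * (ℓ / 2) := by push_cast; ring
    rw [e, hμ.eq_top]
    simp only [smul_eq_mul]
    have h1 : ((-1 : ℂ) ^ m) * (-1) ^ m = 1 := by rw [← mul_pow]; simp
    have h2 : xi ℓ (-(m * (m + 1))) * xi ℓ (-(m * (m - 1))) *
        xi ℓ (-2 * (-m + -(n * (ℓ / 2))) * m) = 1 := by
      rw [← xi_add, ← xi_add, xi_eq_one_iff hℓ]
      exact ⟨n * m, by push_cast; ring⟩
    -- The identity for the signs, multiplied by the product of powers of ξ, so that both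
    -- cancellations enter the final linear combination.
    have h3 := congrArg (fun x => (x - 1) * (xi ℓ (-(m * (m + 1))) * xi ℓ (-(m * (m - 1))) *
        xi ℓ (-2 * (-m + -(n * (ℓ / 2))) * m))) h1
    simp only [sub_self, zero_mul] at h3
    rw [show ((-n : ℤ) : ℂ) * (ℓ / 2) * -t = n * (ℓ / 2) * t by push_cast; ring]
    linear_combination (xi ℓ (n * (ℓ / 2) * t) * η) * (h2 + h3)
  · rw [hμ.eq_zero, smul_zero, smul_zero]
    by_cases hij : i = j
    · subst hij
      rw [show -(i : ℂ) + -α + i = -α by ring]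
      by_cases hi' : i = ell' ℓ - 1
      · refine Or.inr (Or.inr fun n hn => hc ⟨hi', hi', -n, ?_⟩)
        push_cast; linear_combination -hn
      · exact Or.inl hi'
    · omega

theorem IsPBWForm.isSymmetrizedIntegral (hμ : IsPBWForm ℓ η μ) (hℓ : 3 ≤ ℓ) :
    (pivotalU ℓ hℓ).IsSymmetrizedIntegral μ where
  integral {a b c} h x := by
    change K ℓ b (1 - ell' ℓ) * contractLeft (μ a) (comul hℓ h x) = _
    rw [hμ.contractLeft_comul hℓ h, mul_smul_comm, K_mul_K_neg]
  cyclic a x y := hμ.mul_comm hℓ x y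
  antipode h x := hμ.map_antipode hℓ h x

end integral

end QuantumSL2

/-! ### The trace form of an algebra spanned by matrix units -/

section matrixUnits

variable {k A R n : Type*} [Field k] [Ring A] [Algebra k A] [Fintype R] [DecidableEq R]
  [Fintype n] [DecidableEq n]

/-- Sandwiching a relation between u_{oi} and u_{jo} of block r leaves only the coefficient at
(r,i,j), times the nonzero diagonal unit u_{oo}. -/
theorem linearIndependent_of_matrixUnits {u : R → n → n → A}
    (hmul : ∀ r s i j p q, u r i j * u s p q = if r = s ∧ j = p then u r i q else 0)
    (hne : ∀ r, ∃ i, u r i i ≠ 0) :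
    LinearIndependent k fun p : R × n × n => u p.1 p.2.1 p.2.2 := by
  rw [Fintype.linearIndependent_iff]
  rintro g hg ⟨r, i, j⟩
  obtain ⟨o, ho⟩ := hne r
  have h : u r o i * (∑ p : R × n × n, g p • u p.1 p.2.1 p.2.2) * u r j o = g (r, i, j) • u r o o := by
    rw [Finset.mul_sum, Finset.sum_mul, Finset.sum_eq_single (r, i, j)]
    · simp [hmul]
    · rintro ⟨s, p, q⟩ - hp
      simp only [mul_smul_comm, smul_mul_assoc, hmul]
      by_cases h1 : r = s ∧ i = p
      · rw [if_pos h1, hmul, if_neg, smul_zero]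
        rintro ⟨-, rfl⟩
        exact hp (by rw [h1.1, h1.2])
      · rw [if_neg h1]; simp
    · simp
  rw [hg, mul_zero, zero_mul] at h
  exact (smul_eq_zero.1 h.symm).resolve_right ho

/-- The dimension bound makes the matrix units a basis, so A is a product of matrix algebras. On
each block the regular trace is the matrix trace times the block size, which is nonzero in
characteristic 0. -/
theorem eq_zero_of_trace_mulLeft_eq_zero [CharZero k] [FiniteDimensional k A] [Nonempty n]
    {u : R → n → n → A}
    (hmul : ∀ r s i j p q, u r i j * u s p q = if r = s ∧ j = p then u r i q else 0)
    (hne : ∀ r, ∃ i, u r i i ≠ 0)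
    (hrank : Module.finrank k A ≤ Fintype.card (R × n × n)) {x : A}
    (hx : ∀ y, LinearMap.trace k A (LinearMap.mulLeft k (x * y)) = 0) : x = 0 := by
  have hli := linearIndependent_of_matrixUnits (k := k) hmul hne
  have hcard : Fintype.card (R × n × n) = Module.finrank k A :=
    le_antisymm hli.fintype_card_le_finrank hrank
  rcases isEmpty_or_nonempty R with hR | hR
  · have : Module.finrank k A = 0 := by rw [← hcard]; simp
    have := Module.finrank_zero_iff.1 this
    exact Subsingleton.elim _ _
  let b := basisOfLinearIndependentOfCardEqFinrank hli hcard
  have hb : ∀ r i j, b (r, i, j) = u r i j := fun r i j => by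
    simp [b, coe_basisOfLinearIndependentOfCardEqFinrank]
  -- Left multiplication by u_{ij} sends u_{jq} to u_{iq} and kills the other basis vectors, so the
  -- diagonal contributes only for i = j, once for each q.
  have htr : ∀ r i j, LinearMap.trace k A (LinearMap.mulLeft k (u r i j)) =
      if i = j then (Fintype.card n : k) else 0 := by
    intro r i j
    rw [LinearMap.trace_eq_matrix_trace k b, Matrix.trace]
    simp only [Matrix.diag_apply, LinearMap.toMatrix_apply, LinearMap.mulLeft_apply]
    have h1 : ∀ p : R × n × n, b.repr (u r i j * b p) p =
        if r = p.1 then (if i = p.2.1 then (if i = j then 1 else 0) else 0) else 0 := by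
      rintro ⟨s, p, q⟩
      rw [hb, hmul]
      by_cases h : r = s ∧ j = p
      · obtain ⟨rfl, rfl⟩ := h
        rw [if_pos ⟨rfl, rfl⟩, ← hb, b.repr_self, Finsupp.single_apply]
        by_cases h2 : i = j <;> simp [h2]
      · rw [if_neg h, map_zero, Finsupp.zero_apply]
        split_ifs with h1 h2 h3 <;> try rfl
        exact absurd ⟨h1, h3 ▸ h2⟩ h
    simp only [h1, Fintype.sum_prod_type]
    simp only [Finset.sum_ite_irrel, Finset.sum_const_zero, Finset.sum_ite_eq, Finset.mem_univ,
      if_true]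
    rw [Finset.sum_comm]
    simp
  -- Pairing x with u_{ji} recovers its (i,j) coefficient, up to the block size.
  have h2 : ∀ r i j, b.repr x (r, i, j) = 0 := by
    intro r i j
    have h3 := hx (u r j i)
    have h4 : x * u r j i = ∑ p : n, b.repr x (r, p, j) • u r p i := by
      conv_lhs => rw [← b.sum_repr x, Finset.sum_mul]
      simp only [Fintype.sum_prod_type, hb, smul_mul_assoc, hmul]
      rw [Finset.sum_eq_single r]
      · refine Finset.sum_congr rfl fun p _ => ?_
        rw [Finset.sum_eq_single j]
        · simp
        · intro q _ hq; simp [hq]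
        · simp
      · intro s _ hs; simp [hs]
      · simp
    have h5 : LinearMap.trace k A (LinearMap.mulLeft k (x * u r j i)) =
        ∑ p : n, b.repr x (r, p, j) * LinearMap.trace k A (LinearMap.mulLeft k (u r p i)) := by
      rw [h4]
      change LinearMap.trace k A (LinearMap.mul k A _) = _
      rw [map_sum, map_sum]
      simp only [map_smul, smul_eq_mul]
      rfl
    rw [h5] at h3
    simp only [htr, mul_ite, mul_zero, Finset.sum_ite_eq', Finset.mem_univ, if_true] at h3
    refine (mul_eq_zero.1 h3).resolve_right ?_
    exact_mod_cast Fintype.card_ne_zero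
  rw [← b.repr.map_eq_zero_iff]
  ext ⟨r, i, j⟩
  exact h2 r i j

/-- If the trace form is nondegenerate, every trace-like form is represented by a unique central
element. -/
theorem existsUnique_center_trace_mulLeft [FiniteDimensional k A]
    (hnd : ∀ x : A, (∀ y, LinearMap.trace k A (LinearMap.mulLeft k (x * y)) = 0) → x = 0)
    (ν : A →ₗ[k] k) (hν : ∀ x y, ν (x * y) = ν (y * x)) :
    ∃! z : Subalgebra.center k A,
      ∀ x, ν x = LinearMap.trace k A (LinearMap.mulLeft k ((z : A) * x)) := by
  set T : A →ₗ[k] A →ₗ[k] k :=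
    (LinearMap.mul k A).compr₂ (LinearMap.trace k A ∘ₗ LinearMap.mul k A) with hT
  have hT' : ∀ x y, T x y = LinearMap.trace k A (LinearMap.mulLeft k (x * y)) := fun _ _ => rfl
  have hcyc : ∀ x y, LinearMap.trace k A (LinearMap.mulLeft k (x * y)) =
      LinearMap.trace k A (LinearMap.mulLeft k (y * x)) := by
    intro x y
    rw [LinearMap.mulLeft_mul, LinearMap.mulLeft_mul]
    exact LinearMap.trace_mul_comm k _ _
  have hinj : Function.Injective T := by
    rw [injective_iff_map_eq_zero]
    intro x hx
    exact hnd x fun y => by rw [← hT', hx]; rfl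
  have hsurj : Function.Surjective T := by
    -- A and its dual have the same dimension, so nondegeneracy makes every form a trace against
    -- some z.
    refine (LinearMap.injective_iff_surjective_of_finrank_eq_finrank ?_).1 hinj
    exact (Subspace.dual_finrank_eq (K := k) (V := A)).symm
  obtain ⟨z, hz⟩ := hsurj ν
  have hz' : ∀ x, ν x = LinearMap.trace k A (LinearMap.mulLeft k (z * x)) := fun x => by
    rw [← hz, hT']
  refine ⟨⟨z, ?_⟩, hz', ?_⟩
  · rw [Subalgebra.mem_center_iff]
    intro y
    -- Centrality of z: since ν and the trace are both cyclic, yz and zy define the same form.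
    refine hinj (LinearMap.ext fun x => ?_)
    rw [hT', hT', mul_assoc y, hcyc y, mul_assoc, ← hz', mul_assoc, ← hz', hν]
  · rintro ⟨z', h⟩ hz''
    refine Subtype.ext (hinj (LinearMap.ext fun x => ?_))
    rw [hT', hT', ← hz', ← hz'']

end matrixUnits

namespace QuantumSL2

variable {ℓ : ℕ}

/-! ### Matrix units in `Ũ_a` for generic `a` -/

theorem eq_of_two_mul_eq_int {t : ℂ} {k : ℤ} (h : 2 * t = k) :
    (t : Deg) = 0 ∨ (t : Deg) = ((1 : ℂ) : Deg) ∨ (t : Deg) = ((1 / 2 : ℂ) : Deg) ∨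
      (t : Deg) = ((3 / 2 : ℂ) : Deg) := by
  have key : ∀ s : ℤ, k % 4 = s → (t : Deg) = ((s / 2 : ℂ) : Deg) := by
    intro s hs
    rw [QuotientAddGroup.eq]
    refine AddSubgroup.mem_zmultiples_iff.2 ⟨-(k / 4), ?_⟩
    have h1 := Int.mul_ediv_add_emod k 4
    rw [hs] at h1
    have h2 : (4 : ℂ) * (k / 4 : ℤ) + s = k := by exact_mod_cast h1
    rw [zsmul_eq_mul]
    push_cast
    linear_combination (-1 / 2 : ℂ) * h2 + (1 / 2 : ℂ) * h
  have h4 : k % 4 = 0 ∨ k % 4 = 1 ∨ k % 4 = 2 ∨ k % 4 = 3 := by omega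
  rcases h4 with h4 | h4 | h4 | h4
  · left; simpa using key 0 h4
  · right; right; left; simpa using key 1 h4
  · right; left; simpa using key 2 h4
  · right; right; right; simpa using key 3 h4

theorem eq_of_eq_int {t : ℂ} {k : ℤ} (h : t = k) :
    (t : Deg) = 0 ∨ (t : Deg) = ((1 : ℂ) : Deg) := by
  have key : ∀ s : ℤ, k % 2 = s → (t : Deg) = ((s : ℂ) : Deg) := by
    intro s hs
    rw [QuotientAddGroup.eq]
    refine AddSubgroup.mem_zmultiples_iff.2 ⟨-(k / 2), ?_⟩
    have h1 := Int.mul_ediv_add_emod k 2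
    rw [hs] at h1
    have h2 : (2 : ℂ) * (k / 2 : ℤ) + s = k := by exact_mod_cast h1
    rw [zsmul_eq_mul]
    push_cast
    linear_combination -h2 + h
  rcases (by omega : k % 2 = 0 ∨ k % 2 = 1) with h4 | h4
  · left; simpa using key 0 h4
  · right; simpa using key 1 h4

/-- The factor [l] is nonzero because ξ² has order ℓ'. If the other factor vanished, 2(t + 2r + 1 -
l) would lie in ℓℤ. Then t would be an integer for even ℓ, or 2t an integer for odd ℓ, and these are
the classes removed in `genericDeg`. -/
theorem hwCoeff_ne_zero (hℓ : 3 ≤ ℓ) {t : ℂ} (ht : (t : Deg) ∈ genericDeg ℓ) (r : ℤ) {l : ℕ}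
    (h0 : 0 < l) (hl : l < ell' ℓ) : hwCoeff ℓ (t + r * 2) l ≠ 0 := by
  have hxi : ∀ x : ℂ, xi ℓ x - xi ℓ (-x) = 0 → xi ℓ (2 * x) = 1 := by
    intro x hx
    rw [two_mul, xi_add]
    nth_rw 1 [sub_eq_zero.1 hx]
    exact xi_neg_mul ℓ x
  rw [hwCoeff]
  refine div_ne_zero (mul_ne_zero (fun h => ?_) (fun h => ?_)) (pow_ne_zero 2 (xi_sub_ne_zero hℓ))
  · refine (xi_two_primitive (by omega : ℓ ≠ 0)).pow_ne_one_of_pos_of_lt h0.ne' hl ?_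
    rw [← xi_nat_mul, ← hxi _ h, mul_comm]
  · obtain ⟨n, hn⟩ := (xi_eq_one_iff hℓ _).1 (hxi _ h)
    obtain ⟨h1, h2, h3⟩ := ht
    rcases ell'_cases ℓ with ⟨-, he⟩ | ⟨ho, -⟩
    · have he' : (ℓ : ℂ) = 2 * ell' ℓ := by exact_mod_cast he
      have : t = (n * ell' ℓ - 1 + l - r * 2 : ℤ) := by
        push_cast
        rw [he'] at hn
        linear_combination hn / 2
      rcases eq_of_eq_int this with h | h
      · exact h1 h
      · exact h2 h
    · have : 2 * t = (n * ℓ - 2 + 2 * l - 4 * r : ℤ) := by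
        push_cast
        linear_combination hn
      rcases eq_of_two_mul_eq_int this with h | h | h | h
      · exact h1 h
      · exact h2 h
      · exact (h3 ho).1 h
      · exact (h3 ho).2 h

section hwVector

variable {a : Deg} {w : ℂ} {y : U ℓ a}

/-- `y` is a highest weight vector of weight `w` for the left multiplication. -/
structure IsHW (w : ℂ) (y : U ℓ a) : Prop where
  E_mul : E ℓ a * y = 0
  K_one_mul : K ℓ a 1 * y = xi ℓ w • y

theorem IsHW.K_mul (hy : IsHW w y) (k : ℤ) : K ℓ a k * y = xi ℓ (k * w) • y := by
  have hneg : K ℓ a (-1) * y = xi ℓ (-w) • y := by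
    have h := congrArg (fun v => xi ℓ (-w) • (K ℓ a (-1) * v)) hy.K_one_mul
    rw [← mul_assoc, K_neg_mul_K, one_mul, mul_smul_comm, smul_smul, xi_neg_mul, one_smul] at h
    exact h.symm
  induction k using Int.induction_on with
  | zero => simp [K_zero, xi_zero]
  | succ k ih =>
    push_cast at ih ⊢
    rw [← K_mul_K, mul_assoc, hy.K_one_mul, mul_smul_comm, ih, smul_smul, ← xi_add]
    congr 2; ring
  | pred k ih =>
    push_cast at ih ⊢
    rw [sub_eq_add_neg, ← K_mul_K, mul_assoc, hneg, mul_smul_comm, ih, smul_smul, ← xi_add]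
    congr 2; ring

theorem IsHW.E_mul_F_pow (hy : IsHW w y) (hℓ : 3 ≤ ℓ) (i : ℕ) :
    E ℓ a * (F ℓ a ^ (i + 1) * y) = hwCoeff ℓ w (i + 1 : ℕ) • (F ℓ a ^ i * y) := by
  have hK : ∀ (k : ℤ) (i : ℕ), K ℓ a k * (F ℓ a ^ i * y) =
      xi ℓ (k * (w - 2 * i)) • (F ℓ a ^ i * y) := by
    intro k i
    rw [← mul_assoc, K_mul_F_pow, smul_mul_assoc, mul_assoc (F ℓ a ^ i), hy.K_mul, mul_smul_comm, smul_smul,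
      ← xi_add]
    congr 2; ring
  -- One step of the recursion from EF = FE + [E,F]. The eigenvalue v of FE is kept free so that the
  -- start i = 0, where EF^0 y = 0, and the inductive case are treated together.
  have key : ∀ (i : ℕ) (v : ℂ), F ℓ a * (E ℓ a * (F ℓ a ^ i * y)) = v • (F ℓ a ^ i * y) →
      v = hwCoeff ℓ w i →
      E ℓ a * (F ℓ a ^ (i + 1) * y) = hwCoeff ℓ w (i + 1 : ℕ) • (F ℓ a ^ i * y) := by
    rintro i v h rfl
    have h1 := hK 1 i
    have h2 := hK (-1) i
    push_cast at h1 h2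
    rw [pow_succ', mul_assoc, ← mul_assoc, E_mul_F, add_mul, mul_assoc, h, smul_mul_assoc, sub_mul,
      h1, h2, Nat.cast_succ, hwCoeff_succ hℓ, add_smul, mul_smul, sub_smul, one_mul, neg_one_mul]
  induction i with
  | zero =>
    refine key 0 0 ?_ ?_
    · rw [pow_zero, one_mul, hy.E_mul, mul_zero, zero_smul]
    · rw [Nat.cast_zero, hwCoeff_zero]
  | succ i ih =>
    refine key (i + 1) _ ?_ rfl
    rw [ih, mul_smul_comm, ← mul_assoc, ← pow_succ']

theorem IsHW.E_pow_mul_F_pow (hy : IsHW w y) (hℓ : 3 ≤ ℓ) (i j : ℕ) :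
    E ℓ a ^ j * (F ℓ a ^ (i + j) * y) =
      (∏ l ∈ Finset.range j, hwCoeff ℓ w (i + l + 1 : ℕ)) • (F ℓ a ^ i * y) := by
  induction j with
  | zero => simp
  | succ j ih =>
    rw [pow_succ, mul_assoc, ← add_assoc, hy.E_mul_F_pow hℓ, mul_smul_comm, ih, smul_smul,
      Finset.prod_range_succ, mul_comm]

theorem IsHW.E_pow_mul_F_pow_of_lt (hy : IsHW w y) (hℓ : 3 ≤ ℓ) {i j : ℕ} (h : i < j) :
    E ℓ a ^ j * (F ℓ a ^ i * y) = 0 := by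
  obtain ⟨d, rfl⟩ : ∃ d, j = d + 1 + i := ⟨j - i - 1, by omega⟩
  have := hy.E_pow_mul_F_pow hℓ 0 i
  rw [zero_add, pow_zero, one_mul] at this
  rw [pow_add, mul_assoc, this, mul_smul_comm, pow_succ, mul_assoc, hy.E_mul, mul_zero, smul_zero]

end hwVector

/-- The projector onto the eigenspace of `K` of eigenvalue `ξ^w`. -/
noncomputable def weightProj (ℓ : ℕ) (a : Deg) (w : ℂ) : U ℓ a :=
  (ell' ℓ : ℂ)⁻¹ • ∑ k ∈ Finset.range (ell' ℓ), xi ℓ (-(k * w)) • K ℓ a k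

theorem weightProj_mem (hℓ : 3 ≤ ℓ) (a : Deg) (w : ℂ) : weightProj ℓ a w ∈ smallU ℓ a := by
  refine Subalgebra.smul_mem _ (sum_mem fun k _ => Subalgebra.smul_mem _ (K_mem_smallU hℓ ?_) _) _
  exact mem_smallExponents.2 ⟨k, 0, by simp⟩

theorem xi_int_mul_two_ell' (hℓ : 3 ≤ ℓ) (r : ℤ) : xi ℓ (r * (2 * ell' ℓ)) = 1 := by
  obtain ⟨q, hq⟩ := (xi_eq_one_iff hℓ _).1 (xi_two_mul_ell' hℓ)
  rw [hq, xi_eq_one_iff hℓ]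
  exact ⟨r * q, by push_cast; ring⟩

theorem ell'_dvd_of_two_mul_eq {k n : ℤ} (h : 2 * k = n * ℓ) : (ell' ℓ : ℤ) ∣ k := by
  rcases ell'_cases ℓ with ⟨-, he⟩ | ⟨ho, he⟩
  · refine ⟨n, ?_⟩
    have : (ℓ : ℤ) = 2 * ell' ℓ := by exact_mod_cast he
    rw [this] at h; linarith
  · have h4 : (ell' ℓ : ℤ) ∣ 2 * k := ⟨n, by rw [h, ← he, mul_comm]⟩
    refine IsCoprime.dvd_of_dvd_mul_left ?_ h4
    rw [← he]
    exact Nat.isCoprime_iff_coprime.2 (Nat.coprime_two_right.2 ho)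

/-- Multiplication by K shifts the summands cyclically. The sum closes up because K^{ℓ'} = ξ^{ℓ't}
and ξ^{2ℓ'} = 1. -/
theorem K_one_mul_weightProj (hℓ : 3 ≤ ℓ) (t : ℂ) (r : ℤ) :
    K ℓ t 1 * weightProj ℓ t (t + r * 2) = xi ℓ (t + r * 2) • weightProj ℓ t (t + r * 2) := by
  set g : ℕ → U ℓ (t : Deg) := fun k => xi ℓ (-(k * (t + r * 2))) • K ℓ t k with hg
  have h1 : ∀ k, K ℓ t 1 * g k = xi ℓ (t + r * 2) • g (k + 1) := by
    intro k
    simp only [hg]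
    rw [mul_smul_comm, K_mul_K, smul_smul, ← xi_add]
    congr 1
    · congr 1; push_cast; ring
    · congr 1; push_cast; ring
  have h2 : g (ell' ℓ) = g 0 := by
    simp only [hg]
    rw [K_ell', Algebra.algebraMap_eq_smul_one, smul_smul, ← xi_add,
      show -(ell' ℓ * (t + r * 2)) + ell' ℓ * t = ((-r : ℤ) : ℂ) * (2 * ell' ℓ) by push_cast; ring,
      xi_int_mul_two_ell' hℓ]
    simp [xi_zero, K_zero]
  have h3 : ∑ k ∈ Finset.range (ell' ℓ), g (k + 1) = ∑ k ∈ Finset.range (ell' ℓ), g k := by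
    have := (Finset.sum_range_succ g (ell' ℓ)).symm.trans (Finset.sum_range_succ' g (ell' ℓ))
    rw [h2] at this
    exact (add_right_cancel this).symm
  change K ℓ t 1 * ((ell' ℓ : ℂ)⁻¹ • ∑ k ∈ Finset.range (ell' ℓ), g k) =
    xi ℓ (t + r * 2) • ((ell' ℓ : ℂ)⁻¹ • ∑ k ∈ Finset.range (ell' ℓ), g k)
  rw [mul_smul_comm, Finset.mul_sum, smul_comm (xi ℓ _), Finset.sum_congr rfl fun k _ => h1 k,
    ← Finset.smul_sum, h3]

/-- The highest weight vectors `E^(ℓ'-1) F^(ℓ'-1) e` with `e` the projector of weight `t + 2r`. -/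
noncomputable def topVector (ℓ : ℕ) (t : ℂ) (r : ℤ) : U ℓ (t : Deg) :=
  E ℓ t ^ (ell' ℓ - 1) * F ℓ t ^ (ell' ℓ - 1) * weightProj ℓ t (t + r * 2)

theorem topVector_isHW (hℓ : 3 ≤ ℓ) (t : ℂ) (r : ℤ) :
    IsHW (t + r * 2) (topVector ℓ t r) where
  E_mul := by
    rw [topVector, ← mul_assoc, ← mul_assoc, ← pow_succ', Nat.sub_add_cancel (ell'_pos hℓ), E_pow,
      zero_mul, zero_mul]
  K_one_mul := by
    have h := K_mul_monomial (ℓ := ℓ) (a := (t : Deg)) (ell' ℓ - 1) (ell' ℓ - 1) 0 1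
    rw [sub_self, mul_zero, xi_zero, one_smul, K_zero, mul_one, zero_add] at h
    rw [topVector, ← mul_assoc, h, mul_assoc, K_one_mul_weightProj hℓ, mul_smul_comm]

/-- Moving F to the left through the powers of K only costs scalars, and then F^{ℓ'} = 0 applies. -/
theorem topVector_mul_F (hℓ : 3 ≤ ℓ) (t : ℂ) (r : ℤ) : topVector ℓ t r * F ℓ t = 0 := by
  have h : ∀ k : ℂ, E ℓ t ^ (ell' ℓ - 1) * F ℓ t ^ (ell' ℓ - 1) * K ℓ t k * F ℓ t = 0 := by
    intro k
    rw [mul_assoc, K_mul_F, mul_smul_comm, ← mul_assoc, mul_assoc (E ℓ t ^ _), ← pow_succ,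
      Nat.sub_add_cancel (ell'_pos hℓ), F_pow]
    simp
  simp only [topVector, weightProj, mul_smul_comm, smul_mul_assoc, Finset.mul_sum, Finset.sum_mul,
    h, smul_zero, Finset.sum_const_zero]

/-- The projector acts by the average of the powers of ξ^{2(r-s)}, an ℓ'-th root of unity. The
hypothesis `hrs` expresses that r and s are separated modulo ℓ', as for indices between 0 and ℓ'-1.
-/
theorem weightProj_mul_of_isHW {t : ℂ} {r s : ℤ} {y : U ℓ (t : Deg)} (hy : IsHW (t + r * 2) y)
    (hℓ : 3 ≤ ℓ) (hrs : (ell' ℓ : ℤ) ∣ r - s ↔ r = s) :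
    weightProj ℓ t (t + s * 2) * y = if r = s then y else 0 := by
  have h0 : (ell' ℓ : ℂ) ≠ 0 := by exact_mod_cast ell'_ne_zero hℓ
  have h1 : ∀ k ∈ Finset.range (ell' ℓ), (xi ℓ (-(k * (t + s * 2))) • K ℓ t k) * y =
      xi ℓ (k * (2 * (r - s))) • y := by
    intro k _
    have := hy.K_mul k
    rw [Int.cast_natCast] at this
    rw [smul_mul_assoc, this, smul_smul, ← xi_add]
    congr 2; ring
  rw [weightProj, smul_mul_assoc, Finset.sum_mul, Finset.sum_congr rfl h1, ← Finset.sum_smul]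
  split_ifs with h
  · subst h
    simp [xi_zero, h0]
  · rw [xi_pow_sum_eq_zero, zero_smul, smul_zero]
    · intro h2
      obtain ⟨n, hn⟩ := (xi_eq_one_iff hℓ _).1 h2
      exact h (hrs.1 (ell'_dvd_of_two_mul_eq (n := n) (by exact_mod_cast hn)))
    · rw [← xi_int_mul_two_ell' hℓ (r - s)]
      congr 1; push_cast; ring

theorem topVector_mul_topVector (hℓ : 3 ≤ ℓ) (t : ℂ) {r s : ℤ}
    (hrs : (ell' ℓ : ℤ) ∣ r - s ↔ r = s) : topVector ℓ t s * topVector ℓ t r = if r = s then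
      (∏ l ∈ Finset.range (ell' ℓ - 1), hwCoeff ℓ (t + r * 2) (l + 1 : ℕ)) • topVector ℓ t r
        else 0 := by
  have hy := topVector_isHW hℓ t r
  nth_rw 1 [topVector]
  rw [mul_assoc, weightProj_mul_of_isHW hy hℓ hrs]
  split_ifs with h
  · have := hy.E_pow_mul_F_pow hℓ 0 (ell' ℓ - 1)
    simp only [zero_add, pow_zero, one_mul] at this
    rw [mul_assoc, this]
  · rw [mul_zero]

/-- The form μ detects it: for 0 ≤ k < ℓ' only k = 0 lies in (ℓ/2)ℤ, so just one summand of the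
projector contributes, with value 1/ℓ'. -/
theorem topVector_ne_zero (hℓ : 3 ≤ ℓ) (t : ℂ) (r : ℤ) : topVector ℓ t r ≠ 0 := by
  obtain ⟨μ, hμ⟩ := exists_isPBWForm hℓ 1
  intro h
  have h1 : μ t (topVector ℓ t r) = (ell' ℓ : ℂ)⁻¹ := by
    have h2 : ∀ k ∈ Finset.range (ell' ℓ), μ t (E ℓ t ^ (ell' ℓ - 1) * F ℓ t ^ (ell' ℓ - 1) *
        xi ℓ (-(k * (t + r * 2))) • K ℓ t k) = if k = 0 then 1 else 0 := by
      intro k hk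
      rw [mul_smul_comm, map_smul]
      split_ifs with h0
      · subst h0
        have := hμ.eq_top t 0
        rw [Int.cast_zero, zero_mul, zero_mul, xi_zero, mul_one] at this
        rw [Nat.cast_zero, this]
        simp [xi_zero]
      · rw [hμ.eq_zero, smul_zero]
        refine Or.inr (Or.inr fun n hn => ?_)
        rw [Finset.mem_range] at hk
        have h3 : (2 : ℤ) * k = n * ℓ := by
          have : (2 : ℂ) * k = n * ℓ := by rw [hn]; ring
          exact_mod_cast this
        have := Nat.le_of_dvd (by omega) (Int.natCast_dvd_natCast.1 (ell'_dvd_of_two_mul_eq h3))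
        omega
    rw [topVector, weightProj, mul_smul_comm, map_smul, Finset.mul_sum, map_sum,
      Finset.sum_congr rfl h2]
    simp [ell'_pos hℓ]
  rw [h, map_zero] at h1
  exact inv_ne_zero (by exact_mod_cast ell'_ne_zero hℓ) h1.symm

/-- The product `∏ c_l` of the first `j` coefficients of the action of `E`. -/
noncomputable def hwNorm (ℓ : ℕ) (w : ℂ) (j : ℕ) : ℂ :=
  ∏ l ∈ Finset.range j, hwCoeff ℓ w (l + 1 : ℕ)

theorem hwNorm_ne_zero (hℓ : 3 ≤ ℓ) {t : ℂ} (ht : (t : Deg) ∈ genericDeg ℓ) (r : ℤ) {j : ℕ}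
    (hj : j < ell' ℓ) : hwNorm ℓ (t + r * 2) j ≠ 0 := by
  refine Finset.prod_ne_zero_iff.2 fun l hl => ?_
  rw [Finset.mem_range] at hl
  exact hwCoeff_ne_zero hℓ ht r (Nat.succ_pos l) (by omega)

/-- The matrix units of `Ũ_a`. -/
noncomputable def matrixUnit (ℓ : ℕ) (t : ℂ) (r : ℤ) (i j : ℕ) : U ℓ (t : Deg) :=
  (hwNorm ℓ (t + r * 2) j * hwNorm ℓ (t + r * 2) (ell' ℓ - 1))⁻¹ •
    (F ℓ t ^ i * topVector ℓ t r * E ℓ t ^ j)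

theorem matrixUnit_mem (hℓ : 3 ≤ ℓ) (t : ℂ) (r : ℤ) (i j : ℕ) :
    matrixUnit ℓ t r i j ∈ smallU ℓ (t : Deg) :=
  Subalgebra.smul_mem _ (mul_mem (mul_mem (pow_mem F_mem_smallU i)
    (mul_mem (EF_mem_smallU _ _) (weightProj_mem hℓ _ _))) (pow_mem E_mem_smallU j)) _

/-- Everything reduces to v_r E^j F^p v_s. If j > p, the powers of E reach the highest weight vector
v_s and give 0. If j < p, a power of F is left over and v_r F = 0. If j = p, the result is a scalar
times v_r v_s, and that product is 0 for r ≠ s. The scalars for r = s explain the normalization in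
`matrixUnit`. -/
theorem matrixUnit_mul (hℓ : 3 ≤ ℓ) {t : ℂ} (ht : (t : Deg) ∈ genericDeg ℓ) {r s : ℤ}
    (hrs : (ell' ℓ : ℤ) ∣ s - r ↔ s = r) (i : ℕ) {j : ℕ} (hj : j < ell' ℓ) (p q : ℕ) :
    matrixUnit ℓ t r i j * matrixUnit ℓ t s p q =
      if r = s ∧ j = p then matrixUnit ℓ t r i q else 0 := by
  have hy := topVector_isHW hℓ t s
  have hF : ∀ d, topVector ℓ t r * (F ℓ t ^ (d + 1)) = 0 := fun d => by
    rw [pow_succ', ← mul_assoc, topVector_mul_F hℓ, zero_mul]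
  have h1 : topVector ℓ t r * (E ℓ t ^ j * (F ℓ t ^ p * topVector ℓ t s)) =
      if r = s ∧ j = p then (hwNorm ℓ (t + r * 2) j * hwNorm ℓ (t + r * 2) (ell' ℓ - 1)) •
        topVector ℓ t r else 0 := by
    rcases lt_trichotomy j p with h | h | h
    · rw [if_neg (by omega)]
      obtain ⟨d, rfl⟩ : ∃ d, p = d + 1 + j := ⟨p - j - 1, by omega⟩
      rw [hy.E_pow_mul_F_pow hℓ, mul_smul_comm, ← mul_assoc, hF, zero_mul, smul_zero]
    · subst h
      have h2 := hy.E_pow_mul_F_pow hℓ 0 j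
      simp only [zero_add, pow_zero, one_mul] at h2
      rw [h2, mul_smul_comm, topVector_mul_topVector hℓ t hrs]
      by_cases h3 : s = r
      · subst h3
        rw [if_pos rfl, if_pos ⟨rfl, rfl⟩, smul_smul]; rfl
      · rw [if_neg h3, if_neg (fun h => h3 h.1.symm), smul_zero]
    · rw [hy.E_pow_mul_F_pow_of_lt hℓ h, mul_zero, if_neg (by omega)]
  have h2 : (F ℓ t ^ i * topVector ℓ t r * E ℓ t ^ j) * (F ℓ t ^ p * topVector ℓ t s * E ℓ t ^ q) =
      F ℓ t ^ i * (topVector ℓ t r * (E ℓ t ^ j * (F ℓ t ^ p * topVector ℓ t s))) * E ℓ t ^ q := by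
    simp only [mul_assoc]
  rw [matrixUnit, matrixUnit, smul_mul_smul_comm, h2, h1]
  split_ifs with h
  · obtain ⟨rfl, rfl⟩ := h
    have hne : hwNorm ℓ (t + r * 2) j * hwNorm ℓ (t + r * 2) (ell' ℓ - 1) ≠ 0 :=
      mul_ne_zero (hwNorm_ne_zero hℓ ht r hj)
        (hwNorm_ne_zero hℓ ht r (Nat.sub_lt (ell'_pos hℓ) one_pos))
    rw [mul_smul_comm, smul_mul_assoc, smul_smul, mul_right_comm, inv_mul_cancel₀ hne, one_mul,
      matrixUnit]
  · simp

theorem matrixUnit_zero_ne_zero (hℓ : 3 ≤ ℓ) {t : ℂ} (ht : (t : Deg) ∈ genericDeg ℓ) (r : ℤ) :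
    matrixUnit ℓ t r 0 0 ≠ 0 := by
  rw [matrixUnit, pow_zero, pow_zero, one_mul, mul_one]
  exact smul_ne_zero (inv_ne_zero (mul_ne_zero (hwNorm_ne_zero hℓ ht r (ell'_pos hℓ))
    (hwNorm_ne_zero hℓ ht r (Nat.sub_lt (ell'_pos hℓ) one_pos)))) (topVector_ne_zero hℓ t r)

theorem finite_smallU (hℓ : 3 ≤ ℓ) (a : Deg) : FiniteDimensional ℂ (smallU ℓ a) := by
  have := FiniteDimensional.span_of_finite ℂ (Set.finite_range
    fun p : Fin (ell' ℓ) × Fin (ell' ℓ) × Fin (ell' ℓ) =>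
      E ℓ a ^ (p.1 : ℕ) * F ℓ a ^ (p.2.1 : ℕ) * K ℓ a 1 ^ (p.2.2 : ℕ))
  exact Submodule.finiteDimensional_of_le (smallU_le_span hℓ)

theorem finrank_smallU_le (hℓ : 3 ≤ ℓ) (a : Deg) : Module.finrank ℂ (smallU ℓ a) ≤
    Fintype.card (Fin (ell' ℓ) × Fin (ell' ℓ) × Fin (ell' ℓ)) := by
  have := FiniteDimensional.span_of_finite ℂ (Set.finite_range
    fun p : Fin (ell' ℓ) × Fin (ell' ℓ) × Fin (ell' ℓ) =>
      E ℓ a ^ (p.1 : ℕ) * F ℓ a ^ (p.2.1 : ℕ) * K ℓ a 1 ^ (p.2.2 : ℕ))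
  exact (Submodule.finrank_mono (smallU_le_span hℓ)).trans (finrank_range_le_card _)

/-- For generic `a` the trace form of `Ũ_a` is nondegenerate. -/
theorem smallU_eq_zero_of_trace (hℓ : 3 ≤ ℓ) {a : Deg} (ha : a ∈ genericDeg ℓ) {x : smallU ℓ a}
    (hx : ∀ y, LinearMap.trace ℂ (smallU ℓ a) (LinearMap.mulLeft ℂ (x * y)) = 0) : x = 0 := by
  obtain ⟨t, rfl⟩ := QuotientAddGroup.mk_surjective a
  have := finite_smallU hℓ (t : Deg)
  have : Nonempty (Fin (ell' ℓ)) := ⟨⟨0, ell'_pos hℓ⟩⟩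
  -- The ℓ' weights give ℓ' blocks of size ℓ', as many matrix units as there are spanning monomials.
  refine eq_zero_of_trace_mulLeft_eq_zero (R := Fin (ell' ℓ)) (n := Fin (ell' ℓ))
    (u := fun r i j => ⟨matrixUnit ℓ t (r : ℕ) i j, matrixUnit_mem hℓ t _ _ _⟩) ?_ ?_
    (finrank_smallU_le hℓ _) hx
  · intro r s i j p q
    apply Subtype.ext
    have hrs : (ell' ℓ : ℤ) ∣ (s : ℕ) - (r : ℕ) ↔ ((s : ℕ) : ℤ) = (r : ℕ) := by
      constructor
      · intro h
        have h1 := Int.eq_zero_of_abs_lt_dvd h (by rw [abs_lt]; omega)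
        omega
      · intro h; rw [h, sub_self]; exact dvd_zero _
    have h := matrixUnit_mul hℓ ha hrs i j.2 p q
    rw [MulMemClass.coe_mul, h]
    by_cases h1 : r = s ∧ j = p
    · rw [if_pos h1, if_pos (by rw [h1.1, h1.2]; exact ⟨rfl, rfl⟩)]
    · rw [if_neg h1, if_neg]
      · rfl
      · simpa [Fin.ext_iff] using h1
  · intro r
    refine ⟨⟨0, ell'_pos hℓ⟩, fun h => ?_⟩
    exact matrixUnit_zero_ne_zero hℓ ha (r : ℕ) (congrArg Subtype.val h)

theorem IsPBWForm.existsUnique_represents {η : ℂ} {μ : ∀ a : Deg, U ℓ a →ₗ[ℂ] ℂ}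
    (hμ : IsPBWForm ℓ η μ) (hℓ : 3 ≤ ℓ) {a : Deg} (ha : a ∈ genericDeg ℓ) :
    ∃! z : Subalgebra.center ℂ (smallU ℓ a), Represents ℓ a (μ a) z := by
  have := finite_smallU hℓ a
  exact existsUnique_center_trace_mulLeft (fun x hx => smallU_eq_zero_of_trace hℓ ha hx)
    (μ a ∘ₗ (smallU ℓ a).val.toLinearMap) fun x y =>
      hμ.mul_comm hℓ (x : U ℓ a) (y : U ℓ a)

end QuantumSL2

/-! ### Partial contractions and multiplication by pure tensors -/

namespace PivotalHopfGCoalgebra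

variable {k A B : Type*} [CommRing k] [Ring A] [Algebra k A] [Ring B] [Algebra k B]

theorem contractLeft_tmul_mul (f : A →ₗ[k] k) (p : A) (q : B) (x : A ⊗[k] B) :
    contractLeft f (p ⊗ₜ q * x) = q * contractLeft (f ∘ₗ LinearMap.mulLeft k p) x := by
  induction x with
  | zero => simp
  | tmul u v => simp [contractLeft]
  | add x y hx hy => rw [mul_add, map_add, hx, hy, map_add, mul_add]

theorem contractLeft_mul_tmul (f : A →ₗ[k] k) (p : A) (q : B) (x : A ⊗[k] B) :
    contractLeft f (x * p ⊗ₜ q) = contractLeft (f ∘ₗ LinearMap.mulRight k p) x * q := by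
  induction x with
  | zero => simp
  | tmul u v => simp [contractLeft]
  | add x y hx hy => rw [add_mul, map_add, hx, hy, map_add, add_mul]

theorem contractRight_tmul_mul (f : B →ₗ[k] k) (p : A) (q : B) (x : A ⊗[k] B) :
    contractRight f (p ⊗ₜ q * x) = p * contractRight (f ∘ₗ LinearMap.mulLeft k q) x := by
  induction x with
  | zero => simp
  | tmul u v => simp [contractRight]
  | add x y hx hy => rw [mul_add, map_add, hx, hy, map_add, mul_add]

theorem contractRight_mul_tmul (f : B →ₗ[k] k) (p : A) (q : B) (x : A ⊗[k] B) :
    contractRight f (x * p ⊗ₜ q) = contractRight (f ∘ₗ LinearMap.mulRight k q) x * p := by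
  induction x with
  | zero => simp
  | tmul u v => simp [contractRight]
  | add x y hx hy => rw [add_mul, map_add, hx, hy, map_add, add_mul]

end PivotalHopfGCoalgebra

namespace QuantumSL2

open PivotalHopfGCoalgebra

variable {ℓ : ℕ} {a b c : Deg}

/-! ### Partial contractions of the commutant of the coproduct -/

theorem mem_center_of_comm {y : U ℓ a} (hE : E ℓ a * y = y * E ℓ a) (hF : F ℓ a * y = y * F ℓ a)
    (hK : ∀ α, K ℓ a α * y = y * K ℓ a α) : y ∈ Subalgebra.center ℂ (U ℓ a) := by
  rw [Subalgebra.mem_center_iff]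
  intro x
  induction x using U.induction with
  | hc r => exact Algebra.commutes r y
  | hE => exact hE
  | hF => exact hF
  | hK α => exact hK α
  | hmul x x' hx hx' => rw [mul_assoc, hx', ← mul_assoc, hx, mul_assoc]
  | hadd x x' hx hx' => rw [add_mul, mul_add, hx, hx']

theorem E_mul_K (α : ℂ) : E ℓ a * K ℓ a α = xi ℓ (-2 * α) • (K ℓ a α * E ℓ a) := by
  rw [K_mul_E, smul_smul, ← xi_add, show -2 * α + 2 * α = 0 by ring, xi_zero, one_smul]

theorem F_mul_K (α : ℂ) : F ℓ a * K ℓ a α = xi ℓ (2 * α) • (K ℓ a α * F ℓ a) := by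
  rw [K_mul_F, smul_smul, ← xi_add, show 2 * α + -2 * α = 0 by ring, xi_zero, one_smul]

theorem xi_neg_two_mul_ell' (hℓ : 3 ≤ ℓ) : xi ℓ (-(2 * ell' ℓ)) = 1 := by
  rw [xi_neg, xi_two_mul_ell' hℓ, inv_one]

section contract

variable {x : U ℓ a ⊗[ℂ] U ℓ b}

/-- Contracting with the pivotal twist of a cyclic form is a partial quantum trace, and the partial
quantum trace of an intertwiner is an intertwiner. For each generator, this is read off from the
contraction of its commutation relation with x. -/
theorem contractLeft_mem_center (hℓ : 3 ≤ ℓ) {μ : U ℓ a →ₗ[ℂ] ℂ}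
    (hμ : ∀ x y, μ (x * y) = μ (y * x))
    (hx : ∀ y : U ℓ (a + b), comul hℓ rfl y * x = x * comul hℓ rfl y) :
    contractLeft (μ ∘ₗ LinearMap.mulLeft ℂ (K ℓ a (-(1 - ell' ℓ)))) x ∈
      Subalgebra.center ℂ (U ℓ b) := by
  set f := μ ∘ₗ LinearMap.mulLeft ℂ (K ℓ a (-(1 - ell' ℓ))) with hf
  have hK : ∀ (φ : U ℓ a →ₗ[ℂ] ℂ) (α : ℂ),
      K ℓ b α * contractLeft (φ ∘ₗ LinearMap.mulLeft ℂ (K ℓ a α)) x =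
        contractLeft (φ ∘ₗ LinearMap.mulRight ℂ (K ℓ a α)) x * K ℓ b α := by
    intro φ α
    have h := hx (K ℓ _ α)
    rw [comul_K] at h
    rw [← contractLeft_tmul_mul, h, contractLeft_mul_tmul]
  have hE := congrArg (contractLeft f) (hx (E ℓ _))
  rw [comul_E, add_mul, mul_add, map_add, map_add, contractLeft_tmul_mul, contractLeft_tmul_mul,
    contractLeft_mul_tmul, contractLeft_mul_tmul, LinearMap.mulLeft_one, LinearMap.mulRight_one,
    LinearMap.comp_id] at hE
  -- The extra factor K cancels the K⁻¹ in Δ(F) = K⁻¹ ⊗ F + F ⊗ 1. It also turns the form into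
  -- μ(K^{ℓ'} ·), which is cyclic with respect to F, so the terms from F ⊗ 1 agree.
  have hF := congrArg (contractLeft (f ∘ₗ LinearMap.mulLeft ℂ (K ℓ a 1))) (hx (F ℓ _))
  rw [comul_F, add_mul, mul_add, map_add, map_add, contractLeft_tmul_mul, contractLeft_tmul_mul,
    contractLeft_mul_tmul, contractLeft_mul_tmul, one_mul, mul_one] at hF
  have hconj : ∀ α, (f ∘ₗ LinearMap.mulLeft ℂ (K ℓ a α)) ∘ₗ LinearMap.mulRight ℂ (K ℓ a (-α)) =
      f := by
    intro α
    ext u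
    simp only [hf, LinearMap.comp_apply, LinearMap.mulLeft_apply, LinearMap.mulRight_apply]
    rw [← mul_assoc, ← mul_assoc, hμ, ← mul_assoc, ← mul_assoc, K_mul_K, K_mul_K]
    congr 3; ring
  have hcancel : ∀ α, (f ∘ₗ LinearMap.mulLeft ℂ (K ℓ a α)) ∘ₗ LinearMap.mulLeft ℂ (K ℓ a (-α)) =
      f := by
    intro α
    ext u
    simp only [hf, LinearMap.comp_apply, LinearMap.mulLeft_apply]
    rw [← mul_assoc (K ℓ a α), K_mul_K_neg, one_mul]
  refine mem_center_of_comm ?_ ?_ fun α => ?_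
  -- The relation for K, applied to this twisted form, matches the two terms coming from E ⊗ K. The
  -- relation for E then reduces to commutation with E.
  · have h1 := hK (f ∘ₗ LinearMap.mulLeft ℂ (E ℓ a * K ℓ a (-1))) 1
    have h2 : (f ∘ₗ LinearMap.mulLeft ℂ (E ℓ a * K ℓ a (-1))) ∘ₗ LinearMap.mulLeft ℂ (K ℓ a 1) =
        f ∘ₗ LinearMap.mulLeft ℂ (E ℓ a) := by
      ext u
      simp only [LinearMap.comp_apply, LinearMap.mulLeft_apply]
      rw [mul_assoc (E ℓ a), ← mul_assoc (K ℓ a (-1)), K_neg_mul_K, one_mul]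
    have h3 : (f ∘ₗ LinearMap.mulLeft ℂ (E ℓ a * K ℓ a (-1))) ∘ₗ LinearMap.mulRight ℂ (K ℓ a 1) =
        f ∘ₗ LinearMap.mulRight ℂ (E ℓ a) := by
      ext u
      simp only [hf, LinearMap.comp_apply, LinearMap.mulLeft_apply, LinearMap.mulRight_apply]
      have e : K ℓ a 1 * (K ℓ a (-(1 - ell' ℓ)) * (E ℓ a * K ℓ a (-1))) =
          E ℓ a * K ℓ a (-(1 - ell' ℓ)) := by
        rw [E_mul_K, E_mul_K, mul_smul_comm, mul_smul_comm, ← mul_assoc (K ℓ a _) (K ℓ a (-1)),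
          K_mul_K, ← mul_assoc, K_mul_K, show (-2 : ℂ) * -1 = 2 by norm_num,
          show (-2 : ℂ) * -(1 - ell' ℓ) = 2 + -(2 * ell' ℓ) by ring, xi_add ℓ 2,
          xi_neg_two_mul_ell' hℓ, mul_one]
        congr 3; ring
      calc μ (K ℓ a (-(1 - ell' ℓ)) * (E ℓ a * K ℓ a (-1) * (u * K ℓ a 1)))
          = μ ((K ℓ a (-(1 - ell' ℓ)) * (E ℓ a * K ℓ a (-1)) * u) * K ℓ a 1) := by
            simp only [mul_assoc]
        _ = μ (K ℓ a 1 * (K ℓ a (-(1 - ell' ℓ)) * (E ℓ a * K ℓ a (-1))) * u) := by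
            rw [hμ, ← mul_assoc]
        _ = μ (K ℓ a (-(1 - ell' ℓ)) * (u * E ℓ a)) := by
            rw [e, mul_assoc, hμ, mul_assoc]
    rw [h2, h3] at h1
    rwa [h1, add_left_inj] at hE
  · have h3 : (f ∘ₗ LinearMap.mulLeft ℂ (K ℓ a 1)) ∘ₗ LinearMap.mulLeft ℂ (F ℓ a) =
        (f ∘ₗ LinearMap.mulLeft ℂ (K ℓ a 1)) ∘ₗ LinearMap.mulRight ℂ (F ℓ a) := by
      ext u
      simp only [hf, LinearMap.comp_apply, LinearMap.mulLeft_apply, LinearMap.mulRight_apply]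
      have e : K ℓ a (-(1 - ell' ℓ)) * (K ℓ a 1 * F ℓ a) =
          F ℓ a * K ℓ a (-(1 - ell' ℓ)) * K ℓ a 1 := by
        rw [mul_assoc (F ℓ a), K_mul_K, F_mul_K, ← mul_assoc, K_mul_K,
          show (2 : ℂ) * (-(1 - ell' ℓ) + 1) = 2 * ell' ℓ by ring, xi_two_mul_ell' hℓ, one_smul]
      calc μ (K ℓ a (-(1 - ell' ℓ)) * (K ℓ a 1 * (F ℓ a * u)))
          = μ (K ℓ a (-(1 - ell' ℓ)) * (K ℓ a 1 * F ℓ a) * u) := by simp only [mul_assoc]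
        _ = μ (K ℓ a (-(1 - ell' ℓ)) * (K ℓ a 1 * (u * F ℓ a))) := by
            rw [e, mul_assoc, mul_assoc, hμ]; simp only [mul_assoc]
    rw [hcancel, hconj, h3] at hF
    exact add_right_cancel hF
  · have h1 := hK (f ∘ₗ LinearMap.mulLeft ℂ (K ℓ a (-α))) α
    have h2 := hcancel (-α)
    have h3 := hconj (-α)
    rw [neg_neg] at h2 h3
    rwa [h2, h3] at h1

/-- Mirror image of the left contraction: E and F exchange roles, because the coproduct puts K to
the right of E and K⁻¹ to the left of F. -/
theorem contractRight_mem_center (hℓ : 3 ≤ ℓ) {μ : U ℓ b →ₗ[ℂ] ℂ}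
    (hμ : ∀ x y, μ (x * y) = μ (y * x))
    (hx : ∀ y : U ℓ (a + b), comul hℓ rfl y * x = x * comul hℓ rfl y) :
    contractRight (μ ∘ₗ LinearMap.mulLeft ℂ (K ℓ b (1 - ell' ℓ))) x ∈
      Subalgebra.center ℂ (U ℓ a) := by
  set f := μ ∘ₗ LinearMap.mulLeft ℂ (K ℓ b (1 - ell' ℓ)) with hf
  have hK : ∀ (φ : U ℓ b →ₗ[ℂ] ℂ) (α : ℂ),
      K ℓ a α * contractRight (φ ∘ₗ LinearMap.mulLeft ℂ (K ℓ b α)) x =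
        contractRight (φ ∘ₗ LinearMap.mulRight ℂ (K ℓ b α)) x * K ℓ a α := by
    intro φ α
    have h := hx (K ℓ _ α)
    rw [comul_K] at h
    rw [← contractRight_tmul_mul, h, contractRight_mul_tmul]
  have hE := congrArg (contractRight (f ∘ₗ LinearMap.mulLeft ℂ (K ℓ b (-1)))) (hx (E ℓ _))
  rw [comul_E, add_mul, mul_add, map_add, map_add, contractRight_tmul_mul, contractRight_tmul_mul,
    contractRight_mul_tmul, contractRight_mul_tmul, one_mul, mul_one] at hE
  have hF := congrArg (contractRight f) (hx (F ℓ _))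
  rw [comul_F, add_mul, mul_add, map_add, map_add, contractRight_tmul_mul, contractRight_tmul_mul,
    contractRight_mul_tmul, contractRight_mul_tmul, LinearMap.mulLeft_one, LinearMap.mulRight_one,
    LinearMap.comp_id] at hF
  have hconj : ∀ α, (f ∘ₗ LinearMap.mulLeft ℂ (K ℓ b (-α))) ∘ₗ LinearMap.mulRight ℂ (K ℓ b α) =
      f := by
    intro α
    ext u
    simp only [hf, LinearMap.comp_apply, LinearMap.mulLeft_apply, LinearMap.mulRight_apply]
    rw [← mul_assoc, ← mul_assoc, hμ, ← mul_assoc, ← mul_assoc, K_mul_K, K_mul_K]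
    congr 3; ring
  have hcancel : ∀ α, (f ∘ₗ LinearMap.mulLeft ℂ (K ℓ b (-α))) ∘ₗ LinearMap.mulLeft ℂ (K ℓ b α) =
      f := by
    intro α
    ext u
    simp only [hf, LinearMap.comp_apply, LinearMap.mulLeft_apply]
    rw [← mul_assoc (K ℓ b (-α)), K_neg_mul_K, one_mul]
  refine mem_center_of_comm ?_ ?_ fun α => ?_
  · have h3 : (f ∘ₗ LinearMap.mulLeft ℂ (K ℓ b (-1))) ∘ₗ LinearMap.mulLeft ℂ (E ℓ b) =
        (f ∘ₗ LinearMap.mulLeft ℂ (K ℓ b (-1))) ∘ₗ LinearMap.mulRight ℂ (E ℓ b) := by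
      ext u
      simp only [hf, LinearMap.comp_apply, LinearMap.mulLeft_apply, LinearMap.mulRight_apply]
      have e : K ℓ b (1 - ell' ℓ) * (K ℓ b (-1) * E ℓ b) =
          E ℓ b * K ℓ b (1 - ell' ℓ) * K ℓ b (-1) := by
        rw [mul_assoc (E ℓ b), K_mul_K, E_mul_K, ← mul_assoc, K_mul_K,
          show (-2 : ℂ) * (1 - ell' ℓ + -1) = 2 * ell' ℓ by ring, xi_two_mul_ell' hℓ, one_smul]
      calc μ (K ℓ b (1 - ell' ℓ) * (K ℓ b (-1) * (E ℓ b * u)))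
          = μ (K ℓ b (1 - ell' ℓ) * (K ℓ b (-1) * E ℓ b) * u) := by simp only [mul_assoc]
        _ = μ (K ℓ b (1 - ell' ℓ) * (K ℓ b (-1) * (u * E ℓ b))) := by
            rw [e, mul_assoc, mul_assoc, hμ]; simp only [mul_assoc]
    rw [hcancel, hconj, h3] at hE
    exact add_left_cancel hE
  · have h1 := hK (f ∘ₗ LinearMap.mulLeft ℂ (F ℓ b * K ℓ b 1)) (-1)
    have h2 : (f ∘ₗ LinearMap.mulLeft ℂ (F ℓ b * K ℓ b 1)) ∘ₗ LinearMap.mulLeft ℂ (K ℓ b (-1)) =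
        f ∘ₗ LinearMap.mulLeft ℂ (F ℓ b) := by
      ext u
      simp only [LinearMap.comp_apply, LinearMap.mulLeft_apply]
      rw [mul_assoc (F ℓ b), ← mul_assoc (K ℓ b 1), K_mul_K_neg, one_mul]
    have h3 : (f ∘ₗ LinearMap.mulLeft ℂ (F ℓ b * K ℓ b 1)) ∘ₗ LinearMap.mulRight ℂ (K ℓ b (-1)) =
        f ∘ₗ LinearMap.mulRight ℂ (F ℓ b) := by
      ext u
      simp only [hf, LinearMap.comp_apply, LinearMap.mulLeft_apply, LinearMap.mulRight_apply]
      have e : K ℓ b (-1) * (K ℓ b (1 - ell' ℓ) * (F ℓ b * K ℓ b 1)) =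
          F ℓ b * K ℓ b (1 - ell' ℓ) := by
        rw [F_mul_K, F_mul_K, mul_smul_comm, mul_smul_comm, ← mul_assoc (K ℓ b _) (K ℓ b 1),
          K_mul_K, ← mul_assoc, K_mul_K, mul_one,
          show (2 : ℂ) * (1 - ell' ℓ) = 2 + -(2 * ell' ℓ) by ring, xi_add ℓ 2,
          xi_neg_two_mul_ell' hℓ, mul_one]
        congr 3; ring
      calc μ (K ℓ b (1 - ell' ℓ) * (F ℓ b * K ℓ b 1 * (u * K ℓ b (-1))))
          = μ ((K ℓ b (1 - ell' ℓ) * (F ℓ b * K ℓ b 1) * u) * K ℓ b (-1)) := by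
            simp only [mul_assoc]
        _ = μ (K ℓ b (-1) * (K ℓ b (1 - ell' ℓ) * (F ℓ b * K ℓ b 1)) * u) := by
            rw [hμ, ← mul_assoc]
        _ = μ (K ℓ b (1 - ell' ℓ) * (u * F ℓ b)) := by
            rw [e, mul_assoc, hμ, mul_assoc]
    rw [h2, h3] at h1
    rwa [h1, add_right_inj] at hF
  · have h1 := hK (f ∘ₗ LinearMap.mulLeft ℂ (K ℓ b (-α))) α
    rwa [hcancel, hconj] at h1

end contract

end QuantumSL2

/-- The trace of an endomorphism commuting with the action of `H` on a module with two
coordinate systems does not depend on the system used to compute it. -/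
theorem sum_trace_eq_sum_trace {k H A ι κ : Type*} [CommRing k] [Ring H] [Algebra k H] [Ring A]
    [Algebra k A] [Fintype ι] [Fintype κ] (D : H →ₐ[k] A) (μ : H →ₗ[k] k)
    (hμ : ∀ x y, μ (x * y) = μ (y * x)) {f : ι → A →ₗ[k] H} {m : ι → A} {g : κ → A →ₗ[k] H}
    {n : κ → A} (T : A →ₗ[k] A) (hf : ∀ j h y, f j (D h * y) = h * f j y)
    (hg : ∀ i h y, g i (D h * y) = h * g i y)
    (hfn : ∀ i, ∑ j, D (f j (n i)) * m j = n i)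
    (hgm : ∀ j, ∑ i, D (g i (T (m j))) * n i = T (m j))
    (hT : ∀ i j, T (D (f j (n i)) * m j) = D (f j (n i)) * T (m j)) :
    ∑ j, μ (f j (T (m j))) = ∑ i, μ (g i (T (n i))) := by
  -- Expand T(m_j) in the second system. Cyclicity of μ moves the coefficient g_i(T(m_j)) behind
  -- f_j(n_i), and linearity of g_i and T absorbs f_j(n_i) into the argument. Summing over j then
  -- reassembles n_i.
  have h1 : ∀ j, μ (f j (T (m j))) = ∑ i, μ (g i (T (D (f j (n i)) * m j))) := by
    intro j
    conv_lhs => rw [← hgm j, map_sum, map_sum]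
    refine Finset.sum_congr rfl fun i _ => ?_
    rw [hf, hμ, hT, hg]
  rw [Finset.sum_congr rfl fun j _ => h1 j, Finset.sum_comm]
  refine Finset.sum_congr rfl fun i _ => ?_
  rw [← map_sum, ← map_sum, ← map_sum, hfn]

namespace PivotalHopfGCoalgebra

variable {k A B : Type*} [CommRing k] [Ring A] [Algebra k A] [Ring B] [Algebra k B]

theorem apply_contractLeft (f : A →ₗ[k] k) (g : B →ₗ[k] k) (x : A ⊗[k] B) :
    g (contractLeft f x) = f (contractRight g x) := by
  induction x with
  | zero => simp
  | tmul u v => simp [contractLeft, contractRight, mul_comm]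
  | add x y hx hy => rw [map_add, map_add, hx, hy, map_add, map_add]

theorem apply_contractRight_mul_right (f : A →ₗ[k] k) (g : B →ₗ[k] k) (x : A ⊗[k] B) (q : B) :
    f (contractRight g (x * 1 ⊗ₜ q)) = g (contractLeft f x * q) := by
  rw [← apply_contractLeft, contractLeft_mul_tmul, LinearMap.mulRight_one, LinearMap.comp_id]

theorem apply_contractLeft_mul_left (f : A →ₗ[k] k) (g : B →ₗ[k] k) (x : A ⊗[k] B) (q : A) :
    g (contractLeft f (x * q ⊗ₜ 1)) = f (contractRight g x * q) := by
  rw [apply_contractLeft, contractRight_mul_tmul, LinearMap.mulRight_one, LinearMap.comp_id]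

theorem contractLeft_map {A' B' : Type*} [Ring A'] [Algebra k A'] [Ring B'] [Algebra k B']
    (f : A' →ₗ[k] k) (P : A →ₗ[k] A') (Q : B →ₗ[k] B') (x : A ⊗[k] B) :
    contractLeft f (TensorProduct.map P Q x) = Q (contractLeft (f ∘ₗ P) x) := by
  induction x with
  | zero => simp
  | tmul u v => simp [contractLeft]
  | add x y hx hy => rw [map_add, map_add, hx, hy, map_add, map_add]

theorem contractRight_map {A' B' : Type*} [Ring A'] [Algebra k A'] [Ring B'] [Algebra k B']
    (f : B' →ₗ[k] k) (P : A →ₗ[k] A') (Q : B →ₗ[k] B') (x : A ⊗[k] B) :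
    contractRight f (TensorProduct.map P Q x) = P (contractRight (f ∘ₗ Q) x) := by
  induction x with
  | zero => simp
  | tmul u v => simp [contractRight]
  | add x y hx hy => rw [map_add, map_add, hx, hy, map_add, map_add]

end PivotalHopfGCoalgebra

namespace QuantumSL2

open PivotalHopfGCoalgebra

variable {ℓ : ℕ} {a b c : Deg}

/-! ### The free module structures of `U_a ⊗ U_b` over `U_{a+b}` -/

section projection

/-- The projection of `U_a ⊗ U_b` onto `Ũ_a ⊗ Ũ_b`. -/
noncomputable def tensorProj (ℓ : ℕ) (a b : Deg) : U ℓ a ⊗[ℂ] U ℓ b →ₗ[ℂ] U ℓ a ⊗[ℂ] U ℓ b :=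
  TensorProduct.map (smallProj ℓ a) (smallProj ℓ b)

theorem tensorProj_tmul_mul {p : U ℓ a} {q : U ℓ b} (hp : p ∈ smallU ℓ a) (hq : q ∈ smallU ℓ b)
    (x : U ℓ a ⊗[ℂ] U ℓ b) : tensorProj ℓ a b (p ⊗ₜ q * x) = p ⊗ₜ q * tensorProj ℓ a b x := by
  induction x with
  | zero => simp
  | tmul u v => simp [tensorProj, smallProj_mul_left hp, smallProj_mul_left hq]
  | add x y hx hy => rw [mul_add, map_add, hx, hy, map_add, mul_add]

theorem tensorProj_mul_tmul {p : U ℓ a} {q : U ℓ b} (hp : p ∈ smallU ℓ a) (hq : q ∈ smallU ℓ b)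
    (x : U ℓ a ⊗[ℂ] U ℓ b) : tensorProj ℓ a b (x * p ⊗ₜ q) = tensorProj ℓ a b x * p ⊗ₜ q := by
  induction x with
  | zero => simp
  | tmul u v => simp [tensorProj, smallProj_mul_right hp, smallProj_mul_right hq]
  | add x y hx hy => rw [add_mul, map_add, hx, hy, map_add, add_mul]

theorem smallProj_smallProj (hℓ : 3 ≤ ℓ) (x : U ℓ a) :
    smallProj ℓ a (smallProj ℓ a x) = smallProj ℓ a x :=
  smallProj_of_mem (smallProj_mem hℓ x)

theorem tensorProj_tensorProj (hℓ : 3 ≤ ℓ) (x : U ℓ a ⊗[ℂ] U ℓ b) :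
    tensorProj ℓ a b (tensorProj ℓ a b x) = tensorProj ℓ a b x := by
  induction x with
  | zero => simp
  | tmul u v => simp [tensorProj, smallProj_smallProj hℓ]
  | add x y hx hy => rw [map_add, map_add, hx, hy]

theorem lTensor_smallProj (hℓ : 3 ≤ ℓ) {x : U ℓ a ⊗[ℂ] U ℓ b} (hx : tensorProj ℓ a b x = x) :
    (smallProj ℓ b).lTensor (U ℓ a) x = x := by
  have : ∀ y, (smallProj ℓ b).lTensor (U ℓ a) (tensorProj ℓ a b y) = tensorProj ℓ a b y := by
    intro y
    induction y with
    | zero => simp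
    | tmul u v => simp [tensorProj, smallProj_smallProj hℓ]
    | add x y hx hy => rw [map_add, map_add, hx, hy]
  rw [← hx, this]

theorem rTensor_smallProj (hℓ : 3 ≤ ℓ) {x : U ℓ a ⊗[ℂ] U ℓ b} (hx : tensorProj ℓ a b x = x) :
    (smallProj ℓ a).rTensor (U ℓ b) x = x := by
  have : ∀ y, (smallProj ℓ a).rTensor (U ℓ b) (tensorProj ℓ a b y) = tensorProj ℓ a b y := by
    intro y
    induction y with
    | zero => simp
    | tmul u v => simp [tensorProj, smallProj_smallProj hℓ]
    | add x y hx hy => rw [map_add, map_add, hx, hy]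
  rw [← hx, this]

theorem contractLeft_mem_smallU (hℓ : 3 ≤ ℓ) (f : U ℓ a →ₗ[ℂ] ℂ) {x : U ℓ a ⊗[ℂ] U ℓ b}
    (hx : tensorProj ℓ a b x = x) : contractLeft f x ∈ smallU ℓ b := by
  rw [← hx, tensorProj, contractLeft_map]
  exact smallProj_mem hℓ _

theorem contractRight_mem_smallU (hℓ : 3 ≤ ℓ) (f : U ℓ b →ₗ[ℂ] ℂ) {x : U ℓ a ⊗[ℂ] U ℓ b}
    (hx : tensorProj ℓ a b x = x) : contractRight f x ∈ smallU ℓ a := by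
  rw [← hx, tensorProj, contractRight_map]
  exact smallProj_mem hℓ _

end projection

/-! ### Coordinates over U_{a+b} with basis elements in the second factor -/

section leftCoordinates

variable (hℓ : 3 ≤ ℓ) {b' : Deg} (h₁ : c + b' = a) (hb : b' + b = 0)

/-- The map `(Id ⊗ S) Δ_{a+b,-b} : U_a → U_{a+b} ⊗ U_b`. -/
noncomputable def coactL : U ℓ a →ₗ[ℂ] U ℓ c ⊗[ℂ] U ℓ b :=
  (antipode hb).lTensor (U ℓ c) ∘ₗ (comul hℓ h₁).toLinearMap

theorem lTensor_antipode_mul (p : U ℓ c) (q : U ℓ b') (x : U ℓ c ⊗[ℂ] U ℓ b') :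
    (antipode hb).lTensor (U ℓ c) (p ⊗ₜ q * x) =
      p ⊗ₜ 1 * (antipode hb).lTensor (U ℓ c) x * 1 ⊗ₜ antipode hb q := by
  induction x with
  | zero => simp
  | tmul u v => simp [antipode_mul]
  | add x y hx hy => rw [mul_add, map_add, hx, hy, map_add, mul_add, add_mul]

theorem antipode_one : antipode (ℓ := ℓ) hb 1 = 1 := by
  simpa using antipode_algebraMap (ℓ := ℓ) hb 1

theorem coactL_one : coactL (ℓ := ℓ) hℓ h₁ hb 1 = 1 ⊗ₜ 1 := by
  rw [coactL, LinearMap.comp_apply, AlgHom.toLinearMap_apply, map_one,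
    Algebra.TensorProduct.one_def, LinearMap.lTensor_tmul, antipode_one]

theorem coactL_E (u : U ℓ a) : coactL hℓ h₁ hb (E ℓ a * u) =
    coactL hℓ h₁ hb u * 1 ⊗ₜ (-(E ℓ b * K ℓ b (-1))) +
      E ℓ c ⊗ₜ 1 * coactL hℓ h₁ hb u * 1 ⊗ₜ K ℓ b (-1) := by
  simp only [coactL, LinearMap.comp_apply, AlgHom.toLinearMap_apply, map_mul, comul_E, add_mul,
    map_add, lTensor_antipode_mul, antipode_E, antipode_K, ← Algebra.TensorProduct.one_def, one_mul]

theorem coactL_F (u : U ℓ a) : coactL hℓ h₁ hb (F ℓ a * u) =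
    K ℓ c (-1) ⊗ₜ 1 * coactL hℓ h₁ hb u * 1 ⊗ₜ (-(K ℓ b 1 * F ℓ b)) +
      F ℓ c ⊗ₜ 1 * coactL hℓ h₁ hb u := by
  simp only [coactL, LinearMap.comp_apply, AlgHom.toLinearMap_apply, map_mul, comul_F, add_mul,
    map_add, lTensor_antipode_mul, antipode_F, antipode_one, ← Algebra.TensorProduct.one_def,
    mul_one]

theorem coactL_K (α : ℂ) (u : U ℓ a) : coactL hℓ h₁ hb (K ℓ a α * u) =
    K ℓ c α ⊗ₜ 1 * coactL hℓ h₁ hb u * 1 ⊗ₜ K ℓ b (-α) := by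
  simp only [coactL, LinearMap.comp_apply, AlgHom.toLinearMap_apply, map_mul, comul_K,
    lTensor_antipode_mul, antipode_K]

/-- The map `U_a ⊗ U_b → U_{a+b} ⊗ U_b`, `u ⊗ v ↦ u₁ ⊗ S(u₂) v`. -/
noncomputable def freeL : U ℓ a ⊗[ℂ] U ℓ b →ₗ[ℂ] U ℓ c ⊗[ℂ] U ℓ b :=
  TensorProduct.lift ((LinearMap.mul ℂ (U ℓ c ⊗[ℂ] U ℓ b)).compl₁₂ (coactL hℓ h₁ hb)
    (Algebra.TensorProduct.includeRight (R := ℂ) (A := U ℓ c) (B := U ℓ b)).toLinearMap)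

theorem freeL_tmul (u : U ℓ a) (v : U ℓ b) :
    freeL hℓ h₁ hb (u ⊗ₜ v) = coactL hℓ h₁ hb u * 1 ⊗ₜ v := rfl

/-- In Sweedler notation, x₁u₁ ⊗ S(x₂u₂) x₃v = x₁u₁ ⊗ S(u₂) S(x₂) x₃ v = xu₁ ⊗ S(u₂)v. It suffices
to verify this on the generators. -/
theorem freeL_comul_mul (h : a + b = c) (x : U ℓ c) (y : U ℓ a ⊗[ℂ] U ℓ b) :
    freeL hℓ h₁ hb (comul hℓ h x * y) = x ⊗ₜ 1 * freeL hℓ h₁ hb y := by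
  induction x using U.induction generalizing y with
  | hc r => simp [Algebra.algebraMap_eq_smul_one, ← TensorProduct.smul_tmul',
      ← Algebra.TensorProduct.one_def]
  | hE =>
    induction y with
    | zero => simp
    | add x y hx hy => rw [mul_add, map_add, hx, hy, map_add, mul_add]
    | tmul u v =>
      rw [comul_E, add_mul, Algebra.TensorProduct.tmul_mul_tmul,
        Algebra.TensorProduct.tmul_mul_tmul, map_add, freeL_tmul, freeL_tmul, freeL_tmul, coactL_E,
        one_mul, add_mul, mul_assoc _ (1 ⊗ₜ[ℂ] _), mul_assoc _ (1 ⊗ₜ[ℂ] _),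
        Algebra.TensorProduct.tmul_mul_tmul, Algebra.TensorProduct.tmul_mul_tmul, neg_mul,
        mul_assoc (E ℓ b), ← mul_assoc (K ℓ b (-1)), K_neg_mul_K, one_mul, one_mul,
        TensorProduct.tmul_neg, mul_neg, add_neg_cancel_left, mul_assoc]
  | hF =>
    induction y with
    | zero => simp
    | add x y hx hy => rw [mul_add, map_add, hx, hy, map_add, mul_add]
    | tmul u v =>
      rw [comul_F, add_mul, Algebra.TensorProduct.tmul_mul_tmul,
        Algebra.TensorProduct.tmul_mul_tmul, map_add, freeL_tmul, freeL_tmul, freeL_tmul, coactL_F,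
        coactL_K, one_mul, add_mul, mul_assoc _ (1 ⊗ₜ[ℂ] _), mul_assoc _ (1 ⊗ₜ[ℂ] _),
        Algebra.TensorProduct.tmul_mul_tmul, Algebra.TensorProduct.tmul_mul_tmul, neg_mul, neg_neg,
        mul_assoc (K ℓ b 1), one_mul,
        TensorProduct.tmul_neg, mul_neg, add_neg_cancel_left, mul_assoc]
  | hK α =>
    induction y with
    | zero => simp
    | add x y hx hy => rw [mul_add, map_add, hx, hy, map_add, mul_add]
    | tmul u v =>
      rw [comul_K, Algebra.TensorProduct.tmul_mul_tmul, freeL_tmul, freeL_tmul, coactL_K,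
        mul_assoc _ (1 ⊗ₜ[ℂ] _), Algebra.TensorProduct.tmul_mul_tmul, ← mul_assoc (K ℓ b _),
        K_neg_mul_K, one_mul, one_mul, mul_assoc]
  | hmul x x' hx hx' =>
    rw [map_mul (comul hℓ h), mul_assoc, hx, hx', ← mul_assoc, Algebra.TensorProduct.tmul_mul_tmul, one_mul]
  | hadd x x' hx hx' => rw [map_add, add_mul, map_add, hx, hx', TensorProduct.add_tmul, add_mul]

/-- The map `U_{a+b} ⊗ U_b → U_a ⊗ U_b`, `x ⊗ v ↦ Δ(x) (1 ⊗ v)`. -/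
noncomputable def unfreeL (h : a + b = c) : U ℓ c ⊗[ℂ] U ℓ b →ₗ[ℂ] U ℓ a ⊗[ℂ] U ℓ b :=
  TensorProduct.lift ((LinearMap.mul ℂ (U ℓ a ⊗[ℂ] U ℓ b)).compl₁₂ (comul hℓ h).toLinearMap
    (Algebra.TensorProduct.includeRight (R := ℂ) (A := U ℓ a) (B := U ℓ b)).toLinearMap)

theorem unfreeL_tmul (h : a + b = c) (x : U ℓ c) (v : U ℓ b) :
    unfreeL hℓ h (x ⊗ₜ v) = comul hℓ h x * 1 ⊗ₜ v := rfl

theorem unfreeL_mul_left (h : a + b = c) (p : U ℓ c) (x : U ℓ c ⊗[ℂ] U ℓ b) :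
    unfreeL hℓ h (p ⊗ₜ 1 * x) = comul hℓ h p * unfreeL hℓ h x := by
  induction x with
  | zero => simp
  | tmul u v =>
    rw [Algebra.TensorProduct.tmul_mul_tmul, unfreeL_tmul, unfreeL_tmul, map_mul, one_mul,
      mul_assoc]
  | add x y hx hy => rw [mul_add, map_add, hx, hy, map_add, mul_add]

theorem unfreeL_mul_right (h : a + b = c) (q : U ℓ b) (x : U ℓ c ⊗[ℂ] U ℓ b) :
    unfreeL hℓ h (x * 1 ⊗ₜ q) = unfreeL hℓ h x * 1 ⊗ₜ q := by
  induction x with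
  | zero => simp
  | tmul u v =>
    rw [Algebra.TensorProduct.tmul_mul_tmul, unfreeL_tmul, unfreeL_tmul, mul_assoc,
      Algebra.TensorProduct.tmul_mul_tmul, mul_one, mul_one]
  | add x y hx hy => rw [add_mul, map_add, hx, hy, map_add, add_mul]

/-- This is Δ(u₁)(1 ⊗ S(u₂)) = u ⊗ 1. The coaction is not multiplicative, so the induction shows
that the property survives left multiplication of u by any x. -/
theorem unfreeL_coactL (h : a + b = c) (u : U ℓ a) :
    unfreeL hℓ h (coactL hℓ h₁ hb u) = u ⊗ₜ 1 := by
  suffices key : ∀ x u : U ℓ a, unfreeL hℓ h (coactL hℓ h₁ hb u) = u ⊗ₜ 1 →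
      unfreeL hℓ h (coactL hℓ h₁ hb (x * u)) = (x * u) ⊗ₜ 1 by
    simpa using key u 1 (by
      rw [coactL_one, unfreeL_tmul, map_one, one_mul])
  intro x
  induction x using U.induction with
  | hc r =>
    intro u hu
    rw [← Algebra.smul_def, map_smul, map_smul, hu, TensorProduct.smul_tmul']
  | hE =>
    intro u hu
    rw [coactL_E, map_add, unfreeL_mul_right, unfreeL_mul_right, unfreeL_mul_left, hu, comul_E,
      add_mul, add_mul]
    simp only [Algebra.TensorProduct.tmul_mul_tmul, one_mul, mul_one, K_mul_K_neg,
      TensorProduct.tmul_neg, mul_neg]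
    abel
  | hF =>
    intro u hu
    rw [coactL_F, map_add, unfreeL_mul_right, unfreeL_mul_left, unfreeL_mul_left, hu, comul_F,
      comul_K, add_mul]
    simp only [Algebra.TensorProduct.tmul_mul_tmul, one_mul, mul_one, TensorProduct.tmul_neg,
      mul_neg, ← mul_assoc (K ℓ b _), K_neg_mul_K]
    abel
  | hK α =>
    intro u hu
    rw [coactL_K, unfreeL_mul_right, unfreeL_mul_left, hu, comul_K]
    simp only [Algebra.TensorProduct.tmul_mul_tmul, mul_one, K_mul_K_neg]
  | hmul x y hx hy =>
    intro u hu
    rw [mul_assoc]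
    exact hx _ (hy _ hu)
  | hadd x y hx hy =>
    intro u hu
    rw [add_mul, map_add, map_add, hx _ hu, hy _ hu, TensorProduct.add_tmul]

theorem unfreeL_freeL (h : a + b = c) (y : U ℓ a ⊗[ℂ] U ℓ b) :
    unfreeL hℓ h (freeL hℓ h₁ hb y) = y := by
  induction y with
  | zero => simp
  | tmul u v =>
    rw [freeL_tmul, unfreeL_mul_right, unfreeL_coactL, Algebra.TensorProduct.tmul_mul_tmul,
      mul_one, one_mul]
  | add x y hx hy => rw [map_add, map_add, hx, hy]

theorem tensorProj_coactL {u : U ℓ a} (hu : u ∈ smallU ℓ a) :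
    tensorProj ℓ c b (coactL hℓ h₁ hb u) = coactL hℓ h₁ hb u := by
  have hK : ∀ {d : Deg}, K ℓ d (-1) ∈ smallU ℓ d := fun {d} =>
    K_mem_smallU hℓ (neg_mem one_mem_smallExponents)
  suffices key : ∀ v : U ℓ a, tensorProj ℓ c b (coactL hℓ h₁ hb v) = coactL hℓ h₁ hb v →
      tensorProj ℓ c b (coactL hℓ h₁ hb (u * v)) = coactL hℓ h₁ hb (u * v) by
    have h1 := key 1 (by
      rw [coactL_one, tensorProj, TensorProduct.map_tmul, smallProj_of_mem (one_mem _),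
        smallProj_of_mem (one_mem _)])
    rwa [mul_one] at h1
  rw [smallU] at hu
  induction hu using Algebra.adjoin_induction with
  | mem x hx =>
    intro v hv
    rcases hx with rfl | rfl | rfl
    · rw [coactL_E, map_add, tensorProj_mul_tmul (one_mem _) (neg_mem (mul_mem E_mem_smallU hK)),
        tensorProj_mul_tmul (one_mem _) hK, tensorProj_tmul_mul E_mem_smallU (one_mem _), hv]
    · rw [coactL_F, map_add, tensorProj_mul_tmul (one_mem _)
        (neg_mem (mul_mem K_one_mem_smallU F_mem_smallU)), tensorProj_tmul_mul hK (one_mem _),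
        tensorProj_tmul_mul F_mem_smallU (one_mem _), hv]
    · rw [coactL_K, tensorProj_mul_tmul (one_mem _) hK,
        tensorProj_tmul_mul K_one_mem_smallU (one_mem _), hv]
  | algebraMap r => intro v hv; rw [← Algebra.smul_def, map_smul, map_smul, hv]
  | add x y _ _ hx hy => intro v hv; rw [add_mul, map_add, map_add, hx v hv, hy v hv]
  | mul x y _ _ hx hy => intro v hv; rw [mul_assoc]; exact hx _ (hy v hv)

theorem tensorProj_freeL {y : U ℓ a ⊗[ℂ] U ℓ b} (hy : tensorProj ℓ a b y = y) :
    tensorProj ℓ c b (freeL hℓ h₁ hb y) = freeL hℓ h₁ hb y := by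
  rw [← hy]
  clear hy
  induction y with
  | zero => simp
  | tmul u v =>
    have e : tensorProj ℓ a b (u ⊗ₜ v) = smallProj ℓ a u ⊗ₜ smallProj ℓ b v := rfl
    rw [e, freeL_tmul, tensorProj_mul_tmul (one_mem _) (smallProj_mem hℓ v),
      tensorProj_coactL hℓ h₁ hb (smallProj_mem hℓ u)]
  | add x y hx hy => rw [map_add, map_add, map_add, hx, hy]

end leftCoordinates

end QuantumSL2

namespace QuantumSL2

open PivotalHopfGCoalgebra

variable {ℓ : ℕ} {a b c : Deg}

/-! ### Coordinates over U_{a+b} with basis elements in the first factor -/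

section rightCoordinates

variable (hℓ : 3 ≤ ℓ) {a' : Deg} (h₂ : a' + c = b) (ha : a + a' = 0)

/-- The inverse of the antipode. -/
noncomputable def antipodeInv : U ℓ a' →ₗ[ℂ] U ℓ a :=
  (LinearEquiv.ofBijective (antipode ha)
    ((pivotalU ℓ hℓ).antipode_bijective ha)).symm.toLinearMap

theorem antipodeInv_antipode (x : U ℓ a) : antipodeInv hℓ ha (antipode ha x) = x :=
  (LinearEquiv.ofBijective (antipode ha)
    ((pivotalU ℓ hℓ).antipode_bijective ha)).symm_apply_apply x

theorem antipode_antipodeInv (x : U ℓ a') : antipode ha (antipodeInv hℓ ha x) = x :=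
  (LinearEquiv.ofBijective (antipode ha)
    ((pivotalU ℓ hℓ).antipode_bijective ha)).apply_symm_apply x

theorem antipodeInv_mul (x y : U ℓ a') :
    antipodeInv hℓ ha (x * y) = antipodeInv hℓ ha y * antipodeInv hℓ ha x := by
  rw [← antipodeInv_antipode hℓ ha (antipodeInv hℓ ha y * antipodeInv hℓ ha x), antipode_mul,
    antipode_antipodeInv, antipode_antipodeInv]

theorem antipodeInv_one : antipodeInv (ℓ := ℓ) hℓ ha 1 = 1 := by
  rw [← antipode_one ha, antipodeInv_antipode]

theorem antipodeInv_K (α : ℂ) : antipodeInv hℓ ha (K ℓ a' α) = K ℓ a (-α) := by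
  rw [← antipodeInv_antipode hℓ ha (K ℓ a (-α)), antipode_K, neg_neg]

theorem antipodeInv_E : antipodeInv hℓ ha (E ℓ a') = -(K ℓ a (-1) * E ℓ a) := by
  rw [← antipodeInv_antipode hℓ ha (-(K ℓ a (-1) * E ℓ a)), map_neg, antipode_mul, antipode_K,
    antipode_E, neg_neg, neg_mul, neg_neg, mul_assoc, K_neg_mul_K, mul_one]

theorem antipodeInv_F : antipodeInv hℓ ha (F ℓ a') = -(F ℓ a * K ℓ a 1) := by
  rw [← antipodeInv_antipode hℓ ha (-(F ℓ a * K ℓ a 1)), map_neg, antipode_mul, antipode_K,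
    antipode_F, mul_neg, neg_neg, ← mul_assoc, K_neg_mul_K, one_mul]

/-- The map `(S⁻¹ ⊗ Id) Δ_{-a,a+b} : U_b → U_a ⊗ U_{a+b}`. -/
noncomputable def coactR : U ℓ b →ₗ[ℂ] U ℓ a ⊗[ℂ] U ℓ c :=
  (antipodeInv hℓ ha).rTensor (U ℓ c) ∘ₗ (comul hℓ h₂).toLinearMap

theorem rTensor_antipodeInv_mul (p : U ℓ a') (q : U ℓ c) (x : U ℓ a' ⊗[ℂ] U ℓ c) :
    (antipodeInv hℓ ha).rTensor (U ℓ c) (p ⊗ₜ q * x) =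
      1 ⊗ₜ q * (antipodeInv hℓ ha).rTensor (U ℓ c) x * antipodeInv hℓ ha p ⊗ₜ 1 := by
  induction x with
  | zero => simp
  | tmul u v => simp [antipodeInv_mul]
  | add x y hx hy => rw [mul_add, map_add, hx, hy, map_add, mul_add, add_mul]

theorem coactR_one : coactR (ℓ := ℓ) hℓ h₂ ha 1 = 1 ⊗ₜ 1 := by
  rw [coactR, LinearMap.comp_apply, AlgHom.toLinearMap_apply, map_one,
    Algebra.TensorProduct.one_def, LinearMap.rTensor_tmul, antipodeInv_one]

theorem coactR_E (u : U ℓ b) : coactR hℓ h₂ ha (E ℓ b * u) =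
    1 ⊗ₜ E ℓ c * coactR hℓ h₂ ha u +
      1 ⊗ₜ K ℓ c 1 * coactR hℓ h₂ ha u * (-(K ℓ a (-1) * E ℓ a)) ⊗ₜ 1 := by
  simp only [coactR, LinearMap.comp_apply, AlgHom.toLinearMap_apply, map_mul, comul_E, add_mul,
    map_add, rTensor_antipodeInv_mul, antipodeInv_E, antipodeInv_one,
    ← Algebra.TensorProduct.one_def, mul_one]

theorem coactR_F (u : U ℓ b) : coactR hℓ h₂ ha (F ℓ b * u) =
    1 ⊗ₜ F ℓ c * coactR hℓ h₂ ha u * K ℓ a 1 ⊗ₜ 1 +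
      coactR hℓ h₂ ha u * (-(F ℓ a * K ℓ a 1)) ⊗ₜ 1 := by
  simp only [coactR, LinearMap.comp_apply, AlgHom.toLinearMap_apply, map_mul, comul_F, add_mul,
    map_add, rTensor_antipodeInv_mul, antipodeInv_F, antipodeInv_K, neg_neg,
    ← Algebra.TensorProduct.one_def, one_mul]

theorem coactR_K (α : ℂ) (u : U ℓ b) : coactR hℓ h₂ ha (K ℓ b α * u) =
    1 ⊗ₜ K ℓ c α * coactR hℓ h₂ ha u * K ℓ a (-α) ⊗ₜ 1 := by
  simp only [coactR, LinearMap.comp_apply, AlgHom.toLinearMap_apply, map_mul, comul_K,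
    rTensor_antipodeInv_mul, antipodeInv_K]

/-- The map `U_a ⊗ U_b → U_a ⊗ U_{a+b}`, `u ⊗ v ↦ S⁻¹(v₁) u ⊗ v₂`. -/
noncomputable def freeR : U ℓ a ⊗[ℂ] U ℓ b →ₗ[ℂ] U ℓ a ⊗[ℂ] U ℓ c :=
  TensorProduct.lift ((LinearMap.mul ℂ (U ℓ a ⊗[ℂ] U ℓ c)).flip.compl₁₂
    (Algebra.TensorProduct.includeLeft (R := ℂ) (S := ℂ) (A := U ℓ a) (B := U ℓ c)).toLinearMap
    (coactR hℓ h₂ ha))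

theorem freeR_tmul (u : U ℓ a) (v : U ℓ b) :
    freeR hℓ h₂ ha (u ⊗ₜ v) = coactR hℓ h₂ ha v * u ⊗ₜ 1 := rfl

/-- In Sweedler notation, S⁻¹(x₂v₁) x₁u ⊗ x₃v₂ = S⁻¹(v₁) u ⊗ xv₂, because S⁻¹(x₂) x₁ = ε(x). This
order of the factors is what requires the inverse antipode. -/
theorem freeR_comul_mul (h : a + b = c) (x : U ℓ c) (y : U ℓ a ⊗[ℂ] U ℓ b) :
    freeR hℓ h₂ ha (comul hℓ h x * y) = 1 ⊗ₜ x * freeR hℓ h₂ ha y := by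
  induction x using U.induction generalizing y with
  | hc r => simp [Algebra.algebraMap_eq_smul_one, ← Algebra.TensorProduct.one_def]
  | hE =>
    induction y with
    | zero => simp
    | add x y hx hy => rw [mul_add, map_add, hx, hy, map_add, mul_add]
    | tmul u v =>
      rw [comul_E, add_mul, Algebra.TensorProduct.tmul_mul_tmul,
        Algebra.TensorProduct.tmul_mul_tmul, map_add, freeR_tmul, freeR_tmul, freeR_tmul, coactR_E,
        coactR_K, one_mul, add_mul, mul_assoc _ (_ ⊗ₜ[ℂ] 1) (_ ⊗ₜ[ℂ] 1),
        mul_assoc _ (_ ⊗ₜ[ℂ] 1) (_ ⊗ₜ[ℂ] 1), Algebra.TensorProduct.tmul_mul_tmul,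
        Algebra.TensorProduct.tmul_mul_tmul, neg_mul, mul_assoc (K ℓ a (-1)), one_mul,
        TensorProduct.neg_tmul, mul_neg, neg_add_cancel_right, mul_assoc]
  | hF =>
    induction y with
    | zero => simp
    | add x y hx hy => rw [mul_add, map_add, hx, hy, map_add, mul_add]
    | tmul u v =>
      rw [comul_F, add_mul, Algebra.TensorProduct.tmul_mul_tmul,
        Algebra.TensorProduct.tmul_mul_tmul, map_add, freeR_tmul, freeR_tmul, freeR_tmul, coactR_F,
        one_mul, add_mul, mul_assoc _ (_ ⊗ₜ[ℂ] 1) (_ ⊗ₜ[ℂ] 1),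
        mul_assoc _ (_ ⊗ₜ[ℂ] 1) (_ ⊗ₜ[ℂ] 1), Algebra.TensorProduct.tmul_mul_tmul,
        Algebra.TensorProduct.tmul_mul_tmul, neg_mul, mul_assoc (F ℓ a), ← mul_assoc (K ℓ a 1),
        K_mul_K_neg, one_mul, one_mul,
        TensorProduct.neg_tmul, mul_neg, neg_add_cancel_right, mul_assoc]
  | hK α =>
    induction y with
    | zero => simp
    | add x y hx hy => rw [mul_add, map_add, hx, hy, map_add, mul_add]
    | tmul u v =>
      rw [comul_K, Algebra.TensorProduct.tmul_mul_tmul, freeR_tmul, freeR_tmul, coactR_K,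
        mul_assoc _ (_ ⊗ₜ[ℂ] 1) (_ ⊗ₜ[ℂ] 1), Algebra.TensorProduct.tmul_mul_tmul,
        ← mul_assoc (K ℓ a _), K_neg_mul_K, one_mul, one_mul, mul_assoc]
  | hmul x x' hx hx' =>
    rw [map_mul (comul hℓ h), mul_assoc, hx, hx', ← mul_assoc, Algebra.TensorProduct.tmul_mul_tmul,
      one_mul]
  | hadd x x' hx hx' => rw [map_add, add_mul, map_add, hx, hx', TensorProduct.tmul_add, add_mul]

/-- The map `U_a ⊗ U_{a+b} → U_a ⊗ U_b`, `u ⊗ x ↦ Δ(x) (u ⊗ 1)`. -/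
noncomputable def unfreeR (h : a + b = c) : U ℓ a ⊗[ℂ] U ℓ c →ₗ[ℂ] U ℓ a ⊗[ℂ] U ℓ b :=
  TensorProduct.lift ((LinearMap.mul ℂ (U ℓ a ⊗[ℂ] U ℓ b)).flip.compl₁₂
    (Algebra.TensorProduct.includeLeft (R := ℂ) (S := ℂ) (A := U ℓ a) (B := U ℓ b)).toLinearMap
    (comul hℓ h).toLinearMap)

theorem unfreeR_tmul (h : a + b = c) (u : U ℓ a) (x : U ℓ c) :
    unfreeR hℓ h (u ⊗ₜ x) = comul hℓ h x * u ⊗ₜ 1 := rfl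

theorem unfreeR_mul_left (h : a + b = c) (p : U ℓ c) (x : U ℓ a ⊗[ℂ] U ℓ c) :
    unfreeR hℓ h (1 ⊗ₜ p * x) = comul hℓ h p * unfreeR hℓ h x := by
  induction x with
  | zero => simp
  | tmul u v =>
    rw [Algebra.TensorProduct.tmul_mul_tmul, unfreeR_tmul, unfreeR_tmul, map_mul, one_mul,
      mul_assoc]
  | add x y hx hy => rw [mul_add, map_add, hx, hy, map_add, mul_add]

theorem unfreeR_mul_right (h : a + b = c) (q : U ℓ a) (x : U ℓ a ⊗[ℂ] U ℓ c) :
    unfreeR hℓ h (x * q ⊗ₜ 1) = unfreeR hℓ h x * q ⊗ₜ 1 := by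
  induction x with
  | zero => simp
  | tmul u v =>
    rw [Algebra.TensorProduct.tmul_mul_tmul, unfreeR_tmul, unfreeR_tmul, mul_assoc,
      Algebra.TensorProduct.tmul_mul_tmul, mul_one, mul_one]
  | add x y hx hy => rw [add_mul, map_add, hx, hy, map_add, add_mul]

theorem unfreeR_coactR (h : a + b = c) (u : U ℓ b) :
    unfreeR hℓ h (coactR hℓ h₂ ha u) = 1 ⊗ₜ u := by
  suffices key : ∀ x u : U ℓ b, unfreeR hℓ h (coactR hℓ h₂ ha u) = 1 ⊗ₜ u →
      unfreeR hℓ h (coactR hℓ h₂ ha (x * u)) = 1 ⊗ₜ (x * u) by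
    simpa using key u 1 (by
      rw [coactR_one, unfreeR_tmul, map_one, one_mul])
  intro x
  induction x using U.induction with
  | hc r =>
    intro u hu
    rw [← Algebra.smul_def, map_smul, map_smul, hu, TensorProduct.tmul_smul]
  | hE =>
    intro u hu
    rw [coactR_E, map_add, unfreeR_mul_right, unfreeR_mul_left, unfreeR_mul_left, hu, comul_E,
      comul_K, add_mul]
    simp only [Algebra.TensorProduct.tmul_mul_tmul, one_mul, mul_one, TensorProduct.neg_tmul,
      mul_neg, ← mul_assoc (K ℓ a _), K_mul_K_neg]
    abel
  | hF =>
    intro u hu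
    rw [coactR_F, map_add, unfreeR_mul_right, unfreeR_mul_right, unfreeR_mul_left, hu, comul_F,
      add_mul, add_mul]
    simp only [Algebra.TensorProduct.tmul_mul_tmul, one_mul, mul_one, K_neg_mul_K,
      TensorProduct.neg_tmul, mul_neg]
    abel
  | hK α =>
    intro u hu
    rw [coactR_K, unfreeR_mul_right, unfreeR_mul_left, hu, comul_K]
    simp only [Algebra.TensorProduct.tmul_mul_tmul, mul_one, K_mul_K_neg]
  | hmul x y hx hy =>
    intro u hu
    rw [mul_assoc]
    exact hx _ (hy _ hu)
  | hadd x y hx hy =>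
    intro u hu
    rw [add_mul, map_add, map_add, hx _ hu, hy _ hu, TensorProduct.tmul_add]

theorem unfreeR_freeR (h : a + b = c) (y : U ℓ a ⊗[ℂ] U ℓ b) :
    unfreeR hℓ h (freeR hℓ h₂ ha y) = y := by
  induction y with
  | zero => simp
  | tmul u v =>
    rw [freeR_tmul, unfreeR_mul_right, unfreeR_coactR, Algebra.TensorProduct.tmul_mul_tmul,
      mul_one, one_mul]
  | add x y hx hy => rw [map_add, map_add, hx, hy]

theorem tensorProj_coactR {u : U ℓ b} (hu : u ∈ smallU ℓ b) :
    tensorProj ℓ a c (coactR hℓ h₂ ha u) = coactR hℓ h₂ ha u := by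
  have hK : ∀ {d : Deg}, K ℓ d (-1) ∈ smallU ℓ d := fun {d} =>
    K_mem_smallU hℓ (neg_mem one_mem_smallExponents)
  suffices key : ∀ v : U ℓ b, tensorProj ℓ a c (coactR hℓ h₂ ha v) = coactR hℓ h₂ ha v →
      tensorProj ℓ a c (coactR hℓ h₂ ha (u * v)) = coactR hℓ h₂ ha (u * v) by
    have h1 := key 1 (by
      rw [coactR_one, tensorProj, TensorProduct.map_tmul, smallProj_of_mem (one_mem _),
        smallProj_of_mem (one_mem _)])
    rwa [mul_one] at h1
  rw [smallU] at hu
  induction hu using Algebra.adjoin_induction with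
  | mem x hx =>
    intro v hv
    rcases hx with rfl | rfl | rfl
    · rw [coactR_E, map_add, tensorProj_mul_tmul (neg_mem (mul_mem hK E_mem_smallU)) (one_mem _),
        tensorProj_tmul_mul (one_mem _) E_mem_smallU,
        tensorProj_tmul_mul (one_mem _) K_one_mem_smallU, hv]
    · rw [coactR_F, map_add, tensorProj_mul_tmul
        (neg_mem (mul_mem F_mem_smallU K_one_mem_smallU)) (one_mem _),
        tensorProj_mul_tmul K_one_mem_smallU (one_mem _),
        tensorProj_tmul_mul (one_mem _) F_mem_smallU, hv]
    · rw [coactR_K, tensorProj_mul_tmul hK (one_mem _),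
        tensorProj_tmul_mul (one_mem _) K_one_mem_smallU, hv]
  | algebraMap r => intro v hv; rw [← Algebra.smul_def, map_smul, map_smul, hv]
  | add x y _ _ hx hy => intro v hv; rw [add_mul, map_add, map_add, hx v hv, hy v hv]
  | mul x y _ _ hx hy => intro v hv; rw [mul_assoc]; exact hx _ (hy v hv)

theorem tensorProj_freeR {y : U ℓ a ⊗[ℂ] U ℓ b} (hy : tensorProj ℓ a b y = y) :
    tensorProj ℓ a c (freeR hℓ h₂ ha y) = freeR hℓ h₂ ha y := by
  rw [← hy]
  clear hy
  induction y with
  | zero => simp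
  | tmul u v =>
    have e : tensorProj ℓ a b (u ⊗ₜ v) = smallProj ℓ a u ⊗ₜ smallProj ℓ b v := rfl
    rw [e, freeR_tmul, tensorProj_mul_tmul (smallProj_mem hℓ u) (one_mem _),
      tensorProj_coactR hℓ h₂ ha (smallProj_mem hℓ v)]
  | add x y hx hy => rw [map_add, map_add, map_add, hx, hy]

end rightCoordinates

/-! ### The trace form of `Ũ_a` on `U_a` and the main identity -/

/-- The projection of `U_a` onto `Ũ_a`. -/
noncomputable def toSmallU (hℓ : 3 ≤ ℓ) (a : Deg) : U ℓ a →ₗ[ℂ] smallU ℓ a :=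
  (smallProj ℓ a).codRestrict (Subalgebra.toSubmodule (smallU ℓ a)) (smallProj_mem hℓ)

theorem coe_toSmallU (hℓ : 3 ≤ ℓ) (x : U ℓ a) : (toSmallU hℓ a x : U ℓ a) = smallProj ℓ a x := rfl

theorem toSmallU_coe (hℓ : 3 ≤ ℓ) (x : smallU ℓ a) : toSmallU hℓ a x = x :=
  Subtype.ext (smallProj_of_mem x.2)

theorem toSmallU_mul (hℓ : 3 ≤ ℓ) (x : U ℓ a) (v : smallU ℓ a) :
    toSmallU hℓ a (x * v) = toSmallU hℓ a x * v :=
  Subtype.ext (smallProj_mul_right v.2 x)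

/-- The trace of the left multiplication of `Ũ_a` by the projection of an element of `U_a`. -/
noncomputable def regularTrace (hℓ : 3 ≤ ℓ) (a : Deg) : U ℓ a →ₗ[ℂ] ℂ :=
  LinearMap.trace ℂ (smallU ℓ a) ∘ₗ LinearMap.mul ℂ (smallU ℓ a) ∘ₗ toSmallU hℓ a

theorem regularTrace_eq_sum {ι : Type*} [Fintype ι] (hℓ : 3 ≤ ℓ)
    (v : Module.Basis ι ℂ (smallU ℓ a)) (x : U ℓ a) :
    regularTrace hℓ a x = ∑ j, (v.coord j ∘ₗ toSmallU hℓ a) (x * v j) := by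
  classical
  simp only [regularTrace, LinearMap.comp_apply]
  rw [LinearMap.trace_eq_matrix_trace ℂ v, Matrix.trace]
  simp only [Matrix.diag_apply, LinearMap.toMatrix_apply, toSmallU_mul]
  rfl

theorem sum_coord_smul {ι : Type*} [Fintype ι] (hℓ : 3 ≤ ℓ)
    (v : Module.Basis ι ℂ (smallU ℓ a)) (x : U ℓ a) :
    ∑ j, (v.coord j ∘ₗ toSmallU hℓ a) x • (v j : U ℓ a) = smallProj ℓ a x := by
  have h := congrArg Subtype.val (v.sum_repr (toSmallU hℓ a x))
  rw [coe_toSmallU] at h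
  rw [← h, AddSubmonoidClass.coe_finsetSum]
  rfl

section main

variable {η : ℂ} {μ : ∀ a : Deg, U ℓ a →ₗ[ℂ] ℂ}

/-- For x in the image of `freeL`, this is the expansion of an element of U_a ⊗ U_b along the
elements 1 ⊗ v_j, with coefficients in U_{a+b}. -/
theorem sum_unfreeL {ι : Type*} [Fintype ι] (hℓ : 3 ≤ ℓ) (h : a + b = c)
    (v : Module.Basis ι ℂ (smallU ℓ b)) (x : U ℓ c ⊗[ℂ] U ℓ b) :
    ∑ j, comul hℓ h (contractRight (v.coord j ∘ₗ toSmallU hℓ b) x) * 1 ⊗ₜ (v j : U ℓ b) =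
      unfreeL hℓ h ((smallProj ℓ b).lTensor (U ℓ c) x) := by
  induction x with
  | zero => simp
  | tmul u w =>
    rw [LinearMap.lTensor_tmul, unfreeL_tmul, ← sum_coord_smul hℓ v, TensorProduct.tmul_sum,
      Finset.mul_sum]
    refine Finset.sum_congr rfl fun j _ => ?_
    rw [contractRight_tmul, map_smul, smul_mul_assoc, TensorProduct.tmul_smul, mul_smul_comm]
  | add x y hx hy =>
    simp only [map_add, add_mul, Finset.sum_add_distrib, hx, hy]

theorem sum_unfreeR {ι : Type*} [Fintype ι] (hℓ : 3 ≤ ℓ) (h : a + b = c)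
    (v : Module.Basis ι ℂ (smallU ℓ a)) (x : U ℓ a ⊗[ℂ] U ℓ c) :
    ∑ j, comul hℓ h (contractLeft (v.coord j ∘ₗ toSmallU hℓ a) x) * (v j : U ℓ a) ⊗ₜ 1 =
      unfreeR hℓ h ((smallProj ℓ a).rTensor (U ℓ c) x) := by
  induction x with
  | zero => simp
  | tmul u w =>
    rw [LinearMap.rTensor_tmul, unfreeR_tmul, ← sum_coord_smul hℓ v, TensorProduct.sum_tmul,
      Finset.mul_sum]
    refine Finset.sum_congr rfl fun j _ => ?_
    rw [contractLeft_tmul, map_smul, smul_mul_assoc, ← TensorProduct.smul_tmul', mul_smul_comm]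
  | add x y hx hy =>
    simp only [map_add, add_mul, Finset.sum_add_distrib, hx, hy]

/-- Contracting the coaction: `(μ_{a+b} ⊗ Id)(u₁ ⊗ S(u₂)) = μ_a(u) g_b`. -/
theorem IsPBWForm.contractLeft_coactL (hμ : IsPBWForm ℓ η μ) (hℓ : 3 ≤ ℓ) {b' : Deg}
    (h₁ : c + b' = a) (hb : b' + b = 0) (u : U ℓ a) :
    contractLeft (μ c) (coactL hℓ h₁ hb u) = μ a u • K ℓ b (1 - ell' ℓ) := by
  have h := hμ.contractLeft_comul hℓ h₁ u
  have h2 := contractLeft_map (μ c) LinearMap.id (antipode hb) (comul hℓ h₁ u)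
  rw [LinearMap.comp_id, h, map_smul, antipode_K, neg_neg] at h2
  exact h2

theorem IsPBWForm.contractRight_coactR (hμ : IsPBWForm ℓ η μ) (hℓ : 3 ≤ ℓ) {a' : Deg}
    (h₂ : a' + c = b) (ha : a + a' = 0) (u : U ℓ b) :
    contractRight (μ c) (coactR hℓ h₂ ha u) = μ b u • K ℓ a (-(1 - ell' ℓ)) := by
  have h := hμ.contractRight_comul hℓ h₂ u
  have h2 := contractRight_map (μ c) (antipodeInv hℓ ha) LinearMap.id (comul hℓ h₂ u)
  rw [LinearMap.comp_id, h, map_smul, antipodeInv_K] at h2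
  exact h2

/-- The left side is the trace of multiplication by X in the coordinates 1 ⊗ v_j, composed with μ_c.
Contracting the coaction produces g_b, and summing over the basis produces the regular trace of Ũ_b.
-/
theorem IsPBWForm.sum_freeL {ι : Type*} [Fintype ι] (hμ : IsPBWForm ℓ η μ) (hℓ : 3 ≤ ℓ)
    {b' : Deg} (h₁ : c + b' = a) (hb : b' + b = 0) (v : Module.Basis ι ℂ (smallU ℓ b))
    (X : U ℓ a ⊗[ℂ] U ℓ b) :
    ∑ j, μ c (contractRight (v.coord j ∘ₗ toSmallU hℓ b)
      (freeL hℓ h₁ hb (X * 1 ⊗ₜ (v j : U ℓ b)))) =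
      regularTrace hℓ b (K ℓ b (1 - ell' ℓ) * contractLeft (μ a) X) := by
  induction X with
  | zero => simp
  | tmul x y =>
    have h1 : ∀ j, μ c (contractRight (v.coord j ∘ₗ toSmallU hℓ b)
        (freeL hℓ h₁ hb (x ⊗ₜ y * 1 ⊗ₜ (v j : U ℓ b)))) =
        (v.coord j ∘ₗ toSmallU hℓ b) (K ℓ b (1 - ell' ℓ) * contractLeft (μ a) (x ⊗ₜ y) * v j) := by
      intro j
      rw [Algebra.TensorProduct.tmul_mul_tmul, mul_one, freeL_tmul, apply_contractRight_mul_right,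
        hμ.contractLeft_coactL, contractLeft_tmul, mul_smul_comm, smul_mul_assoc, smul_mul_assoc,
        mul_assoc]
    rw [Finset.sum_congr rfl fun j _ => h1 j, ← regularTrace_eq_sum]
  | add X Y hX hY =>
    simp only [add_mul, map_add, Finset.sum_add_distrib, hX, hY, mul_add]

theorem IsPBWForm.sum_freeR {ι : Type*} [Fintype ι] (hμ : IsPBWForm ℓ η μ) (hℓ : 3 ≤ ℓ)
    {a' : Deg} (h₂ : a' + c = b) (ha : a + a' = 0) (v : Module.Basis ι ℂ (smallU ℓ a))
    (X : U ℓ a ⊗[ℂ] U ℓ b) :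
    ∑ j, μ c (contractLeft (v.coord j ∘ₗ toSmallU hℓ a)
      (freeR hℓ h₂ ha (X * (v j : U ℓ a) ⊗ₜ 1))) =
      regularTrace hℓ a (K ℓ a (-(1 - ell' ℓ)) * contractRight (μ b) X) := by
  induction X with
  | zero => simp
  | tmul x y =>
    have h1 : ∀ j, μ c (contractLeft (v.coord j ∘ₗ toSmallU hℓ a)
        (freeR hℓ h₂ ha (x ⊗ₜ y * (v j : U ℓ a) ⊗ₜ 1))) =
        (v.coord j ∘ₗ toSmallU hℓ a)
          (K ℓ a (-(1 - ell' ℓ)) * contractRight (μ b) (x ⊗ₜ y) * v j) := by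
      intro j
      rw [Algebra.TensorProduct.tmul_mul_tmul, mul_one, freeR_tmul, apply_contractLeft_mul_left,
        hμ.contractRight_coactR, contractRight_tmul, mul_smul_comm, smul_mul_assoc, smul_mul_assoc,
        mul_assoc]
    rw [Finset.sum_congr rfl fun j _ => h1 j, ← regularTrace_eq_sum]
  | add X Y hX hY =>
    simp only [add_mul, map_add, Finset.sum_add_distrib, hX, hY, mul_add]

/-- For `X ∈ Ũ_a ⊗ Ũ_b` commuting with `Δ(Ũ_{a+b})`, the two ways of computing the trace of the
multiplication by `X` on `Ũ_a ⊗ Ũ_b`, as a module over `Ũ_{a+b}`, agree. -/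
theorem IsPBWForm.regularTrace_contract (hμ : IsPBWForm ℓ η μ) (hℓ : 3 ≤ ℓ) (h : a + b = c)
    {X : U ℓ a ⊗[ℂ] U ℓ b} (hX : tensorProj ℓ a b X = X)
    (hcomm : ∀ y ∈ smallU ℓ c, comul hℓ h y * X = X * comul hℓ h y) :
    regularTrace hℓ b (K ℓ b (1 - ell' ℓ) * contractLeft (μ a) X) =
      regularTrace hℓ a (K ℓ a (-(1 - ell' ℓ)) * contractRight (μ b) X) := by
  have := finite_smallU hℓ a
  have := finite_smallU hℓ b
  have h₁ : c + -b = a := by rw [← h, add_neg_cancel_right]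
  have h₂ : -a + c = b := by rw [← h, neg_add_cancel_left]
  have hb : -b + b = 0 := neg_add_cancel b
  have ha : a + -a = 0 := add_neg_cancel a
  set v := Module.finBasis ℂ (smallU ℓ b)
  set w := Module.finBasis ℂ (smallU ℓ a)
  have hone : ∀ d, smallProj ℓ d 1 = 1 := fun d => smallProj_of_mem (one_mem _)
  have hv : ∀ j, tensorProj ℓ a b (1 ⊗ₜ (v j : U ℓ b)) = 1 ⊗ₜ (v j : U ℓ b) := fun j => by
    rw [tensorProj, TensorProduct.map_tmul, hone, smallProj_of_mem (v j).2]
  have hw : ∀ j, tensorProj ℓ a b ((w j : U ℓ a) ⊗ₜ 1) = (w j : U ℓ a) ⊗ₜ 1 := fun j => by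
    rw [tensorProj, TensorProduct.map_tmul, hone, smallProj_of_mem (w j).2]
  rw [← hμ.sum_freeL hℓ h₁ hb v X, ← hμ.sum_freeR hℓ h₂ ha w X]
  refine sum_trace_eq_sum_trace (comul hℓ h) (μ c) (hμ.mul_comm hℓ)
    (f := fun j => contractRight (v.coord j ∘ₗ toSmallU hℓ b) ∘ₗ freeL hℓ h₁ hb)
    (m := fun j => 1 ⊗ₜ (v j : U ℓ b))
    (g := fun i => contractLeft (w.coord i ∘ₗ toSmallU hℓ a) ∘ₗ freeR hℓ h₂ ha)
    (n := fun i => (w i : U ℓ a) ⊗ₜ 1) (LinearMap.mulLeft ℂ X) ?_ ?_ ?_ ?_ ?_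
  · intro j x y
    rw [LinearMap.comp_apply, freeL_comul_mul, contractRight_tmul_mul, LinearMap.mulLeft_one,
      LinearMap.comp_id, LinearMap.comp_apply]
  · intro j x y
    rw [LinearMap.comp_apply, freeR_comul_mul, contractLeft_tmul_mul, LinearMap.mulLeft_one,
      LinearMap.comp_id, LinearMap.comp_apply]
  · intro i
    simp only [LinearMap.comp_apply]
    rw [sum_unfreeL, lTensor_smallProj hℓ (tensorProj_freeL hℓ h₁ hb (hw i)), unfreeL_freeL]
  · intro j
    have hXv : tensorProj ℓ a b (X * 1 ⊗ₜ (v j : U ℓ b)) = X * 1 ⊗ₜ (v j : U ℓ b) := by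
      rw [tensorProj_mul_tmul (one_mem _) (v j).2, hX]
    simp only [LinearMap.comp_apply, LinearMap.mulLeft_apply]
    rw [sum_unfreeR, rTensor_smallProj hℓ (tensorProj_freeR hℓ h₂ ha hXv), unfreeR_freeR]
  -- The transition coefficients lie in Ũ_c, so commutation of X with Δ(Ũ_c) suffices.
  · intro i j
    simp only [LinearMap.mulLeft_apply, LinearMap.comp_apply]
    rw [← mul_assoc, ← mul_assoc, hcomm]
    exact contractRight_mem_smallU hℓ _ (tensorProj_freeL hℓ h₁ hb (hw i))

end main

end QuantumSL2

namespace QuantumSL2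

open PivotalHopfGCoalgebra

variable {ℓ : ℕ} {a b c : Deg}

/-! ### The modified integral identity on the commutant -/

section modified

theorem pivot_mem_smallU (hℓ : 3 ≤ ℓ) : K ℓ a (1 - ell' ℓ) ∈ smallU ℓ a :=
  K_mem_smallU hℓ (mem_smallExponents.2 ⟨1 - ell' ℓ, 0, by push_cast; ring⟩)

theorem pivot_inv_mem_smallU (hℓ : 3 ≤ ℓ) : K ℓ a (-(1 - ell' ℓ)) ∈ smallU ℓ a :=
  K_mem_smallU hℓ (mem_smallExponents.2 ⟨-(1 - ell' ℓ), 0, by push_cast; ring⟩)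

/-- The coproduct maps Ũ_c into the algebra generated by the tensors p ⊗ q with p ∈ Ũ_a and q ∈ Ũ_b,
so it is enough to check such tensors. -/
theorem comul_smallU_induction (hℓ : 3 ≤ ℓ) (h : a + b = c) {P : U ℓ a ⊗[ℂ] U ℓ b → Prop}
    (htmul : ∀ p ∈ smallU ℓ a, ∀ q ∈ smallU ℓ b, P (p ⊗ₜ q))
    (hadd : ∀ x y, P x → P y → P (x + y)) (hmul : ∀ x y, P x → P y → P (x * y))
    {y : U ℓ c} (hy : y ∈ smallU ℓ c) : P (comul hℓ h y) := by
  have hK : ∀ {d : Deg}, K ℓ d (-1) ∈ smallU ℓ d := fun {d} =>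
    K_mem_smallU hℓ (neg_mem one_mem_smallExponents)
  induction hy using Algebra.adjoin_induction with
  | mem x hx =>
    obtain rfl | rfl | rfl := hx
    · rw [comul_E]
      exact hadd _ _ (htmul _ (one_mem _) _ E_mem_smallU)
        (htmul _ E_mem_smallU _ K_one_mem_smallU)
    · rw [comul_F]
      exact hadd _ _ (htmul _ hK _ F_mem_smallU) (htmul _ F_mem_smallU _ (one_mem _))
    · rw [comul_K]
      exact htmul _ K_one_mem_smallU _ K_one_mem_smallU
  | algebraMap r =>
    rw [AlgHom.commutes, Algebra.TensorProduct.algebraMap_apply]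
    exact htmul _ (algebraMap_mem _ r) _ (one_mem _)
  | add x y _ _ hx hy => rw [map_add]; exact hadd _ _ hx hy
  | mul x y _ _ hx hy => rw [map_mul]; exact hmul _ _ hx hy

theorem tensorProj_comul_mul (hℓ : 3 ≤ ℓ) (h : a + b = c) {y : U ℓ c} (hy : y ∈ smallU ℓ c)
    (x : U ℓ a ⊗[ℂ] U ℓ b) :
    tensorProj ℓ a b (comul hℓ h y * x) = comul hℓ h y * tensorProj ℓ a b x := by
  revert x
  refine comul_smallU_induction hℓ h
    (P := fun w => ∀ x, tensorProj ℓ a b (w * x) = w * tensorProj ℓ a b x)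
    (fun p hp q hq x => tensorProj_tmul_mul hp hq x) (fun u v hu hv x => ?_)
    (fun u v hu hv x => ?_) hy
  · rw [add_mul, map_add, hu, hv, add_mul]
  · rw [mul_assoc, hu, hv, mul_assoc]

theorem tensorProj_mul_comul (hℓ : 3 ≤ ℓ) (h : a + b = c) {y : U ℓ c} (hy : y ∈ smallU ℓ c)
    (x : U ℓ a ⊗[ℂ] U ℓ b) :
    tensorProj ℓ a b (x * comul hℓ h y) = tensorProj ℓ a b x * comul hℓ h y := by
  revert x
  refine comul_smallU_induction hℓ h
    (P := fun w => ∀ x, tensorProj ℓ a b (x * w) = tensorProj ℓ a b x * w)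
    (fun p hp q hq x => tensorProj_mul_tmul hp hq x) (fun u v hu hv x => ?_)
    (fun u v hu hv x => ?_) hy
  · rw [mul_add, map_add, hu, hv, mul_add]
  · rw [← mul_assoc, hv, hu, mul_assoc]

theorem center_smallU_mul_comm (z : Subalgebra.center ℂ (smallU ℓ a)) {y : U ℓ a}
    (hy : y ∈ smallU ℓ a) : ((z : smallU ℓ a) : U ℓ a) * y = y * (z : smallU ℓ a) :=
  (congrArg Subtype.val (Subalgebra.mem_center_iff.1 z.2 ⟨y, hy⟩)).symm

theorem tmul_center_mul_comul (hℓ : 3 ≤ ℓ) (h : a + b = c)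
    (z : Subalgebra.center ℂ (smallU ℓ a)) (z' : Subalgebra.center ℂ (smallU ℓ b))
    {y : U ℓ c} (hy : y ∈ smallU ℓ c) :
    ((z : smallU ℓ a) : U ℓ a) ⊗ₜ[ℂ] ((z' : smallU ℓ b) : U ℓ b) * comul hℓ h y =
      comul hℓ h y * ((z : smallU ℓ a) : U ℓ a) ⊗ₜ[ℂ] ((z' : smallU ℓ b) : U ℓ b) := by
  refine comul_smallU_induction hℓ h (P := fun w => _ * w = w * _)
    (fun p hp q hq => ?_) (fun u v hu hv => ?_) (fun u v hu hv => ?_) hy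
  · rw [Algebra.TensorProduct.tmul_mul_tmul, Algebra.TensorProduct.tmul_mul_tmul,
      center_smallU_mul_comm z hp, center_smallU_mul_comm z' hq]
  · rw [mul_add, hu, hv, add_mul]
  · rw [← mul_assoc, hu, mul_assoc, hv, mul_assoc]

/-- Being central in Ũ_a, z can be moved to the front, where its defining property converts the
regular trace into μ. -/
theorem Represents.regularTrace_mul (hℓ : 3 ≤ ℓ) {μ : U ℓ a →ₗ[ℂ] ℂ}
    {z : Subalgebra.center ℂ (smallU ℓ a)} (hz : Represents ℓ a μ z) {k x : U ℓ a}
    (hk : k ∈ smallU ℓ a) (hx : x ∈ smallU ℓ a) :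
    regularTrace hℓ a (k * ((z : smallU ℓ a) * x)) = μ (k * x) := by
  have h := hz (⟨k, hk⟩ * ⟨x, hx⟩)
  rw [← mul_assoc, ← center_smallU_mul_comm z hk, mul_assoc]
  refine Eq.trans ?_ h.symm
  have h2 := toSmallU_coe hℓ ((z : smallU ℓ a) * (⟨k, hk⟩ * ⟨x, hx⟩))
  change LinearMap.trace ℂ _ (LinearMap.mul ℂ (smallU ℓ a) (toSmallU hℓ a _)) = _
  exact congrArg (fun w => LinearMap.trace ℂ _ (LinearMap.mul ℂ (smallU ℓ a) w)) h2

theorem IsPBWForm.mulLeft_comp_smallProj {η : ℂ} {μ : ∀ a : Deg, U ℓ a →ₗ[ℂ] ℂ}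
    (hμ : IsPBWForm ℓ η μ) (hℓ : 3 ≤ ℓ) {k : U ℓ a} (hk : k ∈ smallU ℓ a) :
    (μ a ∘ₗ LinearMap.mulLeft ℂ k) ∘ₗ smallProj ℓ a = μ a ∘ₗ LinearMap.mulLeft ℂ k := by
  ext x
  simp only [LinearMap.comp_apply, LinearMap.mulLeft_apply]
  rw [← smallProj_mul_left hk, hμ.map_smallProj hℓ]

/-- Contracting one factor of an element of the commutant and applying the modified form to the
result does not depend on the factor. -/
theorem IsPBWForm.modified_contract {η : ℂ} {μ : ∀ a : Deg, U ℓ a →ₗ[ℂ] ℂ}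
    (hμ : IsPBWForm ℓ η μ) (hℓ : 3 ≤ ℓ)
    {z : Subalgebra.center ℂ (smallU ℓ a)} {z' : Subalgebra.center ℂ (smallU ℓ b)}
    (hz : Represents ℓ a (μ a) z) (hz' : Represents ℓ b (μ b) z') {x : U ℓ a ⊗[ℂ] U ℓ b}
    (hx : ∀ y : U ℓ (a + b), comul hℓ rfl y * x = x * comul hℓ rfl y) :
    μ b ((z' : smallU ℓ b) *
        contractLeft (μ a ∘ₗ LinearMap.mulLeft ℂ (K ℓ a (-(1 - ell' ℓ)))) x) =
      μ a ((z : smallU ℓ a) * contractRight (μ b ∘ₗ LinearMap.mulLeft ℂ (K ℓ b (1 - ell' ℓ))) x) := by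
  have hzm := (z : smallU ℓ a).2
  have hzm' := (z' : smallU ℓ b).2
  -- The trace argument takes place in Ũ_a ⊗ Ũ_b. The projected element still commutes with
  -- Δ(Ũ_{a+b}) because the projection is a map of bimodules.
  set x₀ := tensorProj ℓ a b x with hx₀
  have hproj : tensorProj ℓ a b x₀ = x₀ := tensorProj_tensorProj hℓ x
  have key := hμ.regularTrace_contract hℓ rfl
    (X := ((z : smallU ℓ a) : U ℓ a) ⊗ₜ[ℂ] ((z' : smallU ℓ b) : U ℓ b) * x₀)
    (by rw [tensorProj_tmul_mul hzm hzm', hproj]) (fun y hy => by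
      rw [← mul_assoc, ← tmul_center_mul_comul hℓ rfl z z' hy, mul_assoc, mul_assoc, hx₀,
        ← tensorProj_comul_mul hℓ rfl hy, ← tensorProj_mul_comul hℓ rfl hy, hx])
  rw [contractLeft_tmul_mul, contractRight_tmul_mul,
    hz'.regularTrace_mul hℓ (pivot_mem_smallU hℓ) (contractLeft_mem_smallU hℓ _ hproj),
    hz.regularTrace_mul hℓ (pivot_inv_mem_smallU hℓ) (contractRight_mem_smallU hℓ _ hproj)] at key
  -- Since μ factors through the projection onto the small algebra, replacing x by x₀ does not
  -- change these values.
  have hl : ∀ {p : U ℓ a} {q : U ℓ b}, p ∈ smallU ℓ a → q ∈ smallU ℓ b →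
      μ b (q * contractLeft (μ a ∘ₗ LinearMap.mulLeft ℂ p) x₀) =
        μ b (q * contractLeft (μ a ∘ₗ LinearMap.mulLeft ℂ p) x) := by
    intro p q hp hq
    rw [hx₀, tensorProj, contractLeft_map, hμ.mulLeft_comp_smallProj hℓ hp]
    exact LinearMap.congr_fun (hμ.mulLeft_comp_smallProj hℓ hq) _
  have hr : ∀ (p : U ℓ a) (q : U ℓ b),
      μ b (q * contractLeft (μ a ∘ₗ LinearMap.mulLeft ℂ p) x) =
        μ a (p * contractRight (μ b ∘ₗ LinearMap.mulLeft ℂ q) x) := fun p q =>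
    apply_contractLeft (μ a ∘ₗ LinearMap.mulLeft ℂ p) (μ b ∘ₗ LinearMap.mulLeft ℂ q) x
  have hr₀ : ∀ (p : U ℓ a) (q : U ℓ b),
      μ b (q * contractLeft (μ a ∘ₗ LinearMap.mulLeft ℂ p) x₀) =
        μ a (p * contractRight (μ b ∘ₗ LinearMap.mulLeft ℂ q) x₀) := fun p q =>
    apply_contractLeft (μ a ∘ₗ LinearMap.mulLeft ℂ p) (μ b ∘ₗ LinearMap.mulLeft ℂ q) x₀
  -- At this point `key` equates the values at x₀ of μ_a L_z ⊗ μ_b L_{g_b} and μ_a L_{g_a⁻¹} ⊗ μ_b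
  -- L_{z'}. What remains is to choose the order of contraction on each side and return to x.
  rw [hl hzm (pivot_mem_smallU hℓ), hr, ← hr₀, hl (pivot_inv_mem_smallU hℓ) hzm'] at key
  exact key.symm

end modified

end QuantumSL2

/-! ### Assembly of the theorem -/

theorem theoremT (ℓ : ℕ) (hℓ : 3 ≤ ℓ) (η : ℂ) (hη : η ≠ 0) :
    (∃! μ : ∀ a : QuantumSL2.Deg, QuantumSL2.U ℓ a →ₗ[ℂ] ℂ, QuantumSL2.IsPBWForm ℓ η μ) ∧
    ∀ μ : ∀ a : QuantumSL2.Deg, QuantumSL2.U ℓ a →ₗ[ℂ] ℂ, QuantumSL2.IsPBWForm ℓ η μ →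
      (QuantumSL2.pivotalU ℓ hℓ).IsSymmetrizedIntegral μ ∧
      (∀ a ∈ QuantumSL2.genericDeg ℓ, ∃! z : Subalgebra.center ℂ (QuantumSL2.smallU ℓ a),
        QuantumSL2.Represents ℓ a (μ a) z) ∧
      ∀ z : ∀ a : QuantumSL2.genericDeg ℓ, Subalgebra.center ℂ (QuantumSL2.smallU ℓ a),
        (∀ a : QuantumSL2.genericDeg ℓ, QuantumSL2.Represents ℓ a (μ a) (z a)) →
        (QuantumSL2.pivotalU ℓ hℓ).IsModifiedSymmetrizedIntegral μ (QuantumSL2.genericDeg ℓ)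
          (fun a => QuantumSL2.modifiedForm ℓ a (μ a) (z a : QuantumSL2.smallU ℓ a)) := by
  obtain ⟨μ₀, hμ₀⟩ := QuantumSL2.exists_isPBWForm hℓ η
  refine ⟨⟨μ₀, hμ₀, fun μ hμ => hμ.unique hμ₀⟩, fun μ hμ =>
    ⟨hμ.isSymmetrizedIntegral hℓ, fun a ha => hμ.existsUnique_represents hℓ ha,
      fun z hz a b x hx => ?_⟩⟩
  have hx' : ∀ y : QuantumSL2.U ℓ ((a : QuantumSL2.Deg) + b),
      QuantumSL2.comul hℓ rfl y * x = x * QuantumSL2.comul hℓ rfl y := fun y =>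
    Subalgebra.mem_centralizer_iff ℂ |>.1 hx _ ⟨y, rfl⟩
  exact ⟨QuantumSL2.contractLeft_mem_center hℓ (hμ.mul_comm hℓ) hx',
    QuantumSL2.contractRight_mem_center hℓ (hμ.mul_comm hℓ) hx',
    hμ.modified_contract hℓ (hz a) (hz b) hx'⟩
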